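/- Let $F$ be an algebraically closed field, and let $n,d,r,\ell$ be nonnegative integers with $d>r$. Let $M^n_d$ be the space of morphisms $f=(f_0:\dots:f_n):\mathbb P^1\to\mathbb P^n$ of degree $d$ over $F$; it is the set of $(n+1)$-tuples of binary forms of degree $d$ without common zero, up to a common nonzero scalar, with the Zariski topology as an open subset of $\mathbb P^{(n+1)(d+1)-1}$. Let $V\subset M^n_d$ be the Severi locus of all $f$ that are birational onto their image $C=f(\mathbb P^1)$ and for which the reduced curve $C$ has exactly one singular point $q$, and $q$ is an $r$-tuple point of embedding dimension $\ell$. The last condition means that $C$ has exactly $r$ branches at $q$ (that is, $f^{-1}(q)$ consists of $r$ points), that each of them is smooth (that is, the differential of $f$ is nonzero at each of these $r$ points), and that the tangent lines to these branches at $q$ are pairwise distinct and together span a linear subspace of dimension $\ell$ of the tangent space $T_q\mathbb P^n$. Then every irreducible component of the closure of $V$ in $M^n_d$ has codimension at most $$(n-\ell)(r-\ell)+(r-1)n-r$$ in $M^n_d$. (There is nothing to prove if $V$ is empty.) -/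

import Mathlib

open MvPolynomial

noncomputable section

namespace RationalCurve

/-- The projective space of lines in `F ^ ι`; its points are used through homogeneous coordinates. -/
abbrev Proj (F : Type*) [Field F] (ι : Type*) : Type _ := Projectivization F (ι → F)

/-- The Zariski topology on a projective space: the nonvanishing loci of homogeneous polynomials
form a basis of open sets.  (Whether a homogeneous polynomial vanishes at a point does not depend
on the choice of homogeneous coordinates.) -/
abbrev zariskiTopology (F : Type*) [Field F] (ι : Type*) : TopologicalSpace (Proj F ι) :=
  TopologicalSpace.generateFrom
    {U | ∃ (G : MvPolynomial ι F) (k : ℕ), G.IsHomogeneous k ∧ U = {x | eval x.rep G ≠ 0}}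

/-- The binary form `∑ₖ aₖ s ^ (d - k) t ^ k` of degree `d`, where `s = X 0` and `t = X 1`. -/
def binaryForm {F : Type*} [Field F] {d : ℕ} (a : Fin (d + 1) → F) : MvPolynomial (Fin 2) F :=
  ∑ k : Fin (d + 1), C (a k) * X 0 ^ (d - (k : ℕ)) * X 1 ^ (k : ℕ)

/-- The space of morphisms `ℙ¹ → ℙⁿ` of degree `d`.  Such a morphism is given by `n + 1` binary
forms of degree `d` without a common zero, and these are unique up to a common nonzero scalar; so
the space is an open subset of the projective space of `(n + 1) × (d + 1)` coefficient matrices. -/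
def Mor (F : Type*) [Field F] (n d : ℕ) : Type _ :=
  {a : Proj F (Fin (n + 1) × Fin (d + 1)) //
    ∀ p : Proj F (Fin 2), ∃ i, eval p.rep (binaryForm fun k => a.rep (i, k)) ≠ 0}

instance (F : Type*) [Field F] (n d : ℕ) : TopologicalSpace (Mor F n d) :=
  (zariskiTopology F (Fin (n + 1) × Fin (d + 1))).induced Subtype.val

namespace Mor

variable {F : Type*} [Field F] {n d : ℕ}

/-- The homogeneous components `f₀, …, fₙ` of a morphism (for a choice of the common scalar). -/
def comp (f : Mor F n d) (i : Fin (n + 1)) : MvPolynomial (Fin 2) F :=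
  binaryForm fun k => f.1.rep (i, k)

/-- The value `(f₀(p) : … : fₙ(p))` of a morphism at a point `p` of `ℙ¹`. -/
def toFun (f : Mor F n d) (p : Proj F (Fin 2)) : Proj F (Fin (n + 1)) :=
  Projectivization.mk F (fun i => eval p.rep (f.comp i)) fun h => by
    obtain ⟨i, hi⟩ := f.2 p
    exact hi (congrFun h i)

/-- The image curve of a morphism. -/
def image (f : Mor F n d) : Set (Proj F (Fin (n + 1))) := Set.range f.toFun

/-- The morphism is birational onto its image, that is, it parametrizes its image: the rational
functions `fᵢ / fⱼ`, which generate the function field of the image, generate the function field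
`F(t)` of `ℙ¹`, where `(1 : t)` is the affine coordinate. -/
def IsBirational (f : Mor F n d) : Prop :=
  IntermediateField.adjoin F
    {g : RatFunc F | ∃ i j, f.comp j ≠ 0 ∧
      g = aeval ![1, RatFunc.X] (f.comp i) / aeval ![1, RatFunc.X] (f.comp j)} = ⊤

/-- The tangent line at `f p` to the branch of the image that is parametrized near `p`, as a linear
subspace of `F ^ (n + 1)`: the span of `(fᵢ(p))ᵢ`, `(∂ₛ fᵢ(p))ᵢ` and `(∂ₜ fᵢ(p))ᵢ`.  It contains the
line `f p`, and its quotient by that line is the image of the differential of `f` at `p`.  So it has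
dimension `2` if the differential is not zero, that is, if the branch is smooth, and dimension `1`
otherwise. -/
def branchTangent (f : Mor F n d) (p : Proj F (Fin 2)) : Submodule F (Fin (n + 1) → F) :=
  Submodule.span F
    (insert (fun i => eval p.rep (f.comp i))
      (Set.range fun (j : Fin 2) (i : Fin (n + 1)) => eval p.rep (pderiv j (f.comp i))))

end Mor

variable {F : Type*} [Field F] {n d : ℕ}

/-- The projective Zariski tangent space at `q` of a subset `Z` of `ℙⁿ` (with its reduced
structure), as a linear subspace of `F ^ (n + 1)`: the common kernel of the differentials at `q` of
the homogeneous polynomials that vanish on `Z`. -/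
def zariskiTangent (Z : Set (Proj F (Fin (n + 1)))) (q : Proj F (Fin (n + 1))) :
    Submodule F (Fin (n + 1) → F) where
  carrier := {v | ∀ (G : MvPolynomial (Fin (n + 1)) F) (k : ℕ), G.IsHomogeneous k →
    (∀ x ∈ Z, eval x.rep G = 0) → ∑ i, eval q.rep (pderiv i G) * v i = 0}
  zero_mem' := by
    intro G k _ _
    simp
  add_mem' := by
    intro v w hv hw G k hG hZ
    simp [mul_add, Finset.sum_add_distrib, hv G k hG hZ, hw G k hG hZ]
  smul_mem' := by
    intro c v hv G k hG hZ
    have h := hv G k hG hZ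
    simp only [Pi.smul_apply, smul_eq_mul, mul_left_comm _ c, ← Finset.mul_sum, h, mul_zero]

/-- The singular locus of a projective curve `Z`: the points at which the projective Zariski tangent
space is not a line, that is, does not have linear dimension `2`. -/
def singularLocus (Z : Set (Proj F (Fin (n + 1)))) : Set (Proj F (Fin (n + 1))) :=
  {q ∈ Z | Module.finrank F (zariskiTangent Z q) ≠ 2}

/-- The point `q` of the image of `f` (which is birational onto its image, so that the branches of
the image at `q` correspond to the points of `ℙ¹` over `q`) is an `r`-tuple point of embedding
dimension `ℓ`: there are `r` branches at `q`, all smooth, and their tangent lines are distinct and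
span a linear space of dimension `ℓ` in the tangent space of `ℙⁿ` at `q`. -/
def IsMultiplePoint (f : Mor F n d) (q : Proj F (Fin (n + 1))) (r ℓ : ℕ) : Prop :=
  (f.toFun ⁻¹' {q}).encard = r ∧
  (∀ p ∈ f.toFun ⁻¹' {q}, Module.finrank F (f.branchTangent p) = 2) ∧
  Set.InjOn f.branchTangent (f.toFun ⁻¹' {q}) ∧
  Module.finrank F (⨆ p ∈ f.toFun ⁻¹' {q}, f.branchTangent p : Submodule F (Fin (n + 1) → F))
    = ℓ + 1

/-- The Severi locus: the morphisms of degree `d` that are birational onto their image, and whose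
image has exactly one singular point, which is an `r`-tuple point of embedding dimension `ℓ`. -/
def severi (F : Type*) [Field F] (n d r ℓ : ℕ) : Set (Mor F n d) :=
  {f | f.IsBirational ∧ ∃ q, singularLocus f.image = {q} ∧ IsMultiplePoint f q r ℓ}

/-- `Z` is an irreducible component of the closure of the subset `V`. -/
def IsComponent {X : Type*} [TopologicalSpace X] (V : Set X)
    (Z : TopologicalSpace.IrreducibleCloseds X) : Prop :=
  Maximal (fun Y : TopologicalSpace.IrreducibleCloseds X => (Y : Set X) ⊆ closure V) Z

/-- The codimension of an irreducible closed subset: the supremum of the lengths of the chains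
`Z = Z₀ ⊊ Z₁ ⊊ … ⊊ Z_c` of irreducible closed subsets. -/
def codim {X : Type*} [TopologicalSpace X] (Z : TopologicalSpace.IrreducibleCloseds X) : ℕ∞ :=
  Order.coheight Z

end RationalCurve

end

/-! A morphism in the Severi locus can be written f = A b + h g, where A is the multiple point, h is
the form of degree r whose roots are the points over A, b is a form of degree d, and g is a vector
of forms of degree d - r. At the roots of h the values of g are the tangent directions modulo A, so
they span a space of dimension ℓ. Let B_1, …, B_ℓ be a basis of it. Then g - ∑ B_j c_j vanishes at
the roots of h for suitable forms c_j, hence f = A b + h ∑ B_j c_j + h² k, with k absent if 2r > d.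
The data (A, b, h, B, c, k) form the affine space of functions on `Param`.

Conversely, parameters in a Zariski open set (`IsAdmissible`, `zOpen_isAdmissible`) give morphisms
in the locus (`IsAdmissible.mem_severi`), and every morphism in the locus arises from admissible
parameters (`exists_isAdmissible_of_mem_severi`). So the locus is irreducible, a component Z of its
closure contains all of it, and every polynomial in the cone ideal of Z vanishes on the whole image
of the parametrization. The codimension of Z is at most the height of this prime
(`codim_le_height_coneIdeal`).

The parametrization is redundant: A and h can be rescaled, GL_ℓ acts on B and c, and multiples of h
can be moved between b, c and k. Fixing n + 1 - (n - ℓ) = ℓ + 1 rows of B and k, one coordinate of A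
and one coefficient of h leaves a slice on which the differential is injective
(`IsAdmissible.eq_zero_of_paramDeriv`). An injective differential bounds the height by the number of
ambient coordinates minus the dimension of the slice, in every characteristic
(`height_add_card_le_of_curves`), and counting coordinates gives the bound.

Two ingredients need work. Openness involves conditions at all points and pairs of points of the
projective line; it follows from elimination (`ZOpen.forall_ne_zero`), with Bezoutians to treat
pairs up to the diagonal. And singular points are defined by Zariski tangent spaces: for a
birational morphism, the image is nonsingular at a point exactly if a single smooth branch passes
through it (`Mor.finrank_zariskiTangent_of_unibranch`, `Mor.unibranch_of_finrank_zariskiTangent`).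
-/

noncomputable section

namespace RationalCurve

/-! ### Zariski open conditions on affine space and elimination -/

section ZariskiOpen

variable {F : Type*} [Field F] {ι κ : Type*}

/-- Functions on affine space that are given by a polynomial. -/
def IsPolyFun (φ : (ι → F) → F) : Prop := ∃ P : MvPolynomial ι F, ∀ v, φ v = eval v P

namespace IsPolyFun

lemma of_eval (P : MvPolynomial ι F) : IsPolyFun fun v => eval v P := ⟨P, fun _ => rfl⟩

lemma const (c : F) : IsPolyFun fun _ : ι → F => c := ⟨C c, by simp⟩

lemma coord (i : ι) : IsPolyFun fun v : ι → F => v i := ⟨X i, by simp⟩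

lemma add {φ ψ : (ι → F) → F} (hφ : IsPolyFun φ) (hψ : IsPolyFun ψ) :
    IsPolyFun fun v => φ v + ψ v := by
  obtain ⟨P, hP⟩ := hφ
  obtain ⟨Q, hQ⟩ := hψ
  exact ⟨P + Q, by simp [hP, hQ]⟩

lemma mul {φ ψ : (ι → F) → F} (hφ : IsPolyFun φ) (hψ : IsPolyFun ψ) :
    IsPolyFun fun v => φ v * ψ v := by
  obtain ⟨P, hP⟩ := hφ
  obtain ⟨Q, hQ⟩ := hψ
  exact ⟨P * Q, by simp [hP, hQ]⟩

lemma sub {φ ψ : (ι → F) → F} (hφ : IsPolyFun φ) (hψ : IsPolyFun ψ) :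
    IsPolyFun fun v => φ v - ψ v := by
  obtain ⟨P, hP⟩ := hφ
  obtain ⟨Q, hQ⟩ := hψ
  exact ⟨P - Q, by simp [hP, hQ]⟩

lemma pow {φ : (ι → F) → F} (hφ : IsPolyFun φ) (k : ℕ) : IsPolyFun fun v => φ v ^ k := by
  obtain ⟨P, hP⟩ := hφ
  exact ⟨P ^ k, by simp [hP]⟩

lemma sum {α : Type*} (s : Finset α) {φ : α → (ι → F) → F} (hφ : ∀ a ∈ s, IsPolyFun (φ a)) :
    IsPolyFun fun v => ∑ a ∈ s, φ a v := by
  choose! P hP using hφ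
  refine ⟨∑ a ∈ s, P a, fun v => ?_⟩
  rw [map_sum]
  exact Finset.sum_congr rfl fun a ha => hP a ha v

lemma prod {α : Type*} (s : Finset α) {φ : α → (ι → F) → F} (hφ : ∀ a ∈ s, IsPolyFun (φ a)) :
    IsPolyFun fun v => ∏ a ∈ s, φ a v := by
  choose! P hP using hφ
  refine ⟨∏ a ∈ s, P a, fun v => ?_⟩
  rw [map_prod]
  exact Finset.prod_congr rfl fun a ha => hP a ha v

lemma comp {φ : (κ → F) → F} (hφ : IsPolyFun φ) {g : (ι → F) → κ → F}
    (hg : ∀ k, IsPolyFun fun v => g v k) : IsPolyFun fun v => φ (g v) := by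
  obtain ⟨P, hP⟩ := hφ
  choose Q hQ using hg
  refine ⟨bind₁ Q P, fun v => ?_⟩
  change φ (g v) = _
  rw [hP, ← aeval_eq_eval, ← aeval_eq_eval, aeval_bind₁]
  congr 2
  ext k
  exact hQ k v

lemma det {m : Type*} [Fintype m] [DecidableEq m] {M : (ι → F) → Matrix m m F}
    (hM : ∀ i j, IsPolyFun fun v => M v i j) : IsPolyFun fun v => (M v).det := by
  simp only [Matrix.det_apply', ]
  exact sum _ fun σ _ => mul (const _) (prod _ fun i _ => hM _ _)

end IsPolyFun

/-- Zariski open subsets of affine space. -/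
def ZOpen (S : Set (ι → F)) : Prop :=
  ∀ u ∈ S, ∃ P : MvPolynomial ι F, eval u P ≠ 0 ∧ ∀ v, eval v P ≠ 0 → v ∈ S

lemma ZOpen.inter {S T : Set (ι → F)} (hS : ZOpen S) (hT : ZOpen T) : ZOpen (S ∩ T) := by
  rintro u ⟨hu, hu'⟩
  obtain ⟨P, hP, hP'⟩ := hS u hu
  obtain ⟨Q, hQ, hQ'⟩ := hT u hu'
  refine ⟨P * Q, by simp [hP, hQ], fun v hv => ?_⟩
  rw [map_mul] at hv
  exact ⟨hP' v (left_ne_zero_of_mul hv), hQ' v (right_ne_zero_of_mul hv)⟩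

lemma ZOpen.exists_ne_zero {α : Type*} {φ : α → (ι → F) → F} (hφ : ∀ a, IsPolyFun (φ a)) :
    ZOpen {v | ∃ a, φ a v ≠ 0} := by
  rintro u ⟨a, ha⟩
  obtain ⟨P, hP⟩ := hφ a
  exact ⟨P, by rwa [← hP], fun v hv => ⟨a, by rwa [hP]⟩⟩

lemma ZOpen.ne_zero {φ : (ι → F) → F} (hφ : IsPolyFun φ) : ZOpen {v | φ v ≠ 0} := by
  intro u ha
  obtain ⟨P, hP⟩ := hφ
  exact ⟨P, by rwa [← hP], fun v hv => by
    change φ v ≠ 0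
    rwa [hP]⟩

/-- Linear independence of a finite family of vectors is an open condition. -/
lemma ZOpen.linearIndependent {m n : Type*} [Fintype m] [Fintype n]
    {M : (ι → F) → m → n → F} (hM : ∀ i j, IsPolyFun fun v => M v i j) :
    ZOpen {v | LinearIndependent F (M v)} := by
  classical
  intro u hu
  -- A left inverse g is fixed at u. The determinant of g applied to the rows of M v is polynomial
  -- in v, equals 1 at u, and forces independence wherever it is nonzero.
  obtain ⟨g, hg⟩ := LinearMap.exists_leftInverse_of_injective (Fintype.linearCombination F (M u))
    (LinearMap.ker_eq_bot.2 (linearIndependent_iff_injective_fintypeLinearCombination.1 hu))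
  have hgu (i : m) : g (M u i) = Pi.single i 1 := by
    have := LinearMap.congr_fun hg (Pi.single i 1)
    simpa using this
  have hpoly : IsPolyFun fun v => (Matrix.of fun i k => g (M v i) k).det := by
    refine IsPolyFun.det fun i k => ?_
    simp only [Matrix.of_apply]
    have (v : ι → F) : g (M v i) k = ∑ j, M v i j * g (Pi.single j 1) k := by
      conv_lhs => rw [pi_eq_sum_univ (M v i), map_sum, Finset.sum_apply]
      refine Finset.sum_congr rfl fun j _ => ?_
      rw [map_smul, Pi.smul_apply, smul_eq_mul]
      congr 2
      refine congrFun (congrArg g (funext fun l => ?_)) k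
      simp [Pi.single_apply, eq_comm]
    simp only [this]
    exact IsPolyFun.sum _ fun j _ => (hM i j).mul (IsPolyFun.const _)
  have hu' : (Matrix.of fun i k => g (M u i) k).det ≠ 0 := by
    have : (Matrix.of fun i k => g (M u i) k) = 1 := by
      ext i k
      simp [hgu, Matrix.one_apply, Pi.single_apply, eq_comm]
    rw [this, Matrix.det_one]
    exact one_ne_zero
  obtain ⟨P, hP, hP'⟩ := ZOpen.ne_zero hpoly u hu'
  refine ⟨P, hP, fun v hv => ?_⟩
  have h1 := Matrix.linearIndependent_rows_of_isUnit
    ((Matrix.isUnit_iff_isUnit_det _).2 (hP' v hv).isUnit)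
  exact LinearIndependent.of_comp g h1

/-- The projection along a projective line is closed. -/
theorem ZOpen.forall_ne_zero [IsAlgClosed F] {S : Set (ι ⊕ Fin 2 → F)} (hS : ZOpen S)
    (hsmul : ∀ (u : ι → F) (x : Fin 2 → F) (c : F), c ≠ 0 → Sum.elim u x ∈ S →
      Sum.elim u (c • x) ∈ S) :
    ZOpen {u : ι → F | ∀ x : Fin 2 → F, x ≠ 0 → Sum.elim u x ∈ S} := by
  intro u hu
  have hne (t : F) : (![1, t] : Fin 2 → F) ≠ 0 := fun h => one_ne_zero (congrFun h 0)
  have hne' (t : F) : (![t, 1] : Fin 2 → F) ≠ 0 := fun h => one_ne_zero (congrFun h 1)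
  -- One polynomial for each point (1 : t), and Q for the remaining point (0 : 1).
  choose P hP hPS using fun t : F => hS _ (hu _ (hne t))
  obtain ⟨Q, hQ, hQS⟩ := hS _ (hu _ (hne' 0))
  let A (a : Fin 2 → Polynomial (MvPolynomial ι F)) :
      MvPolynomial (ι ⊕ Fin 2) F →ₐ[F] Polynomial (MvPolynomial ι F) :=
    aeval (Sum.elim (fun i => Polynomial.C (X i)) a)
  have hA1 (R : MvPolynomial (ι ⊕ Fin 2) F) (v : ι → F) (t : F) :
      ((A ![1, Polynomial.X] R).map (eval v)).eval t = eval (Sum.elim v ![1, t]) R := by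
    have h : ((Polynomial.evalRingHom t).comp (Polynomial.mapRingHom (eval v))).comp
        (A ![1, Polynomial.X]).toRingHom = eval (Sum.elim v ![1, t]) := by
      ext i
      · simp [A]
      · rcases i with i | i
        · simp [A]
        · fin_cases i <;> simp [A]
    exact RingHom.congr_fun h R
  have hA2 (R : MvPolynomial (ι ⊕ Fin 2) F) (v : ι → F) (t : F) :
      ((A ![Polynomial.X, 1] R).map (eval v)).eval t = eval (Sum.elim v ![t, 1]) R := by
    have h : ((Polynomial.evalRingHom t).comp (Polynomial.mapRingHom (eval v))).comp
        (A ![Polynomial.X, 1]).toRingHom = eval (Sum.elim v ![t, 1]) := by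
      ext i
      · simp [A]
      · rcases i with i | i
        · simp [A]
        · fin_cases i <;> simp [A]
    exact RingHom.congr_fun h R
  -- Over u the polynomials P t have no common root, so they generate the unit ideal of F[t].
  have htop : Ideal.span (Set.range fun t => (A ![1, Polynomial.X] (P t)).map (eval u)) = ⊤ := by
    by_contra hcon
    set I := Ideal.span (Set.range fun t => (A ![1, Polynomial.X] (P t)).map (eval u)) with hI
    have hgen := Ideal.span_singleton_generator I
    set g := Submodule.IsPrincipal.generator I
    have hnu : ¬ IsUnit g := fun h => hcon (by
      rw [← hgen]; exact Ideal.span_singleton_eq_top.2 h)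
    obtain ⟨t, ht⟩ : ∃ t, g.eval t = 0 := by
      by_cases h0 : g.degree = 0
      · exact absurd (Polynomial.isUnit_iff_degree_eq_zero.2 h0) hnu
      · exact IsAlgClosed.exists_root g h0
    have hmem : (A ![1, Polynomial.X] (P t)).map (eval u) ∈ I :=
      Ideal.subset_span ⟨t, rfl⟩
    rw [← hgen, Ideal.mem_span_singleton] at hmem
    obtain ⟨q, hq⟩ := hmem
    apply hP t
    rw [← hA1, hq, Polynomial.eval_mul, ht, zero_mul]
  have hone := htop ▸ Submodule.mem_top (x := (1 : Polynomial F))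
  obtain ⟨c, hc⟩ := Finsupp.mem_ideal_span_range_iff_exists_finsupp.1 hone
  -- H spreads the relation that expresses 1 over u to all parameters: it specializes to 1 at u, and
  -- wherever it is nonzero some P t is nonzero.
  set H : Polynomial (MvPolynomial ι F) :=
    c.sum fun t a => a.map (C : F →+* MvPolynomial ι F) * A ![1, Polynomial.X] (P t) with hH
  have hmapC (v : ι → F) (a : Polynomial F) :
      (a.map (C : F →+* MvPolynomial ι F)).map (eval v) = a := by
    ext
    simp
  have hHmap (v : ι → F) : H.map (eval v) =
      c.sum fun t a => a * (A ![1, Polynomial.X] (P t)).map (eval v) := by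
    rw [hH, Finsupp.sum, Finsupp.sum, Polynomial.map_sum]
    exact Finset.sum_congr rfl fun t _ => by rw [Polynomial.map_mul, hmapC]
  set p := A ![Polynomial.X, 1] Q with hp
  set N := p.natDegree
  -- G is Q rewritten in the coordinate of the other chart. The extra factor t makes the formal
  -- degree positive and ensures that G ≠ 0 excludes t = 0. Its coefficient in degree N + 1 is the
  -- value of Q at (0 : 1).
  set G : Polynomial (MvPolynomial ι F) := Polynomial.X * p.reflect N with hG
  have hGdeg : G.natDegree ≤ N + 1 := by
    refine Polynomial.natDegree_mul_le.trans ?_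
    have h1 : (Polynomial.X : Polynomial (MvPolynomial ι F)).natDegree ≤ 1 :=
      Polynomial.natDegree_X_le
    have h2 := Polynomial.natDegree_reflect_le (N := N) (p := p)
    rw [max_self] at h2
    omega
  have hGcoeff : G.coeff (N + 1) = p.coeff 0 := by
    rw [hG, Polynomial.coeff_X_mul, Polynomial.coeff_reflect, Polynomial.revAt_le le_rfl]
    simp
  have hcoeff (v : ι → F) : eval v (p.coeff 0) = eval (Sum.elim v ![0, 1]) Q := by
    rw [← hA2, ← Polynomial.coeff_zero_eq_eval_zero, Polynomial.coeff_map]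
  obtain ⟨a, b, -, -, hab⟩ := Polynomial.exists_mul_add_mul_eq_C_resultant G H hGdeg
    (le_refl H.natDegree) (Or.inl (Nat.succ_ne_zero N))
  set ρ := G.resultant H (N + 1) H.natDegree
  -- Over u the polynomial H is 1, so its resultant with G is a power of the top coefficient of G,
  -- which does not vanish at u.
  have hρ : eval u ρ ≠ 0 := by
    rw [← Polynomial.resultant_map_map, hHmap, hc, Polynomial.resultant_one_right,
      Polynomial.coeff_map, hGcoeff, hcoeff]
    exact pow_ne_zero _ hQ
  refine ⟨ρ * p.coeff 0, ?_, fun v hv x hx => ?_⟩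
  · rw [map_mul, hcoeff]
    exact mul_ne_zero hρ hQ
  rw [map_mul] at hv
  have hv1 := left_ne_zero_of_mul hv
  have hv2 := right_ne_zero_of_mul hv
  by_cases hx0 : x 0 = 0
  · have hx1 : x 1 ≠ 0 := fun h => hx (by ext i; fin_cases i <;> simp [hx0, h])
    have := hsmul v _ (x 1) hx1 (hQS (Sum.elim v ![0, 1]) (by rwa [← hcoeff]))
    convert this using 2
    ext i
    fin_cases i <;> simp [hx0]
  · set t := x 1 / x 0 with ht
    have hxt : x = x 0 • ![1, t] := by
      ext i
      fin_cases i
      · simp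
      · simp [ht, mul_div_cancel₀ _ hx0]
    suffices Sum.elim v ![1, t] ∈ S by
      rw [hxt]; exact hsmul v _ _ hx0 this
    -- By the Bezout identity of the resultant, G and H have no common root t where ρ ≠ 0. A nonzero
    -- H gives some P t, a nonzero G gives Q.
    have key := congrArg (fun q => (q.map (eval v)).eval t) hab
    simp only [Polynomial.map_add, Polynomial.map_mul, Polynomial.eval_add, Polynomial.eval_mul,
      Polynomial.map_C, Polynomial.eval_C] at key
    by_cases hGt : (G.map (eval v)).eval t = 0
    · have hHt : (H.map (eval v)).eval t ≠ 0 := by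
        intro h
        rw [hGt, h, zero_mul, zero_mul, add_zero] at key
        exact hv1 key.symm
      rw [hHmap, Finsupp.sum, Polynomial.eval_finsetSum] at hHt
      obtain ⟨τ, -, hτ⟩ := Finset.exists_ne_zero_of_sum_ne_zero hHt
      rw [Polynomial.eval_mul, hA1] at hτ
      exact hPS τ _ (right_ne_zero_of_mul hτ)
    · rw [hG, Polynomial.map_mul, Polynomial.eval_mul, Polynomial.map_X, Polynomial.eval_X] at hGt
      have ht0 := left_ne_zero_of_mul hGt
      have hr := right_ne_zero_of_mul hGt
      let _ := invertibleOfNonzero (inv_ne_zero ht0)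
      have := Polynomial.eval₂_reflect_mul_pow (eval v) t⁻¹ N p le_rfl
      rw [invOf_eq_inv, inv_inv, ← Polynomial.eval_map, ← Polynomial.eval_map, hA2] at this
      have h2 : eval (Sum.elim v ![t⁻¹, 1]) Q ≠ 0 := by
        rw [← this]
        exact mul_ne_zero hr (pow_ne_zero _ (inv_ne_zero ht0))
      have h3 := hsmul v _ t ht0 (hQS _ h2)
      convert h3 using 2
      ext i
      fin_cases i <;> simp [ht0]

/-- The common zeros of a family of functions that are homogeneous in a point of the projective
line have a closed projection. -/
theorem ZOpen.forall_exists_ne_zero [IsAlgClosed F] {α : Type*} (m : α → ℕ)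
    {φ : α → (ι → F) → (Fin 2 → F) → F}
    (hφ : ∀ a, IsPolyFun fun w : ι ⊕ Fin 2 → F => φ a (w ∘ Sum.inl) (w ∘ Sum.inr))
    (hm : ∀ a u x c, φ a u (c • x) = c ^ m a * φ a u x) :
    ZOpen {u : ι → F | ∀ x : Fin 2 → F, x ≠ 0 → ∃ a, φ a u x ≠ 0} := by
  refine (ZOpen.exists_ne_zero hφ).forall_ne_zero fun u x c hc hx => ?_
  obtain ⟨a, ha⟩ := hx
  refine ⟨a, ?_⟩
  simp only [Sum.elim_comp_inl, Sum.elim_comp_inr] at ha ⊢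
  rw [hm]
  exact mul_ne_zero (pow_ne_zero _ hc) ha

/-- The analogue of `ZOpen.forall_exists_ne_zero` for two points of the projective line. -/
theorem ZOpen.forall_forall_exists_ne_zero [IsAlgClosed F] {α : Type*} (m : α → ℕ)
    {φ : α → (ι → F) → (Fin 2 → F) → (Fin 2 → F) → F}
    (hφ : ∀ a, IsPolyFun fun w : (ι ⊕ Fin 2) ⊕ Fin 2 → F =>
      φ a (w ∘ Sum.inl ∘ Sum.inl) (w ∘ Sum.inl ∘ Sum.inr) (w ∘ Sum.inr))
    (hm : ∀ a u x y c, φ a u (c • x) y = c ^ m a * φ a u x y)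
    (hm' : ∀ a u x y c, φ a u x (c • y) = c ^ m a * φ a u x y) :
    ZOpen {u : ι → F | ∀ x : Fin 2 → F, x ≠ 0 → ∀ y : Fin 2 → F, y ≠ 0 → ∃ a, φ a u x y ≠ 0} := by
  have h1 : ZOpen {w : ι ⊕ Fin 2 → F | ∀ y : Fin 2 → F, y ≠ 0 →
      ∃ a, φ a (w ∘ Sum.inl) (w ∘ Sum.inr) y ≠ 0} :=
    ZOpen.forall_exists_ne_zero m (φ := fun a w y => φ a (w ∘ Sum.inl) (w ∘ Sum.inr) y) hφ
      fun a u x c => hm' _ _ _ _ _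
  refine h1.forall_ne_zero fun u x c hc hx y hy => ?_
  obtain ⟨a, ha⟩ := hx y hy
  refine ⟨a, ?_⟩
  simp only [Sum.elim_comp_inl, Sum.elim_comp_inr] at ha ⊢
  rw [hm]
  exact mul_ne_zero (pow_ne_zero _ hc) ha

end ZariskiOpen

end RationalCurve

namespace RationalCurve

/-! ### Homogeneous components of products and pullbacks -/

section Homogeneous

variable {R : Type*} [CommRing R] {κ : Type*}

lemma homogeneousComponent_mul_of_isHomogeneous {P : MvPolynomial κ R} {a : ℕ}
    (hP : P.IsHomogeneous a) (b : ℕ) (Q : MvPolynomial κ R) :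
    homogeneousComponent (a + b) (P * Q) = P * homogeneousComponent b Q := by
  conv_lhs => rw [← sum_homogeneousComponent Q, Finset.mul_sum, map_sum]
  have h (k : ℕ) : homogeneousComponent (a + b) (P * homogeneousComponent k Q) =
      if k = b then P * homogeneousComponent b Q else 0 := by
    rw [homogeneousComponent_of_mem
      (hP.mul (homogeneousComponent_isHomogeneous k Q) : _ ∈ homogeneousSubmodule κ R (a + k))]
    by_cases hk : k = b
    · simp [hk]
    · rw [if_neg hk, if_neg (by omega)]
  simp only [h, Finset.sum_ite_eq', Finset.mem_range]
  split_ifs with hb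
  · rfl
  · rw [homogeneousComponent_eq_zero b Q (by omega), mul_zero]

lemma homogeneousComponent_aeval {κ' : Type*}
    {f : κ → MvPolynomial κ' R} {d : ℕ} (hd : 0 < d)
    (hf : ∀ i, (f i).IsHomogeneous d) (k : ℕ) (P : MvPolynomial κ R) :
    homogeneousComponent (d * k) (aeval f P) = aeval f (homogeneousComponent k P) := by
  conv_lhs => rw [← sum_homogeneousComponent P, map_sum, map_sum]
  have h (j : ℕ) : homogeneousComponent (d * k) (aeval f (homogeneousComponent j P)) =
      if j = k then aeval f (homogeneousComponent k P) else 0 := by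
    rw [homogeneousComponent_of_mem
      ((homogeneousComponent_isHomogeneous j P).aeval f hf : _ ∈ homogeneousSubmodule κ' R (d * j))]
    by_cases hk : j = k
    · simp [hk]
    · rw [if_neg hk, if_neg (by simpa [hd.ne', eq_comm] using hk)]
  simp only [h, Finset.sum_ite_eq', Finset.mem_range]
  split_ifs with hb
  · rfl
  · rw [homogeneousComponent_eq_zero k P (by omega), map_zero]

end Homogeneous

variable {F : Type*} [Field F]

/-! ### The ideal of a line through the origin -/

section Line

variable {κ : Type*}

/-- Restriction of polynomials to the line spanned by a vector. -/
def lineMap (w : κ → F) : MvPolynomial κ F →ₐ[F] Polynomial F :=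
  aeval fun i => Polynomial.C (w i) * Polynomial.X

lemma eval_lineMap (w : κ → F) (P : MvPolynomial κ F) (c : F) :
    (lineMap w P).eval c = eval (c • w) P := by
  have h : ((Polynomial.evalRingHom c).comp (lineMap w).toRingHom) = eval (c • w) := by
    ext i
    · simp [lineMap]
    · simp [lineMap, -Polynomial.X_mul_C, mul_comm c]
  exact RingHom.congr_fun h P

lemma lineMap_of_isHomogeneous (w : κ → F) {P : MvPolynomial κ F} {m : ℕ}
    (hP : P.IsHomogeneous m) : lineMap w P = Polynomial.C (eval w P) * Polynomial.X ^ m := by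
  rw [lineMap, aeval_def, eval₂_eq, eval_eq, map_sum, Finset.sum_mul]
  refine Finset.sum_congr rfl fun d hd => ?_
  have : ∑ i ∈ d.support, d i = m := by
    rw [← hP.degree_eq_sum_deg_support hd]
  simp only [mul_pow, Finset.prod_mul_distrib, Finset.prod_pow_eq_pow_sum, this, map_mul,
    map_prod, map_pow, Polynomial.algebraMap_eq]
  ring

lemma eval_smul_of_isHomogeneous {P : MvPolynomial κ F} {m : ℕ} (hP : P.IsHomogeneous m)
    (c : F) (w : κ → F) : eval (c • w) P = c ^ m * eval w P := by
  rw [← eval_lineMap, lineMap_of_isHomogeneous w hP, Polynomial.eval_mul, Polynomial.eval_C,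
    Polynomial.eval_pow, Polynomial.eval_X, mul_comm]

/-- The linear form that is dual to `w` along the coordinate `j`. -/
def dualCoord (w : κ → F) (j : κ) : MvPolynomial κ F := C (w j)⁻¹ * X j

/-- Linear forms that generate the ideal of the line through `w`. -/
def lineGen (w : κ → F) (j i : κ) : MvPolynomial κ F := X i - C (w i) * dualCoord w j

variable {w : κ → F} {j : κ}

lemma isHomogeneous_dualCoord : (dualCoord w j).IsHomogeneous 1 :=
  isHomogeneous_C_mul_X _ _

lemma isHomogeneous_lineGen (i : κ) : (lineGen w j i).IsHomogeneous 1 :=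
  (isHomogeneous_X F i).sub (isHomogeneous_dualCoord.C_mul _)

lemma eval_dualCoord (hj : w j ≠ 0) : eval w (dualCoord w j) = 1 := by
  simp [dualCoord, hj]

lemma eval_lineGen (hj : w j ≠ 0) (i : κ) : eval w (lineGen w j i) = 0 := by
  simp [lineGen, eval_dualCoord hj]

lemma lineMap_dualCoord (hj : w j ≠ 0) : lineMap w (dualCoord w j) = Polynomial.X := by
  rw [lineMap_of_isHomogeneous w isHomogeneous_dualCoord, eval_dualCoord hj]
  simp

lemma lineMap_lineGen (hj : w j ≠ 0) (i : κ) : lineMap w (lineGen w j i) = 0 := by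
  rw [lineMap_of_isHomogeneous w (isHomogeneous_lineGen i), eval_lineGen hj]
  simp

/-- The ideal of the line through `w`. -/
def lineIdeal (w : κ → F) (j : κ) : Ideal (MvPolynomial κ F) :=
  Ideal.span (Set.range (lineGen w j))

/-- Modulo the generators each X i becomes w i times the class of `dualCoord w j`, so the projection
to the quotient factors through the restriction to the line. -/
lemma mem_lineIdeal_iff (hj : w j ≠ 0) {P : MvPolynomial κ F} :
    P ∈ lineIdeal w j ↔ lineMap w P = 0 := by
  constructor
  · intro h
    have : lineIdeal w j ≤ RingHom.ker (lineMap w) := by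
      rw [lineIdeal, Ideal.span_le]
      rintro _ ⟨i, rfl⟩
      exact lineMap_lineGen hj i
    exact this h
  · intro h
    let π := Ideal.Quotient.mkₐ F (lineIdeal w j)
    have hπ (i : κ) : π (X i) = π (C (w i) * dualCoord w j) :=
      Ideal.Quotient.eq.2 (Ideal.subset_span ⟨i, rfl⟩)
    have h2 : π = (Polynomial.aeval (π (dualCoord w j))).comp (lineMap w) := by
      ext i
      rw [hπ]
      simp [lineMap, Algebra.algebraMap_eq_smul_one, C_mul']
    have : π P = 0 := by
      rw [h2, AlgHom.comp_apply, h, map_zero]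
    exact Ideal.Quotient.eq_zero_iff_mem.1 this

lemma mem_lineIdeal_iff_of_isHomogeneous (hj : w j ≠ 0) {P : MvPolynomial κ F} {m : ℕ}
    (hP : P.IsHomogeneous m) : P ∈ lineIdeal w j ↔ eval w P = 0 := by
  rw [mem_lineIdeal_iff hj, lineMap_of_isHomogeneous w hP]
  simp

/-- The first order expansion of a homogeneous polynomial that vanishes at `w`. -/
lemma exists_eq_sum_pderiv_add [Fintype κ] (hj : w j ≠ 0) {P : MvPolynomial κ F} {m : ℕ}
    (hP : P.IsHomogeneous (m + 1)) (h0 : eval w P = 0) :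
    ∃ N : κ → MvPolynomial κ F, (∀ i, N i ∈ lineIdeal w j) ∧
      P = dualCoord w j ^ m * ∑ i, C (eval w (pderiv i P)) * lineGen w j i
        + ∑ i, N i * lineGen w j i := by
  have h1 := (mem_lineIdeal_iff_of_isHomogeneous hj hP).2 h0
  obtain ⟨c, hc⟩ := Ideal.mem_span_range_iff_exists_fun.1 h1
  -- The coefficients may be taken homogeneous of degree m. For i ≠ j their values at w are then the
  -- partial derivatives of P; the index j does not matter because `lineGen w j j` is zero.
  set c' := fun i => homogeneousComponent m (c i) with hc'
  have hc'' : ∑ i, c' i * lineGen w j i = P := by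
    have := congrArg (homogeneousComponent (1 + m)) hc
    rw [map_sum, homogeneousComponent_of_mem (hP : _ ∈ homogeneousSubmodule _ _ _),
      if_pos (add_comm _ _)] at this
    rw [← this]
    refine Finset.sum_congr rfl fun i _ => ?_
    rw [mul_comm (c i), homogeneousComponent_mul_of_isHomogeneous (isHomogeneous_lineGen i),
      mul_comm]
  have hhom (i : κ) : (c' i).IsHomogeneous m := homogeneousComponent_isHomogeneous _ _
  have hw : lineGen w j j = 0 := by
    simp [lineGen, dualCoord, ← mul_assoc, ← C_mul, hj]
  classical
  have hpd (i : κ) (hij : i ≠ j) : eval w (pderiv i P) = eval w (c' i) := by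
    rw [← hc'', map_sum, map_sum, Finset.sum_eq_single i]
    · simp [lineGen, dualCoord, pderiv_X_of_ne hij.symm, hj]
    · intro k _ hk
      simp [lineGen, dualCoord, pderiv_X_of_ne hij.symm, pderiv_X_of_ne hk, hj]
    · simp
  refine ⟨fun i => c' i - C (eval w (c' i)) * dualCoord w j ^ m, fun i => ?_, ?_⟩
  · rw [mem_lineIdeal_iff_of_isHomogeneous hj
      ((hhom i).sub (by simpa using (isHomogeneous_dualCoord.pow m).C_mul _))]
    simp [eval_dualCoord hj]
  · rw [Finset.mul_sum, ← Finset.sum_add_distrib, ← hc'']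
    refine Finset.sum_congr rfl fun i _ => ?_
    by_cases hij : i = j
    · rw [hij, hw]; ring
    · rw [hc'', hpd i hij]; ring

end Line

/-! ### Divisibility of binary forms by linear forms -/

section BinaryForms

/-- The linear form with the zero `x`. -/
def lineForm (x : Fin 2 → F) : MvPolynomial (Fin 2) F := C (x 0) * X 1 - C (x 1) * X 0

lemma isHomogeneous_lineForm (x : Fin 2 → F) : (lineForm x).IsHomogeneous 1 :=
  (isHomogeneous_C_mul_X _ _).sub (isHomogeneous_C_mul_X _ _)

@[simp] lemma eval_lineForm (x y : Fin 2 → F) : eval y (lineForm x) = x 0 * y 1 - x 1 * y 0 := by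
  simp [lineForm]

lemma eval_lineForm_self (x : Fin 2 → F) : eval x (lineForm x) = 0 := by
  simp [mul_comm]

lemma exists_coord_ne_zero {κ : Type*} {x : κ → F} (hx : x ≠ 0) : ∃ j, x j ≠ 0 := by
  by_contra! h
  exact hx (funext h)

lemma exists_smul_of_eval_lineForm {x y : Fin 2 → F} (hx : x ≠ 0)
    (h : eval y (lineForm x) = 0) : ∃ c : F, y = c • x := by
  rw [eval_lineForm, sub_eq_zero] at h
  obtain ⟨j, hj⟩ := exists_coord_ne_zero hx
  fin_cases j
  · refine ⟨y 0 / x 0, ?_⟩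
    simp only [Fin.zero_eta, Fin.isValue] at hj
    ext i; fin_cases i
    · simp [hj]
    · simp; field_simp; linear_combination h
  · refine ⟨y 1 / x 1, ?_⟩
    simp only [Fin.mk_one, Fin.isValue] at hj
    ext i; fin_cases i
    · simp; field_simp; linear_combination -h
    · simp [hj]

lemma eval_lineForm_smul (x : Fin 2 → F) (c : F) : eval (c • x) (lineForm x) = 0 := by
  simp; ring

lemma lineForm_ne_zero {x : Fin 2 → F} (hx : x ≠ 0) : lineForm x ≠ 0 := by
  intro h
  apply hx
  have h0 := congrArg (eval ![0, 1]) h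
  have h1 := congrArg (eval ![1, 0]) h
  simp at h0 h1
  ext i; fin_cases i <;> simp [h0, h1]

/-- In two variables the ideal of a line through the origin is principal. -/
lemma lineForm_dvd_iff {x : Fin 2 → F} (hx : x ≠ 0) {P : MvPolynomial (Fin 2) F} :
    lineForm x ∣ P ↔ lineMap x P = 0 := by
  obtain ⟨j, hj⟩ := exists_coord_ne_zero hx
  rw [← mem_lineIdeal_iff hj, ← Ideal.mem_span_singleton]
  suffices h : Ideal.span {lineForm x} = lineIdeal x j by rw [h]
  apply le_antisymm
  · rw [Ideal.span_le, Set.singleton_subset_iff, SetLike.mem_coe,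
      mem_lineIdeal_iff_of_isHomogeneous hj (isHomogeneous_lineForm x), eval_lineForm_self]
  · rw [lineIdeal, Ideal.span_le]
    rintro _ ⟨i, rfl⟩
    rw [SetLike.mem_coe, Ideal.mem_span_singleton]
    fin_cases j
    · simp only [Fin.zero_eta, Fin.isValue] at hj
      have hC : C (x 0) * C (x 0)⁻¹ = (1 : MvPolynomial (Fin 2) F) := by
        rw [← C_mul, mul_inv_cancel₀ hj, C_1]
      fin_cases i
      · refine ⟨0, ?_⟩
        simp only [lineGen, dualCoord, Fin.zero_eta]
        linear_combination (-X 0) * hC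
      · refine ⟨C (x 0)⁻¹, ?_⟩
        simp only [lineGen, dualCoord, lineForm, Fin.zero_eta, Fin.mk_one]
        linear_combination (-X 1) * hC
    · simp only [Fin.mk_one, Fin.isValue] at hj
      have hC : C (x 1) * C (x 1)⁻¹ = (1 : MvPolynomial (Fin 2) F) := by
        rw [← C_mul, mul_inv_cancel₀ hj, C_1]
      fin_cases i
      · refine ⟨-C (x 1)⁻¹, ?_⟩
        simp only [lineGen, dualCoord, lineForm, Fin.zero_eta, Fin.mk_one]
        linear_combination (-X 0) * hC
      · refine ⟨0, ?_⟩
        simp only [lineGen, dualCoord, Fin.mk_one]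
        linear_combination (-X 1) * hC

lemma lineForm_dvd_iff_of_isHomogeneous {x : Fin 2 → F} (hx : x ≠ 0) {P : MvPolynomial (Fin 2) F}
    {m : ℕ} (hP : P.IsHomogeneous m) : lineForm x ∣ P ↔ eval x P = 0 := by
  rw [lineForm_dvd_iff hx, lineMap_of_isHomogeneous x hP]
  simp

lemma prime_lineForm {x : Fin 2 → F} (hx : x ≠ 0) : Prime (lineForm x) := by
  refine ⟨lineForm_ne_zero hx, fun h => ?_, fun a b hab => ?_⟩
  · have := (lineForm_dvd_iff hx).1 (h.dvd (a := (1 : MvPolynomial (Fin 2) F)))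
    simp at this
  · rw [lineForm_dvd_iff hx, map_mul, mul_eq_zero] at hab
    rwa [lineForm_dvd_iff hx, lineForm_dvd_iff hx]

lemma exists_eq_lineForm_mul {x : Fin 2 → F} (hx : x ≠ 0) {P : MvPolynomial (Fin 2) F} {m : ℕ}
    (hP : P.IsHomogeneous (m + 1)) (h0 : eval x P = 0) :
    ∃ Q : MvPolynomial (Fin 2) F, Q.IsHomogeneous m ∧ P = lineForm x * Q := by
  obtain ⟨Q, hQ⟩ := (lineForm_dvd_iff hx).2
    (by rw [lineMap_of_isHomogeneous x hP, h0]; simp : lineMap x P = 0)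
  refine ⟨homogeneousComponent m Q, homogeneousComponent_isHomogeneous _ _, ?_⟩
  rw [← homogeneousComponent_mul_of_isHomogeneous (isHomogeneous_lineForm x), ← hQ, add_comm,
    homogeneousComponent_of_mem (hP : _ ∈ homogeneousSubmodule _ _ _), if_pos rfl]

/-- Binary forms of the same degree without a common zero generate all forms of high degree. -/
lemma exists_forall_eq_sum_mul [IsAlgClosed F] {κ : Type*} [Fintype κ]
    {g : κ → MvPolynomial (Fin 2) F} {e : ℕ} (hg : ∀ i, (g i).IsHomogeneous e)
    (h0 : ∀ x : Fin 2 → F, x ≠ 0 → ∃ i, eval x (g i) ≠ 0) :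
    ∃ E, ∀ m ≥ E, ∀ b : MvPolynomial (Fin 2) F, b.IsHomogeneous (e + m) →
      ∃ c : κ → MvPolynomial (Fin 2) F, (∀ i, (c i).IsHomogeneous m) ∧ b = ∑ i, g i * c i := by
  set I := Ideal.span (Set.range g) with hI
  -- By the Nullstellensatz: the g i have no common zero in the plane except possibly the origin,
  -- where both variables vanish.
  have hrad (j : Fin 2) : ∃ a, (X j : MvPolynomial (Fin 2) F) ^ a ∈ I := by
    change X j ∈ I.radical
    rw [← vanishingIdeal_zeroLocus_eq_radical (K := F)]
    rw [mem_vanishingIdeal_iff]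
    intro x hx
    have : x = 0 := by
      by_contra hne
      obtain ⟨i, hi⟩ := h0 x hne
      exact hi (hx _ (Ideal.subset_span ⟨i, rfl⟩))
    simp [this]
  obtain ⟨a, ha⟩ := hrad 0
  obtain ⟨a', ha'⟩ := hrad 1
  refine ⟨a + a', fun m hm b hb => ?_⟩
  -- A monomial of degree at least a + a' is divisible by X 0 ^ a or by X 1 ^ a'.
  have hbI : b ∈ I := by
    rw [b.as_sum]
    refine I.sum_mem fun d hd => ?_
    have hdeg : d 0 + d 1 = e + m := by
      rw [hb.degree_eq_sum_deg_support hd, ← Fin.sum_univ_two (fun i => d i)]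
      exact (Finset.sum_subset (Finset.subset_univ _) (by simp)).symm
    rw [monomial_eq, Finsupp.prod_fintype _ _ (by simp), Fin.prod_univ_two]
    refine I.mul_mem_left _ ?_
    by_cases h : a ≤ d 0
    · exact I.mul_mem_right _ (I.pow_mem_of_pow_mem ha h)
    · exact I.mul_mem_left _ (I.pow_mem_of_pow_mem ha' (by omega))
  obtain ⟨c, hc⟩ := Ideal.mem_span_range_iff_exists_fun.1 hbI
  refine ⟨fun i => homogeneousComponent m (c i),
    fun i => homogeneousComponent_isHomogeneous _ _, ?_⟩
  have := congrArg (homogeneousComponent (e + m)) hc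
  rw [map_sum, homogeneousComponent_of_mem (hb : _ ∈ homogeneousSubmodule _ _ _),
      if_pos rfl] at this
  rw [← this]
  refine Finset.sum_congr rfl fun i _ => ?_
  rw [mul_comm (c i), homogeneousComponent_mul_of_isHomogeneous (hg i)]

end BinaryForms
end RationalCurve

namespace RationalCurve

/-! ### Coefficients of binary forms -/

section FormCoeff

variable {R : Type*} [CommRing R]

/-- The coefficient of `X 0 ^ (m - k) * X 1 ^ k`. -/
def formCoeff (m k : ℕ) (P : MvPolynomial (Fin 2) R) : R :=
  coeff (Finsupp.single 0 (m - k) + Finsupp.single 1 k) P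

lemma eq_sum_formCoeff {m : ℕ} {P : MvPolynomial (Fin 2) R} (hP : P.IsHomogeneous m) :
    P = ∑ k ∈ Finset.range (m + 1), C (formCoeff m k P) * X 0 ^ (m - k) * X 1 ^ k := by
  have h (k : ℕ) : (C (formCoeff m k P) * X 0 ^ (m - k) * X 1 ^ k : MvPolynomial (Fin 2) R) =
      monomial (Finsupp.single 0 (m - k) + Finsupp.single 1 k) (formCoeff m k P) := by
    rw [X_pow_eq_monomial, X_pow_eq_monomial, C_mul_monomial, monomial_mul, mul_one, mul_one]
  simp only [h]
  ext δ
  rw [coeff_sum]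
  simp only [coeff_monomial]
  by_cases hδ : δ.degree = m
  · have hsum : δ 0 + δ 1 = m := by
      rw [← hδ, Finsupp.degree_eq_sum, Fin.sum_univ_two]
    have hδ' : Finsupp.single 0 (m - δ 1) + Finsupp.single 1 (δ 1) = δ := by
      ext i; fin_cases i
      · simp; omega
      · simp
    rw [Finset.sum_eq_single (δ 1)]
    · rw [if_pos hδ', formCoeff, hδ']
    · intro k _ hk
      rw [if_neg]
      rintro rfl
      simp at hk
    · intro hk
      exact absurd (Finset.mem_range.2 (by omega)) hk
  · rw [hP.coeff_eq_zero hδ, Finset.sum_eq_zero]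
    intro k hk
    rw [if_neg]
    rintro rfl
    apply hδ
    rw [Finset.mem_range] at hk
    simp [Finsupp.degree_eq_sum, Fin.sum_univ_two]
    omega

lemma isHomogeneous_sum_form {m : ℕ} (a : Fin (m + 1) → R) :
    (∑ k : Fin (m + 1), C (a k) * X 0 ^ (m - (k : ℕ)) * X 1 ^ (k : ℕ) :
      MvPolynomial (Fin 2) R).IsHomogeneous m := by
  refine IsHomogeneous.sum _ _ _ fun k _ => ?_
  have h := (((isHomogeneous_X_pow (R := R) (0 : Fin 2) (m - (k : ℕ))).C_mul (a k)).mul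
    (isHomogeneous_X_pow (R := R) (1 : Fin 2) (k : ℕ)))
  rwa [Nat.sub_add_cancel (Nat.le_of_lt_succ k.2)] at h

lemma eval_eq_sum_formCoeff {m : ℕ} {P : MvPolynomial (Fin 2) R} (hP : P.IsHomogeneous m)
    (x : Fin 2 → R) :
    eval x P = ∑ k ∈ Finset.range (m + 1), formCoeff m k P * (x 0 ^ (m - k) * x 1 ^ k) := by
  conv_lhs => rw [eq_sum_formCoeff hP]
  simp [map_sum, mul_assoc]

lemma formCoeff_sum {m : ℕ} (a : ℕ → R) {l : ℕ} (hl : l ≤ m) :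
    formCoeff m l (∑ k ∈ Finset.range (m + 1), C (a k) * X 0 ^ (m - k) * X 1 ^ k) = a l := by
  have h (k : ℕ) : (C (a k) * X 0 ^ (m - k) * X 1 ^ k : MvPolynomial (Fin 2) R) =
      monomial (Finsupp.single 0 (m - k) + Finsupp.single 1 k) (a k) := by
    rw [X_pow_eq_monomial, X_pow_eq_monomial, C_mul_monomial, monomial_mul, mul_one, mul_one]
  simp only [h]
  rw [formCoeff, coeff_sum, Finset.sum_eq_single l]
  · simp
  · intro k _ hk
    rw [coeff_monomial, if_neg]
    intro h
    apply hk
    have := DFunLike.congr_fun h 1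
    simpa using this
  · intro h
    exact absurd (Finset.mem_range.2 (by omega)) h

end FormCoeff

/-! ### Bezoutians -/

section Bezoutian

variable {R : Type*} [CommRing R]

/-- Half of the Bezoutian of two monomials. -/
def bezTerm (m k l : ℕ) (x y : Fin 2 → R) : R :=
  ∑ i ∈ Finset.range (l - k), (x 0 * y 0) ^ (m - l) * (x 1 * y 1) ^ k *
    ((x 0 * y 1) ^ i * (x 1 * y 0) ^ (l - k - 1 - i))

/-- The Bezoutian `(P(x) Q(y) - Q(x) P(y)) / (x₀ y₁ - x₁ y₀)` of two binary forms of degree `m`. -/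
def bez (m : ℕ) (P Q : MvPolynomial (Fin 2) R) (x y : Fin 2 → R) : R :=
  ∑ k ∈ Finset.range (m + 1), ∑ l ∈ Finset.range (m + 1),
    formCoeff m k P * formCoeff m l Q * (bezTerm m k l x y - bezTerm m l k x y)

/-- Up to a common monomial factor the right-hand side is a difference of two (l - k)-th powers, and
`bezTerm` is the geometric sum. Writing the quotient explicitly makes `bez` polynomial in the
coefficients and in both points, with a meaning on the diagonal. -/
lemma mul_bezTerm {m k l : ℕ} (hk : k ≤ l) (hl : l ≤ m) (x y : Fin 2 → R) :
    (x 0 * y 1 - x 1 * y 0) * bezTerm m k l x y =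
      x 0 ^ (m - k) * x 1 ^ k * (y 0 ^ (m - l) * y 1 ^ l) -
      x 0 ^ (m - l) * x 1 ^ l * (y 0 ^ (m - k) * y 1 ^ k) := by
  rw [bezTerm, ← Finset.mul_sum, mul_left_comm,
    mul_comm (x 0 * y 1 - x 1 * y 0), geom_sum₂_mul]
  obtain ⟨j, rfl⟩ := Nat.exists_eq_add_of_le hk
  obtain ⟨i, rfl⟩ := Nat.exists_eq_add_of_le hl
  have h1 : k + j + i - (k + j) = i := by omega
  have h2 : k + j - k = j := by omega
  have h3 : k + j + i - k = j + i := by omega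
  rw [h1, h2, h3]
  ring

lemma bezTerm_eq_zero {m k l : ℕ} (h : l ≤ k) (x y : Fin 2 → R) : bezTerm m k l x y = 0 := by
  simp [bezTerm, Nat.sub_eq_zero_of_le h]

lemma mul_bez {m : ℕ} {P Q : MvPolynomial (Fin 2) R} (hP : P.IsHomogeneous m)
    (hQ : Q.IsHomogeneous m) (x y : Fin 2 → R) :
    (x 0 * y 1 - x 1 * y 0) * bez m P Q x y = eval x P * eval y Q - eval x Q * eval y P := by
  rw [eval_eq_sum_formCoeff hP x, eval_eq_sum_formCoeff hQ y, eval_eq_sum_formCoeff hQ x,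
    eval_eq_sum_formCoeff hP y, mul_comm (Finset.sum _ fun k => formCoeff m k Q * (x 0 ^ _ * _)),
    Finset.sum_mul_sum, Finset.sum_mul_sum, ← Finset.sum_sub_distrib, bez, Finset.mul_sum]
  refine Finset.sum_congr rfl fun k hk => ?_
  rw [← Finset.sum_sub_distrib, Finset.mul_sum]
  refine Finset.sum_congr rfl fun l hl => ?_
  rw [Finset.mem_range] at hk hl
  rcases le_total k l with h | h
  · have := mul_bezTerm (R := R) h (Nat.le_of_lt_succ hl) x y
    rw [bezTerm_eq_zero h]
    linear_combination (formCoeff m k P * formCoeff m l Q) * this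
  · have := mul_bezTerm (R := R) h (Nat.le_of_lt_succ hk) x y
    rw [bezTerm_eq_zero h]
    linear_combination (-(formCoeff m k P * formCoeff m l Q)) * this

lemma bezTerm_smul_left {m k l : ℕ} (hl : l ≤ m) (c : R) (x y : Fin 2 → R) :
    bezTerm m k l (c • x) y = c ^ (m - 1) * bezTerm m k l x y := by
  rw [bezTerm, bezTerm, Finset.mul_sum]
  refine Finset.sum_congr rfl fun i hi => ?_
  rw [Finset.mem_range] at hi
  obtain ⟨j, hj⟩ : ∃ j, l = k + (i + j + 1) := ⟨l - k - 1 - i, by omega⟩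
  obtain ⟨i', rfl⟩ := Nat.exists_eq_add_of_le hl
  subst hj
  have h1 : k + (i + j + 1) - k - 1 - i = j := by omega
  have h2 : k + (i + j + 1) + i' - 1 = k + i + j + i' := by omega
  have h3 : k + (i + j + 1) + i' - (k + (i + j + 1)) = i' := by omega
  rw [h1, h2, h3]
  simp only [Pi.smul_apply, smul_eq_mul]
  ring

lemma bezTerm_smul_right {m k l : ℕ} (hl : l ≤ m) (c : R) (x y : Fin 2 → R) :
    bezTerm m k l x (c • y) = c ^ (m - 1) * bezTerm m k l x y := by
  rw [bezTerm, bezTerm, Finset.mul_sum]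
  refine Finset.sum_congr rfl fun i hi => ?_
  rw [Finset.mem_range] at hi
  obtain ⟨j, hj⟩ : ∃ j, l = k + (i + j + 1) := ⟨l - k - 1 - i, by omega⟩
  obtain ⟨i', rfl⟩ := Nat.exists_eq_add_of_le hl
  subst hj
  have h1 : k + (i + j + 1) - k - 1 - i = j := by omega
  have h2 : k + (i + j + 1) + i' - 1 = k + i + j + i' := by omega
  have h3 : k + (i + j + 1) + i' - (k + (i + j + 1)) = i' := by omega
  rw [h1, h2, h3]
  simp only [Pi.smul_apply, smul_eq_mul]
  ring

lemma bez_smul_left (m : ℕ) (P Q : MvPolynomial (Fin 2) R) (c : R) (x y : Fin 2 → R) :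
    bez m P Q (c • x) y = c ^ (m - 1) * bez m P Q x y := by
  rw [bez, bez, Finset.mul_sum]
  refine Finset.sum_congr rfl fun k hk => ?_
  rw [Finset.mul_sum]
  refine Finset.sum_congr rfl fun l hl => ?_
  rw [Finset.mem_range] at hk hl
  rw [bezTerm_smul_left (by omega), bezTerm_smul_left (by omega)]
  ring

lemma bez_smul_right (m : ℕ) (P Q : MvPolynomial (Fin 2) R) (c : R) (x y : Fin 2 → R) :
    bez m P Q x (c • y) = c ^ (m - 1) * bez m P Q x y := by
  rw [bez, bez, Finset.mul_sum]
  refine Finset.sum_congr rfl fun k hk => ?_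
  rw [Finset.mul_sum]
  refine Finset.sum_congr rfl fun l hl => ?_
  rw [Finset.mem_range] at hk hl
  rw [bezTerm_smul_right (by omega), bezTerm_smul_right (by omega)]
  ring

end Bezoutian

variable {F : Type*} [Field F]

lemma isPolyFun_bezTerm {ι : Type*} (m k l : ℕ) {x y : (ι → F) → Fin 2 → F}
    (hx : ∀ j, IsPolyFun fun v => x v j) (hy : ∀ j, IsPolyFun fun v => y v j) :
    IsPolyFun fun v => bezTerm m k l (x v) (y v) :=
  IsPolyFun.sum _ fun _ _ => ((((hx 0).mul (hy 0)).pow _).mul (((hx 1).mul (hy 1)).pow _)).mul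
    ((((hx 0).mul (hy 1)).pow _).mul (((hx 1).mul (hy 0)).pow _))

lemma isPolyFun_bez {ι : Type*} (m : ℕ) {P Q : (ι → F) → MvPolynomial (Fin 2) F}
    (hP : ∀ k, IsPolyFun fun v => formCoeff m k (P v))
    (hQ : ∀ k, IsPolyFun fun v => formCoeff m k (Q v)) {x y : (ι → F) → Fin 2 → F}
    (hx : ∀ j, IsPolyFun fun v => x v j) (hy : ∀ j, IsPolyFun fun v => y v j) :
    IsPolyFun fun v => bez m (P v) (Q v) (x v) (y v) :=
  IsPolyFun.sum _ fun k _ => IsPolyFun.sum _ fun l _ => ((hP k).mul (hQ l)).mul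
    ((isPolyFun_bezTerm m k l hx hy).sub (isPolyFun_bezTerm m l k hx hy))

/-- A polynomial function is determined off the zeros of a nonzero linear form. -/
lemma IsPolyFun.eq_of_eval_lineForm_mul_eq [Infinite F] {φ ψ : (Fin 2 → F) → F}
    (hφ : IsPolyFun φ) (hψ : IsPolyFun ψ) {x : Fin 2 → F} (hx : x ≠ 0)
    (h : ∀ y, (x 0 * y 1 - x 1 * y 0) * φ y = (x 0 * y 1 - x 1 * y 0) * ψ y) : φ = ψ := by
  obtain ⟨P, hP⟩ := hφ
  obtain ⟨Q, hQ⟩ := hψ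
  have : lineForm x * P = lineForm x * Q := MvPolynomial.funext fun y => by
    rw [map_mul, map_mul, eval_lineForm, ← hP, ← hQ]
    exact h y
  have := mul_left_cancel₀ (lineForm_ne_zero hx) this
  funext y
  rw [hP, hQ, this]

lemma isPolyFun_bez_right (m : ℕ) (P Q : MvPolynomial (Fin 2) F) (x : Fin 2 → F) :
    IsPolyFun fun y => bez m P Q x y :=
  isPolyFun_bez m (fun _ => IsPolyFun.const _) (fun _ => IsPolyFun.const _)
    (fun _ => IsPolyFun.const _) IsPolyFun.coord

/-- The Bezoutian on the diagonal is a Wronskian. -/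
lemma bez_self [Infinite F] {m : ℕ} {P Q : MvPolynomial (Fin 2) F} (hP : P.IsHomogeneous m)
    (hQ : Q.IsHomogeneous m) (x : Fin 2 → F) (j : Fin 2) :
    eval x (pderiv j (lineForm x)) * bez m P Q x x =
      eval x P * eval x (pderiv j Q) - eval x Q * eval x (pderiv j P) := by
  obtain ⟨D, hD⟩ := isPolyFun_bez_right m P Q x
  -- Differentiating this identity in y at y = x, where `lineForm x` vanishes, isolates the value of
  -- D.
  have h : lineForm x * D = C (eval x P) * Q - C (eval x Q) * P := MvPolynomial.funext fun y => by
    rw [map_mul, eval_lineForm, ← hD, mul_bez hP hQ]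
    simp
  have h2 := congrArg (fun P => eval x (pderiv j P)) h
  simp only [pderiv_mul, map_add, map_mul, map_sub, eval_lineForm_self, zero_mul, add_zero,
    pderiv_C, eval_C, zero_add, ← hD] at h2
  exact h2

@[simp] lemma pderiv_zero_lineForm (x : Fin 2 → F) : pderiv 0 (lineForm x) = -C (x 1) := by
  simp [lineForm]

@[simp] lemma pderiv_one_lineForm (x : Fin 2 → F) : pderiv 1 (lineForm x) = C (x 0) := by
  simp [lineForm]

lemma exists_pderiv_lineForm_ne_zero {x : Fin 2 → F} (hx : x ≠ 0) :
    ∃ j, ∀ y, eval y (pderiv j (lineForm x)) ≠ 0 := by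
  obtain ⟨j, hj⟩ := exists_coord_ne_zero hx
  fin_cases j
  · exact ⟨1, by simpa using hj⟩
  · exact ⟨0, by simpa using hj⟩

section Factor

variable [IsAlgClosed F]

/-- If (0 : 1) is not a zero, the dehomogenized polynomial has degree m + 1 > 0 and therefore a
root. -/
lemma exists_zero_of_isHomogeneous {m : ℕ} {P : MvPolynomial (Fin 2) F}
    (hP : P.IsHomogeneous (m + 1)) : ∃ x : Fin 2 → F, x ≠ 0 ∧ eval x P = 0 := by
  by_cases h0 : eval ![0, 1] P = 0
  · exact ⟨_, fun h => one_ne_zero (congrFun h 1), h0⟩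
  set p : Polynomial F := ∑ k ∈ Finset.range (m + 2), Polynomial.C (formCoeff (m + 1) k P) *
    Polynomial.X ^ k with hp
  have hev (t : F) : p.eval t = eval ![1, t] P := by
    rw [eval_eq_sum_formCoeff hP, hp, Polynomial.eval_finsetSum]
    simp
  have hcoeff : p.coeff (m + 1) ≠ 0 := by
    intro h
    apply h0
    rw [eval_eq_sum_formCoeff hP, Finset.sum_range_succ, Finset.sum_eq_zero]
    · rw [hp] at h
      simpa [Polynomial.finsetSum_coeff, Polynomial.coeff_X_pow] using h
    · intro k hk
      rw [Finset.mem_range] at hk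
      simp [Nat.sub_ne_zero_of_lt hk]
  have hdeg : p.degree ≠ 0 := by
    intro h
    have := Polynomial.le_natDegree_of_ne_zero hcoeff
    rw [Polynomial.natDegree_eq_zero_iff_degree_le_zero.2 h.le] at this
    omega
  obtain ⟨t, ht⟩ := IsAlgClosed.exists_root p hdeg
  exact ⟨![1, t], fun h => one_ne_zero (congrFun h 0), by rw [← hev]; exact ht⟩

/-- Binary forms split into linear forms. -/
lemma exists_eq_prod_lineForm {m : ℕ} {P : MvPolynomial (Fin 2) F}
    (hP : P.IsHomogeneous m) : ∃ (c : F) (p : Fin m → Fin 2 → F), (∀ i, p i ≠ 0) ∧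
      P = C c * ∏ i, lineForm (p i) := by
  induction m generalizing P with
  | zero =>
    obtain ⟨c, hc⟩ : ∃ c, P = C c := by
      rw [← mem_homogeneousSubmodule, homogeneousSubmodule_zero] at hP
      obtain ⟨c, hc⟩ := Submodule.mem_one.1 hP
      exact ⟨c, hc.symm⟩
    exact ⟨c, fun i => i.elim0, fun i => i.elim0, by simp [hc]⟩
  | succ m ih =>
    obtain ⟨x, hx, hx0⟩ := exists_zero_of_isHomogeneous hP
    obtain ⟨Q, hQ, rfl⟩ := exists_eq_lineForm_mul hx hP hx0
    obtain ⟨c, p, hp, rfl⟩ := ih hQ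
    refine ⟨c, Fin.cons x p, fun i => ?_, ?_⟩
    · refine Fin.cases hx hp i
    · rw [Fin.prod_univ_succ]
      simp only [Fin.cons_zero, Fin.cons_succ]
      ring

end Factor

/-- A form that vanishes at the zeros of a product of distinct linear forms is a multiple of it. -/
lemma exists_eq_prod_lineForm_mul {r m : ℕ} {p : Fin r → Fin 2 → F} (hp : ∀ i, p i ≠ 0)
    (hpp : ∀ i j, i ≠ j → eval (p j) (lineForm (p i)) ≠ 0) {P : MvPolynomial (Fin 2) F}
    (hP : P.IsHomogeneous (r + m)) (h0 : ∀ i, eval (p i) P = 0) :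
    ∃ Q : MvPolynomial (Fin 2) F, Q.IsHomogeneous m ∧ P = (∏ i, lineForm (p i)) * Q := by
  induction r generalizing P with
  | zero => exact ⟨P, by simpa using hP, by simp⟩
  | succ r ih =>
    obtain ⟨Q, hQ, rfl⟩ := exists_eq_lineForm_mul (hp 0)
      (m := r + m) (by convert hP using 1; ring) (h0 0)
    obtain ⟨Q', hQ', rfl⟩ := ih (p := fun i => p i.succ) (fun i => hp _)
      (fun i j hij => hpp _ _ (by simpa using hij)) hQ fun i => by
        have := h0 i.succ
        rw [map_mul] at this
        exact (mul_eq_zero.1 this).resolve_left (hpp _ _ (Fin.succ_ne_zero i).symm)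
    exact ⟨Q', hQ', by rw [Fin.prod_univ_succ]; ring⟩

end RationalCurve

namespace RationalCurve

/-! ### The image at a point with a single smooth branch -/

section LocalCurve

variable {F : Type*} [Field F] {κ : Type*}

/-- The value of a tuple of polynomials. -/
def tupleEval {τ : Type*} (f : κ → MvPolynomial τ F) (x : τ → F) : κ → F := fun i => eval x (f i)

/-- No other point of the projective line has the same image as `x`. -/
def IsSoleInFibre (f : κ → MvPolynomial (Fin 2) F) (x : Fin 2 → F) : Prop :=
  ∀ y, y ≠ 0 → (∃ c : F, tupleEval f y = c • tupleEval f x) → eval y (lineForm x) = 0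

/-- The differential at `x` of the morphism with components `f` is not zero. -/
def IsImmersedAt (f : κ → MvPolynomial (Fin 2) F) (x : Fin 2 → F) : Prop :=
  ∃ j, ¬ ∃ c : F, tupleEval (fun i => pderiv j (f i)) x = c • tupleEval f x

variable {f : κ → MvPolynomial (Fin 2) F} {d : ℕ}

lemma eval_aeval_tuple (x : Fin 2 → F) (P : MvPolynomial κ F) :
    eval x (aeval f P) = eval (tupleEval f x) P := by
  have h : (eval x).comp (aeval f).toRingHom = eval (tupleEval f x) := by
    ext i
    · simp
    · simp [tupleEval]
  exact RingHom.congr_fun h P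

lemma tupleEval_smul (hf : ∀ i, (f i).IsHomogeneous d) (c : F) (x : Fin 2 → F) :
    tupleEval f (c • x) = c ^ d • tupleEval f x :=
  funext fun i => eval_smul_of_isHomogeneous (hf i) c x

/-- On the line through x the tuple f is c ↦ c ^ d • f(x). This transfers nonvanishing on the line
through f(x) to pullbacks, also for polynomials that are not homogeneous. -/
lemma lineMap_aeval (hf : ∀ i, (f i).IsHomogeneous d) (x : Fin 2 → F) (P : MvPolynomial κ F) :
    lineMap x (aeval f P) = Polynomial.expand F d (lineMap (tupleEval f x) P) := by
  have h : (lineMap x).comp (aeval f) =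
      (Polynomial.expand F d).comp (lineMap (tupleEval f x)) := by
    ext i : 1
    rw [AlgHom.comp_apply, aeval_X, lineMap_of_isHomogeneous x (hf i)]
    simp [lineMap, tupleEval]
  exact AlgHom.congr_fun h P

lemma lineMap_aeval_ne_zero (hd : 0 < d) (hf : ∀ i, (f i).IsHomogeneous d) {x : Fin 2 → F}
    {P : MvPolynomial κ F} (h : lineMap (tupleEval f x) P ≠ 0) : lineMap x (aeval f P) ≠ 0 := by
  rw [lineMap_aeval hf]
  exact (Polynomial.expand_ne_zero hd).2 h

lemma aeval_lineGen (w : κ → F) (j i : κ) :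
    aeval f (lineGen w j i) = f i - C (w i * (w j)⁻¹) * f j := by
  simp [lineGen, dualCoord, C_mul, mul_assoc, algebraMap_eq]

/-- Cramer's rule for a system of linear equations that becomes true after a ring homomorphism. -/
lemma det_mul_eq_of_forall {m A S : Type*} [Fintype m] [DecidableEq m] [CommRing A] [CommRing S]
    (H : A →+* S) (y : A) (N : Matrix m m A) (v u : m → S)
    (h : ∀ a, H y * v a - ∑ b, H (N a b) * v b = u a) (a : m) :
    H (Matrix.det (y • (1 : Matrix m m A) - N)) * v a =
      ∑ b, H ((y • (1 : Matrix m m A) - N).adjugate a b) * u b := by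
  set M := y • (1 : Matrix m m A) - N with hM
  have hMv : (M.map H).mulVec v = u := by
    funext a
    rw [← h a]
    simp only [Matrix.mulVec, dotProduct, Matrix.map_apply, hM, Matrix.sub_apply,
      Matrix.smul_apply, Matrix.one_apply, smul_eq_mul, map_sub, sub_mul, Finset.sum_sub_distrib,
      mul_ite, mul_one, mul_zero, apply_ite H, map_zero, ite_mul, zero_mul]
    simp
  have h2 : (M.adjugate.map H).mulVec u = H M.det • v := by
    rw [← hMv, Matrix.mulVec_mulVec, ← Matrix.map_mul, Matrix.adjugate_mul]
    funext a
    simp [Matrix.mulVec, dotProduct, Matrix.one_apply, apply_ite H]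
  have := congrFun h2 a
  simp only [Matrix.mulVec, dotProduct, Matrix.map_apply, Pi.smul_apply, smul_eq_mul] at this
  exact this.symm

section Unibranch

variable {e : ℕ} {x : Fin 2 → F} {j : κ}

/-- The pullbacks of the linear forms through f(x) vanish at x; dividing them by `lineForm x` gives
g. At a common zero y of g the value f(y) would be proportional to f(x), so y would represent the
same point as x, and then all derivatives of f at x would be proportional to f(x), against
immersedness. -/
lemma exists_residual (hf : ∀ i, (f i).IsHomogeneous (e + 1)) (hx : x ≠ 0)
    (hj : tupleEval f x j ≠ 0) (hsole : IsSoleInFibre f x) (himm : IsImmersedAt f x) :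
    ∃ g : κ → MvPolynomial (Fin 2) F, (∀ i, (g i).IsHomogeneous e) ∧
      (∀ i, aeval f (lineGen (tupleEval f x) j i) = lineForm x * g i) ∧
      ∀ y : Fin 2 → F, y ≠ 0 → ∃ i, eval y (g i) ≠ 0 := by
  set w := tupleEval f x with hw
  have h1 (i : κ) := exists_eq_lineForm_mul hx (P := aeval f (lineGen w j i)) (m := e)
    (by have := (isHomogeneous_lineGen (w := w) (j := j) i).aeval f hf; rwa [mul_one] at this)
    (by rw [eval_aeval_tuple, ← hw, eval_lineGen hj])
  choose g hg hgeq using h1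
  refine ⟨g, hg, hgeq, fun y hy => ?_⟩
  by_contra! hcon
  have hprop : tupleEval f y = ((w j)⁻¹ * eval y (f j)) • w := by
    funext i
    have := congrArg (eval y) (hgeq i)
    rw [aeval_lineGen, map_mul _ (lineForm x), hcon i, mul_zero] at this
    simp only [map_sub, map_mul, eval_C, sub_eq_zero] at this
    simp only [tupleEval, this, Pi.smul_apply, smul_eq_mul]
    ring
  obtain ⟨c, hc⟩ := exists_smul_of_eval_lineForm hx (hsole y hy ⟨_, hprop⟩)
  have hc0 : c ≠ 0 := by
    rintro rfl
    exact hy (by simpa using hc)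
  have hgx (i : κ) : eval x (g i) = 0 := by
    have := hcon i
    rw [hc, eval_smul_of_isHomogeneous (hg i)] at this
    exact (mul_eq_zero.1 this).resolve_left (pow_ne_zero _ hc0)
  obtain ⟨k, hk⟩ := himm
  apply hk
  refine ⟨(w j)⁻¹ * eval x (pderiv k (f j)), ?_⟩
  funext i
  have := congrArg (fun P => eval x (pderiv k P)) (hgeq i)
  simp only [aeval_lineGen, map_sub, pderiv_mul, pderiv_C, zero_mul, zero_add, map_mul, eval_C,
    map_add, hgx i, mul_zero, eval_lineForm_self, add_zero, sub_eq_zero] at this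
  simp only [tupleEval, this, Pi.smul_apply, smul_eq_mul, ← hw]
  ring

variable [IsAlgClosed F] [Fintype κ]

/-- Since the residual forms have no common zero, they generate all forms of high degree. So the
pullbacks of linear forms through f(x) generate the forms that vanish at x, and their products those
that vanish doubly. -/
lemma exists_eq_sum_lineGen_mul (hf : ∀ i, (f i).IsHomogeneous (e + 1)) (hx : x ≠ 0)
    (hj : tupleEval f x j ≠ 0) (hsole : IsSoleInFibre f x) (himm : IsImmersedAt f x) :
    ∃ E, ∀ m ≥ E,
      (∀ b : MvPolynomial (Fin 2) F, b.IsHomogeneous (e + 1 + m) → eval x b = 0 →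
        ∃ c : κ → MvPolynomial (Fin 2) F, (∀ i, (c i).IsHomogeneous m) ∧
          b = ∑ i, aeval f (lineGen (tupleEval f x) j i) * c i) ∧
      (∀ b : MvPolynomial (Fin 2) F, b.IsHomogeneous (e + (e + m)) →
        ∃ c : κ → κ → MvPolynomial (Fin 2) F, (∀ i k, (c i k).IsHomogeneous m) ∧
          lineForm x ^ 2 * b = ∑ i, ∑ k, aeval f (lineGen (tupleEval f x) j i) *
            aeval f (lineGen (tupleEval f x) j k) * c i k) := by
  obtain ⟨g, hg, hgeq, h0⟩ := exists_residual hf hx hj hsole himm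
  obtain ⟨E, hE⟩ := exists_forall_eq_sum_mul hg h0
  refine ⟨E, fun m hm => ⟨fun b hb hbx => ?_, fun b hb => ?_⟩⟩
  · obtain ⟨b', hb', rfl⟩ := exists_eq_lineForm_mul hx (m := e + m)
      (by convert hb using 1; ring) hbx
    obtain ⟨c, hc, rfl⟩ := hE m hm b' hb'
    refine ⟨c, hc, ?_⟩
    rw [Finset.mul_sum]
    exact Finset.sum_congr rfl fun i _ => by rw [hgeq]; ring
  · obtain ⟨c, hc, rfl⟩ := hE (e + m) (by omega) b hb
    choose c' hc' hc'eq using fun i => hE m hm (c i) (hc i)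
    refine ⟨c', hc', ?_⟩
    rw [Finset.mul_sum]
    refine Finset.sum_congr rfl fun i _ => ?_
    conv_lhs => rw [hc'eq i]
    rw [Finset.mul_sum, Finset.mul_sum]
    exact Finset.sum_congr rfl fun k _ => by rw [hgeq, hgeq]; ring

/-- At a point with a smooth unibranch image, all forms of a certain degree lie in the conductor:
up to a unit they are pulled back from the image. -/
lemma exists_conductor (hf : ∀ i, (f i).IsHomogeneous (e + 1)) (hx : x ≠ 0)
    (hj : tupleEval f x j ≠ 0) (hsole : IsSoleInFibre f x) (himm : IsImmersedAt f x) :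
    ∃ (k m : ℕ) (Δ : MvPolynomial κ F), 0 < k ∧ Δ.IsHomogeneous m ∧
      eval (tupleEval f x) Δ ≠ 0 ∧
      (∀ b : MvPolynomial (Fin 2) F, b.IsHomogeneous ((e + 1) * k) →
        ∃ R : MvPolynomial κ F, R.IsHomogeneous (m + k) ∧ aeval f Δ * b = aeval f R) ∧
      (∀ b : MvPolynomial (Fin 2) F, b.IsHomogeneous (e + (e + (e + 1) * k)) →
        ∃ c : κ → κ → MvPolynomial (Fin 2) F, (∀ i k', (c i k').IsHomogeneous ((e + 1) * k)) ∧
          lineForm x ^ 2 * b = ∑ i, ∑ k', aeval f (lineGen (tupleEval f x) j i) *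
            aeval f (lineGen (tupleEval f x) j k') * c i k') := by
  obtain ⟨E, hE⟩ := exists_eq_sum_lineGen_mul hf hx hj hsole himm
  set w := tupleEval f x with hw
  -- The degree M = (e + 1) k is a multiple of the degree of f, so that homogeneous components of
  -- pullbacks match, and it exceeds the bound E.
  set k := E + 1 with hk
  have hkE : (e + 1) * k ≥ E := by nlinarith
  obtain ⟨hE1, hE2⟩ := hE _ hkE
  set M := (e + 1) * k with hM
  set y := dualCoord w j with hy
  have hyhom : (aeval f y).IsHomogeneous (e + 1) := by
    simpa using (isHomogeneous_dualCoord (w := w) (j := j)).aeval f hf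
  let B (a : Fin (M + 1)) : MvPolynomial (Fin 2) F := X 0 ^ (M - (a : ℕ)) * X 1 ^ (a : ℕ)
  have hB (a : Fin (M + 1)) : (B a).IsHomogeneous M := by
    have := (isHomogeneous_X_pow (R := F) (0 : Fin 2) (M - (a : ℕ))).mul
      (isHomogeneous_X_pow (R := F) (1 : Fin 2) (a : ℕ))
    rwa [Nat.sub_add_cancel (Nat.le_of_lt_succ a.2)] at this
  have hspan (b : MvPolynomial (Fin 2) F) (hb : b.IsHomogeneous M) :
      ∃ t : Fin (M + 1) → F, b = ∑ a, C (t a) * B a := by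
    refine ⟨fun a => formCoeff M a b, ?_⟩
    conv_lhs => rw [eq_sum_formCoeff hb, Finset.sum_range]
    exact Finset.sum_congr rfl fun a _ => mul_assoc _ _ _
  -- A version of Nakayama's lemma: multiplied by y, each monomial B a is its value at x times y ^
  -- (k + 1) plus a combination of the monomials with coefficients vanishing at w. Cramer's rule
  -- solves this system over the coordinate ring of the image.
  have hvan (a : Fin (M + 1)) : ∃ c : κ → MvPolynomial (Fin 2) F, (∀ i, (c i).IsHomogeneous M) ∧
      aeval f y * B a - C (eval x (B a)) * aeval f y ^ (k + 1) =
        ∑ i, aeval f (lineGen w j i) * c i := by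
    apply hE1
    · refine (hyhom.mul (hB a)).sub ?_
      have := (hyhom.pow (k + 1)).C_mul (eval x (B a))
      rwa [mul_add, mul_one, add_comm (_ * k)] at this
    · simp only [map_sub, map_mul, map_pow, eval_aeval_tuple, eval_C, ← hw, hy, eval_dualCoord hj]
      ring
  choose c hc hceq using hvan
  choose t ht using fun a i => hspan (c a i) (hc a i)
  let N : Matrix (Fin (M + 1)) (Fin (M + 1)) (MvPolynomial κ F) :=
    Matrix.of fun a b => ∑ i, C (t a i b) * lineGen w j i
  have key := det_mul_eq_of_forall (aeval f).toRingHom y N B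
    (fun a => C (eval x (B a)) * aeval f y ^ (k + 1)) (fun a => by
      have h : ∑ b, (aeval f).toRingHom (N a b) * B b = ∑ i, aeval f (lineGen w j i) * c a i := by
        simp only [N, Matrix.of_apply, map_sum, Finset.sum_mul]
        rw [Finset.sum_comm]
        refine Finset.sum_congr rfl fun i _ => ?_
        rw [ht a i, Finset.mul_sum]
        refine Finset.sum_congr rfl fun b _ => ?_
        simp only [AlgHom.toRingHom_eq_coe, RingHom.coe_coe, map_mul, algHom_C, algebraMap_eq]
        ring
      rw [h, ← hceq a]
      simp)
  set Δ := Matrix.det (y • (1 : Matrix (Fin (M + 1)) (Fin (M + 1)) (MvPolynomial κ F)) - N)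
    with hΔ
  -- At w the matrix is the identity, because y takes the value 1 and N vanishes.
  have hΔw : eval w Δ = 1 := by
    rw [hΔ, RingHom.map_det]
    have : (eval w).mapMatrix (y • (1 : Matrix (Fin (M + 1)) (Fin (M + 1)) _) - N) = 1 := by
      ext a b
      simp [N, eval_lineGen hj, hy, eval_dualCoord hj, Matrix.one_apply, apply_ite (eval w)]
    rw [this, Matrix.det_one]
  obtain ⟨m, hm⟩ : ∃ m, eval w (homogeneousComponent m Δ) ≠ 0 := by
    by_contra! hcon
    rw [← sum_homogeneousComponent Δ, map_sum, Finset.sum_eq_zero fun i _ => hcon i] at hΔw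
    exact zero_ne_one hΔw
  refine ⟨k, m, homogeneousComponent m Δ, Nat.succ_pos _, homogeneousComponent_isHomogeneous _ _,
    hm, fun b hb => ?_, hE2⟩
  have hb2 : ∃ R : MvPolynomial κ F, aeval f Δ * b = aeval f R := by
    obtain ⟨s, rfl⟩ := hspan b hb
    have h3 (a : Fin (M + 1)) : ∃ R : MvPolynomial κ F, aeval f Δ * B a = aeval f R := by
      refine ⟨∑ b, (y • (1 : Matrix (Fin (M + 1)) (Fin (M + 1)) _) - N).adjugate a b *
        (C (eval x (B b)) * y ^ (k + 1)), ?_⟩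
      rw [map_sum]
      refine (key a).trans (Finset.sum_congr rfl fun b _ => ?_)
      simp [algebraMap_eq]
    choose R hR using h3
    refine ⟨∑ a, C (s a) * R a, ?_⟩
    rw [map_sum, Finset.mul_sum]
    refine Finset.sum_congr rfl fun a _ => ?_
    rw [map_mul, ← hR, algHom_C, algebraMap_eq]
    ring
  obtain ⟨R, hR⟩ := hb2
  refine ⟨homogeneousComponent (m + k) R, homogeneousComponent_isHomogeneous _ _, ?_⟩
  have h4 := homogeneousComponent_aeval (R := F) (Nat.succ_pos e) hf m Δ
  have h5 := homogeneousComponent_aeval (R := F) (Nat.succ_pos e) hf (m + k) R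
  rw [← h4, ← h5, ← hR, mul_add, add_comm, mul_comm _ b, mul_comm _ b,
    homogeneousComponent_mul_of_isHomogeneous hb]

/-- At a point with a smooth unibranch image, the Zariski tangent space of the image is spanned by
the branch. -/
lemma sum_mul_eq_zero_of_unibranch (he : 0 < e) (hf : ∀ i, (f i).IsHomogeneous (e + 1))
    (hx : x ≠ 0) (hj : tupleEval f x j ≠ 0) (hsole : IsSoleInFibre f x) (himm : IsImmersedAt f x)
    {v : κ → F} (hv : ∀ G : MvPolynomial κ F, aeval f G = 0 →
      ∑ i, eval (tupleEval f x) (pderiv i G) * v i = 0) {φ : κ → F}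
    (h0 : ∑ i, φ i * eval x (f i) = 0) (h1 : ∀ j, ∑ i, φ i * eval x (pderiv j (f i)) = 0) :
    ∑ i, φ i * v i = 0 := by
  obtain ⟨k, m, Δ, -, -, hΔ, hR, hE⟩ := exists_conductor hf hx hj hsole himm
  set w := tupleEval f x with hw
  obtain ⟨e', rfl⟩ := Nat.exists_eq_add_of_lt he
  rw [zero_add] at *
  set y := dualCoord w j with hy
  have hyhom : (aeval f y).IsHomogeneous (e' + 1 + 1) := by
    simpa using (isHomogeneous_dualCoord (w := w) (j := j)).aeval f hf
  -- A linear form φ that annihilates the branch tangent pulls back to a form with a double zero at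
  -- x.
  set P := ∑ i, C (φ i) * f i with hP
  have hPhom : P.IsHomogeneous (e' + 1 + 1) := IsHomogeneous.sum _ _ _ fun i _ => (hf i).C_mul _
  obtain ⟨P1, hP1hom, hP1⟩ := exists_eq_lineForm_mul hx hPhom (by simpa [hP] using h0)
  obtain ⟨l, hl⟩ := exists_pderiv_lineForm_ne_zero hx
  have hP1x : eval x P1 = 0 := by
    have h2 := congrArg (fun P => eval x (pderiv l P)) hP1
    simp only [pderiv_mul, map_add, map_mul, eval_lineForm_self, zero_mul, add_zero] at h2
    have h3 : eval x (pderiv l P) = 0 := by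
      rw [← h1 l, hP]
      simp
    rw [h3] at h2
    exact (mul_eq_zero.1 h2.symm).resolve_left (hl x)
  obtain ⟨P2, hP2hom, rfl⟩ := exists_eq_lineForm_mul hx hP1hom hP1x
  -- The factor y ^ (k + 1) raises the degree of P2 to the one required by the conductor.
  obtain ⟨c, hc, hceq⟩ := hE (aeval f y ^ (k + 1) * P2) (by
    convert (hyhom.pow (k + 1)).mul hP2hom using 1
    ring)
  choose R hRhom hReq using fun i k' => hR (c i k') (hc i k')
  -- An equation of the image: near w it is φ minus terms quadratic in the linear forms through w.
  -- Its differential at w is therefore the value of Δ at w times φ, which shows that tangent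
  -- vectors are annihilated by φ.
  set G : MvPolynomial κ F := Δ * y ^ (k + 1) * (∑ i, C (φ i) * X i) -
    ∑ i, ∑ k', lineGen w j i * lineGen w j k' * R i k' with hG
  have hGf : aeval f G = 0 := by
    have hlin : aeval f (∑ i, C (φ i) * X i) = P := by simp [hP, algebraMap_eq]
    have hsum : aeval f (∑ i, ∑ k', lineGen w j i * lineGen w j k' * R i k') =
        aeval f Δ * ∑ i, ∑ k', aeval f (lineGen w j i) * aeval f (lineGen w j k') * c i k' := by
      simp only [map_sum, map_mul, Finset.mul_sum, ← hReq]
      exact Finset.sum_congr rfl fun i _ => Finset.sum_congr rfl fun k' _ => by ring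
    rw [hG, map_sub, hsum, ← hceq, map_mul, map_mul, hlin, hP1, map_pow]
    ring
  have hpd (i : κ) : eval w (pderiv i G) = eval w Δ * φ i := by
    classical
    have hz : eval w (∑ i, C (φ i) * X i) = 0 := by simpa [hw, tupleEval] using h0
    have hs : eval w (pderiv i (∑ i, ∑ k', lineGen w j i * lineGen w j k' * R i k')) = 0 := by
      simp [eval_lineGen hj]
    have hl : pderiv i (∑ i, C (φ i) * X i : MvPolynomial κ F) = C (φ i) := by
      simp [pderiv_X, Pi.single_apply]
    rw [hG, map_sub, map_sub, hs, pderiv_mul, map_add, map_mul _ _ (∑ i, C (φ i) * X i), hz,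
      hl]
    simp [hy, eval_dualCoord hj]
  have := hv G hGf
  simp only [hpd, mul_assoc, ← Finset.mul_sum] at this
  exact (mul_eq_zero.1 this).resolve_left hΔ

end Unibranch

end LocalCurve
end RationalCurve

namespace RationalCurve

/-! ### The function field of the image -/

section Birational

variable {F : Type*} [Field F] {κ : Type*}

/-- Dehomogenization of binary forms. -/
def affineMap (F : Type*) [Field F] : MvPolynomial (Fin 2) F →ₐ[F] RatFunc F :=
  aeval ![1, RatFunc.X]

lemma affineMap_injective {m : ℕ} {P : MvPolynomial (Fin 2) F} (hP : P.IsHomogeneous m)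
    (h : affineMap F P = 0) : P = 0 := by
  set p : Polynomial F := ∑ k ∈ Finset.range (m + 1), Polynomial.C (formCoeff m k P) *
    Polynomial.X ^ k with hp
  have h1 : affineMap F P = algebraMap (Polynomial F) (RatFunc F) p := by
    conv_lhs => rw [eq_sum_formCoeff hP]
    simp [affineMap, hp, map_sum, RatFunc.algebraMap_X, RatFunc.algebraMap_C,
      RatFunc.algebraMap_eq_C]
  rw [h1, map_eq_zero_iff _ (RatFunc.algebraMap_injective F)] at h
  rw [eq_sum_formCoeff hP]
  refine Finset.sum_eq_zero fun k hk => ?_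
  have : p.coeff k = formCoeff m k P := by
    simp only [hp, Polynomial.finsetSum_coeff, Polynomial.coeff_C_mul, Polynomial.coeff_X_pow,
      mul_ite, mul_one, mul_zero, Finset.sum_ite_eq, hk, if_true]
  rw [← this, h]
  simp

/-- The field generated by the ratios of the forms `f i`. -/
def ratioField (f : κ → MvPolynomial (Fin 2) F) : IntermediateField F (RatFunc F) :=
  IntermediateField.adjoin F
    {g : RatFunc F | ∃ i j, f j ≠ 0 ∧
      g = aeval ![1, RatFunc.X] (f i) / aeval ![1, RatFunc.X] (f j)}

variable {f : κ → MvPolynomial (Fin 2) F} {d : ℕ}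

lemma div_mem_ratioField (hf : ∀ i, (f i).IsHomogeneous d) {j : κ} (hj : f j ≠ 0) {m : ℕ}
    {R : MvPolynomial κ F} (hR : R.IsHomogeneous m) :
    affineMap F (aeval f R) / affineMap F (f j) ^ m ∈ ratioField f := by
  have hj' : affineMap F (f j) ≠ 0 := fun h => hj (affineMap_injective (hf j) h)
  have h1 : affineMap F (aeval f R) = aeval (fun i => affineMap F (f i)) R := by
    have : (affineMap F).comp (aeval f) = aeval fun i => affineMap F (f i) := by
      ext i; simp
    exact AlgHom.congr_fun this R
  have h2 : (fun i => affineMap F (f i)) =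
      affineMap F (f j) • fun i => affineMap F (f i) / affineMap F (f j) := by
    ext i
    simp only [Pi.smul_apply, smul_eq_mul]
    field_simp
  have h3 (v : κ → RatFunc F) : aeval v R = eval v (map (algebraMap F (RatFunc F)) R) := by
    rw [eval_map, aeval_def]
  rw [h1, h2, h3, eval_smul_of_isHomogeneous (hR.map _), ← h3, mul_div_cancel_left₀ _
    (pow_ne_zero _ hj')]
  have h4 (i : κ) : affineMap F (f i) / affineMap F (f j) ∈ ratioField f :=
    IntermediateField.subset_adjoin _ _ ⟨i, j, hj, rfl⟩
  have h5 : aeval (fun i => (⟨_, h4 i⟩ : ratioField f)) R ∈ (⊤ : Subalgebra F (ratioField f)) :=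
    trivial
  have h6 : aeval (fun i => affineMap F (f i) / affineMap F (f j)) R =
      (ratioField f).val (aeval (fun i => (⟨_, h4 i⟩ : ratioField f)) R) := by
    have : (ratioField f).val.comp (aeval (fun i => (⟨_, h4 i⟩ : ratioField f))) =
        aeval (fun i => affineMap F (f i) / affineMap F (f j)) := by
      ext i; simp
    rw [← this]; rfl
  rw [h6]
  exact SetLike.coe_mem _

/-- The generators are fractions of pulled back forms of equal degree, and such fractions are closed
under the field operations. -/
lemma exists_of_mem_ratioField (hf : ∀ i, (f i).IsHomogeneous d) {g : RatFunc F}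
    (hg : g ∈ ratioField f) : ∃ (m : ℕ) (P Q : MvPolynomial κ F), P.IsHomogeneous m ∧
      Q.IsHomogeneous m ∧ aeval f Q ≠ 0 ∧
        g * affineMap F (aeval f Q) = affineMap F (aeval f P) := by
  have hne {m : ℕ} {Q : MvPolynomial κ F} (hQ : Q.IsHomogeneous m) (h : aeval f Q ≠ 0) :
      affineMap F (aeval f Q) ≠ 0 := fun h' => h (affineMap_injective (hQ.aeval f hf) h')
  induction hg using IntermediateField.adjoin_induction with
  | mem g hg =>
    obtain ⟨i, j, hj, rfl⟩ := hg
    refine ⟨1, X i, X j, isHomogeneous_X _ _, isHomogeneous_X _ _, by simpa using hj, ?_⟩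
    have hj' := hne (isHomogeneous_X F j) (by simpa using hj)
    rw [aeval_X] at hj'
    rw [aeval_X, aeval_X]
    exact div_mul_cancel₀ _ hj'
  | algebraMap c =>
    exact ⟨0, C c, 1, isHomogeneous_C _ _, isHomogeneous_one _ _, by simp, by
      simp [algebraMap_eq, algHom_C]⟩
  | add g g' _ _ h h' =>
    obtain ⟨m, P, Q, hP, hQ, hQ0, h⟩ := h
    obtain ⟨m', P', Q', hP', hQ', hQ0', h'⟩ := h'
    refine ⟨m + m', P * Q' + Q * P', Q * Q', (hP.mul hQ').add (hQ.mul hP'), hQ.mul hQ', ?_, ?_⟩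
    · rw [map_mul]; exact mul_ne_zero hQ0 hQ0'
    · simp only [map_mul, map_add, ← h, ← h']
      ring
  | mul g g' _ _ h h' =>
    obtain ⟨m, P, Q, hP, hQ, hQ0, h⟩ := h
    obtain ⟨m', P', Q', hP', hQ', hQ0', h'⟩ := h'
    refine ⟨m + m', P * P', Q * Q', hP.mul hP', hQ.mul hQ', ?_, ?_⟩
    · rw [map_mul]; exact mul_ne_zero hQ0 hQ0'
    · simp only [map_mul, ← h, ← h']
      ring
  | inv g _ h =>
    obtain ⟨m, P, Q, hP, hQ, hQ0, h⟩ := h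
    by_cases hg : g = 0
    · exact ⟨0, 0, 1, isHomogeneous_zero _ _ _, isHomogeneous_one _ _, by simp, by simp [hg]⟩
    · refine ⟨m, Q, P, hQ, hP, ?_, ?_⟩
      · intro hP0
        rw [hP0, map_zero] at h
        exact mul_ne_zero hg (hne hQ hQ0) h
      · rw [← h, inv_mul_cancel_left₀ hg]

/-- A morphism with a smooth unibranch image point parametrizes its image. -/
lemma ratioField_eq_top [IsAlgClosed F] [Fintype κ] {e : ℕ} {x : Fin 2 → F} {j : κ}
    (hf : ∀ i, (f i).IsHomogeneous (e + 1)) (hx : x ≠ 0)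
    (hj : tupleEval f x j ≠ 0) (hsole : IsSoleInFibre f x) (himm : IsImmersedAt f x) :
    ratioField f = ⊤ := by
  obtain ⟨k, m, Δ, hk, hΔ, hΔx, hR, -⟩ := exists_conductor hf hx hj hsole himm
  set N := (e + 1) * k with hN
  -- The forms X 0 ^ (N' + 1) and X 0 ^ N' * X 1 have the affine coordinate as their quotient. Both
  -- become pullbacks after multiplication by Δ, which cancels.
  obtain ⟨N', hN'⟩ : ∃ N', N = N' + 1 := Nat.exists_eq_succ_of_ne_zero (by positivity)
  obtain ⟨R, hRhom, hR0⟩ := hR (X 0 ^ (N' + 1)) (by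
    rw [hN']; exact isHomogeneous_X_pow _ _)
  obtain ⟨R', hRhom', hR1⟩ := hR (X 0 ^ N' * X 1) (by
    rw [hN']; exact (isHomogeneous_X_pow _ _).mul (isHomogeneous_X _ _))
  have hfj : f j ≠ 0 := fun h => hj (by simp [tupleEval, h])
  have hfj' : affineMap F (f j) ≠ 0 := fun h => hfj (affineMap_injective (hf j) h)
  have hΔ0 : affineMap F (aeval f Δ) ≠ 0 := fun h => by
    have := affineMap_injective (hΔ.aeval f hf) h
    rw [← eval_aeval_tuple, this, map_zero] at hΔx
    exact hΔx rfl
  have h0 := div_mem_ratioField hf hfj hRhom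
  have h1 := div_mem_ratioField hf hfj hRhom'
  rw [← hR0] at h0
  rw [← hR1] at h1
  have e0 : affineMap F (X 0) = 1 := by simp [affineMap]
  have e1 : affineMap F (X 1) = RatFunc.X := by simp [affineMap]
  simp only [map_mul, map_pow, e0, e1, one_pow, mul_one, one_mul] at h0 h1
  have h2 := (ratioField f).div_mem h1 h0
  have h3 : affineMap F (aeval f Δ) * RatFunc.X / affineMap F (f j) ^ (m + k) /
      (affineMap F (aeval f Δ) / affineMap F (f j) ^ (m + k)) = RatFunc.X := by
    have := pow_ne_zero (m + k) hfj'
    field_simp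
  rw [h3] at h2
  rw [eq_top_iff, ← RatFunc.adjoin_X, IntermediateField.adjoin_simple_le_iff]
  exact h2

end Birational

/-! ### Nonsingular points of the image of a birational morphism -/

section Nonsingular

variable {F : Type*} [Field F] {κ : Type*} [Fintype κ] {f : κ → MvPolynomial (Fin 2) F}

/-- The span of the differentials at `w` of the homogeneous polynomials that vanish on the image. -/
def conormal (f : κ → MvPolynomial (Fin 2) F) (w : κ → F) : Submodule F (κ → F) :=
  Submodule.span F {μ | ∃ (G : MvPolynomial κ F) (k : ℕ), G.IsHomogeneous k ∧ aeval f G = 0 ∧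
    μ = fun i => eval w (pderiv i G)}

variable {x : Fin 2 → F} {j : κ}

/-- By the first order expansion of the equations of the image, a conormal vector is a linear form
that lies in the square of the maximal ideal of the local ring at f(x). The power of `dualCoord`
plays the role of a unit. -/
lemma exists_of_mem_conormal (hj : tupleEval f x j ≠ 0)
    {μ : κ → F} (hμ : μ ∈ conormal f (tupleEval f x)) :
    ∃ (K : ℕ) (N : κ → MvPolynomial κ F), (∀ i, N i ∈ lineIdeal (tupleEval f x) j) ∧
      aeval f (dualCoord (tupleEval f x) j ^ K * ∑ i, C (μ i) * lineGen (tupleEval f x) j i) =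
        aeval f (∑ i, N i * lineGen (tupleEval f x) j i) := by
  set w := tupleEval f x with hw
  set y := dualCoord w j
  induction hμ using Submodule.span_induction with
  | mem μ hμ =>
    obtain ⟨G, k, hG, hGf, rfl⟩ := hμ
    have hG0 : eval w G = 0 := by rw [hw, ← eval_aeval_tuple, hGf, map_zero]
    rcases k with _ | k
    · obtain ⟨c, rfl⟩ : ∃ c, G = C c := by
        rw [← mem_homogeneousSubmodule, homogeneousSubmodule_zero] at hG
        obtain ⟨c, hc⟩ := Submodule.mem_one.1 hG
        exact ⟨c, hc.symm⟩
      exact ⟨0, 0, fun i => (lineIdeal w j).zero_mem, by simp⟩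
    · obtain ⟨N, hN, hGN⟩ := exists_eq_sum_pderiv_add hj hG hG0
      refine ⟨k, fun i => -N i, fun i => (lineIdeal w j).neg_mem (hN i), ?_⟩
      rw [hGN, map_add] at hGf
      rw [eq_neg_of_add_eq_zero_left hGf, ← map_neg, ← Finset.sum_neg_distrib]
      simp only [neg_mul]
  | zero => exact ⟨0, 0, fun i => (lineIdeal w j).zero_mem, by simp⟩
  | add μ μ' _ _ h h' =>
    obtain ⟨K, N, hN, h⟩ := h
    obtain ⟨K', N', hN', h'⟩ := h'
    refine ⟨K + K', fun i => y ^ K' * N i + y ^ K * N' i, fun i => (lineIdeal w j).add_mem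
      ((lineIdeal w j).mul_mem_left _ (hN i)) ((lineIdeal w j).mul_mem_left _ (hN' i)), ?_⟩
    have e1 : y ^ (K + K') * ∑ i, C ((μ + μ') i) * lineGen w j i =
        y ^ K' * (y ^ K * ∑ i, C (μ i) * lineGen w j i) +
        y ^ K * (y ^ K' * ∑ i, C (μ' i) * lineGen w j i) := by
      simp only [Pi.add_apply, map_add, add_mul, Finset.sum_add_distrib]
      ring
    have e2 : ∑ i, (y ^ K' * N i + y ^ K * N' i) * lineGen w j i =
        y ^ K' * ∑ i, N i * lineGen w j i + y ^ K * ∑ i, N' i * lineGen w j i := by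
      simp only [add_mul, Finset.sum_add_distrib, Finset.mul_sum, mul_assoc]
    rw [e1, e2, map_add, map_add, map_mul _ (y ^ K') (y ^ K * _), map_mul _ (y ^ K) (y ^ K' * _),
      h, h', map_mul, map_mul]
  | smul c μ _ h =>
    obtain ⟨K, N, hN, h⟩ := h
    refine ⟨K, fun i => C c * N i, fun i => (lineIdeal w j).mul_mem_left _ (hN i), ?_⟩
    have e1 : y ^ K * ∑ i, C ((c • μ) i) * lineGen w j i =
        C c * (y ^ K * ∑ i, C (μ i) * lineGen w j i) := by
      simp only [Pi.smul_apply, smul_eq_mul, C_mul, mul_assoc, ← Finset.mul_sum]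
      ring
    have e2 : ∑ i, (C c * N i) * lineGen w j i = C c * ∑ i, N i * lineGen w j i := by
      simp only [Finset.mul_sum, mul_assoc]
    rw [e1, e2, map_mul _ (C c) (y ^ K * _), h, map_mul]

/-- If the conormal space at a point is as large as for a nonsingular point, then the linear forms
that vanish at the point are locally multiples of one of them. -/
lemma exists_local_parameter (hj : tupleEval f x j ≠ 0) {ε : κ → F}
    (hε : ∀ φ : κ → F, ∑ i, φ i * tupleEval f x i = 0 → ∑ i, φ i * ε i = 0 →
      φ ∈ conormal f (tupleEval f x))
    {η : κ → F} (hη0 : ∑ i, η i * tupleEval f x i = 0) (hη1 : ∑ i, η i * ε i = 1) :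
    ∃ (Δ : MvPolynomial κ F) (R : κ → MvPolynomial κ F), lineMap (tupleEval f x) Δ ≠ 0 ∧
      ∀ i, aeval f Δ * aeval f (lineGen (tupleEval f x) j i) =
        aeval f (∑ k, C (η k) * lineGen (tupleEval f x) j k) * aeval f (R i) := by
  classical
  set w := tupleEval f x with hw
  set y := dualCoord w j with hy
  set z : MvPolynomial κ F := ∑ k, C (η k) * lineGen w j k with hz
  have hjj : lineGen w j j = 0 := by simp [lineGen, dualCoord, ← mul_assoc, ← C_mul, hj]
  -- These are the coefficients of `lineGen w j i` as a linear form. Subtracting a multiple of η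
  -- makes it vanish on ε as well, so that the difference is conormal.
  let φ (i : κ) : κ → F := Pi.single i 1 - (w i * (w j)⁻¹) • Pi.single j 1
  have hφ (i : κ) (v : κ → F) : ∑ k, φ i k * v k = v i - w i * (w j)⁻¹ * v j := by
    simp [φ, sub_mul, Finset.sum_sub_distrib, Pi.single_apply, mul_assoc]
  have hφC (i : κ) : ∑ k, C (φ i k) * lineGen w j k = lineGen w j i := by
    simp [φ, sub_mul, Finset.sum_sub_distrib, Pi.single_apply, apply_ite C, hjj]
  let α (i : κ) : F := ∑ k, φ i k * ε k
  have hμ (i : κ) : φ i - α i • η ∈ conormal f w := by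
    apply hε
    · have : ∑ k, (φ i - α i • η) k * w k = (∑ k, φ i k * w k) - α i * ∑ k, η k * w k := by
        simp [sub_mul, Finset.sum_sub_distrib, Finset.mul_sum, mul_assoc]
      rw [this, hη0, hφ]
      field_simp
      ring
    · have : ∑ k, (φ i - α i • η) k * ε k = (∑ k, φ i k * ε k) - α i * ∑ k, η k * ε k := by
        simp [sub_mul, Finset.sum_sub_distrib, Finset.mul_sum, mul_assoc]
      rw [this, hη1, mul_one, sub_self]
  choose K N hN hKN using fun i => exists_of_mem_conormal hj (hμ i)
  set L := ∑ i, K i with hL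
  have hKL (i : κ) : K i ≤ L := Finset.single_le_sum (fun _ _ => Nat.zero_le _) (Finset.mem_univ i)
  have hrel (i : κ) : aeval f (y ^ L) * aeval f (lineGen w j i) -
      ∑ k, aeval f (y ^ (L - K i) * N i k) * aeval f (lineGen w j k) =
        aeval f (y ^ L) * (C (α i) * aeval f z) := by
    have h1 : ∑ k, C ((φ i - α i • η) k) * lineGen w j k = lineGen w j i - C (α i) * z := by
      simp only [Pi.sub_apply, Pi.smul_apply, smul_eq_mul, map_sub, C_mul, sub_mul,
        Finset.sum_sub_distrib, hφC, hz, Finset.mul_sum, mul_assoc]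
    have h2 := hKN i
    rw [h1, map_mul, map_sub, map_mul _ (C (α i)), algHom_C, algebraMap_eq] at h2
    have h3 : ∑ k, aeval f (y ^ (L - K i) * N i k) * aeval f (lineGen w j k) =
        aeval f (y ^ (L - K i)) * aeval f (∑ k, N i k * lineGen w j k) := by
      simp only [map_sum, map_mul, Finset.mul_sum, mul_assoc]
    have h4 : aeval f (y ^ L) = aeval f (y ^ (L - K i)) * aeval f (y ^ K i) := by
      rw [← map_mul, ← pow_add, Nat.sub_add_cancel (hKL i)]
    rw [h3, ← h2, h4]
    ring
  -- Nakayama's lemma again: modulo the square of the maximal ideal each linear form through w is a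
  -- multiple of z. On the line through w the matrix of the system restricts to a power of the
  -- coordinate times the identity, so its determinant is not zero there.
  have key := det_mul_eq_of_forall (aeval f).toRingHom (y ^ L)
    (Matrix.of fun i k => y ^ (L - K i) * N i k) (fun i => aeval f (lineGen w j i)) _ hrel
  set M := (y ^ L) • (1 : Matrix κ κ (MvPolynomial κ F)) -
    Matrix.of fun i k => y ^ (L - K i) * N i k with hM
  refine ⟨M.det, fun i => ∑ k, M.adjugate i k * (y ^ L * C (α k)), ?_, fun i => ?_⟩
  · have h5 : (lineMap w).mapMatrix M = (Polynomial.X ^ L : Polynomial F) • 1 := by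
      ext1 i k
      have h6 : lineMap w (N i k) = 0 := (mem_lineIdeal_iff hj).1 (hN i k)
      simp only [hM, AlgHom.mapMatrix_apply, Matrix.map_apply, Matrix.sub_apply, Matrix.smul_apply,
        Matrix.of_apply, map_sub, map_mul, h6, mul_zero, sub_zero, smul_eq_mul, map_pow, hy,
        lineMap_dualCoord hj, Matrix.one_apply, apply_ite (lineMap w), map_one, map_zero]
    rw [AlgHom.map_det, h5, Matrix.det_smul, Matrix.det_one, mul_one]
    exact pow_ne_zero _ (pow_ne_zero _ Polynomial.X_ne_zero)
  · refine (key i).trans ?_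
    change _ = aeval f z * aeval f (∑ k, M.adjugate i k * (y ^ L * C (α k)))
    rw [map_sum (aeval f) fun k => M.adjugate i k * (y ^ L * C (α k)), Finset.mul_sum]
    refine Finset.sum_congr rfl fun k _ => ?_
    simp only [AlgHom.toRingHom_eq_coe, RingHom.coe_coe, map_mul, algHom_C, algebraMap_eq]
    ring

variable {e : ℕ}

/-- In the local ring of the image at a nonsingular point, every element is a unit times a power of
the local parameter. -/
lemma exists_eq_pow_mul (hf : ∀ i, (f i).IsHomogeneous (e + 1)) (hx : x ≠ 0)
    (hj : tupleEval f x j ≠ 0) {Δ z : MvPolynomial κ F} {R : κ → MvPolynomial κ F}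
    (hΔ : lineMap (tupleEval f x) Δ ≠ 0) (hz : lineForm x ∣ aeval f z)
    (hR : ∀ i, aeval f Δ * aeval f (lineGen (tupleEval f x) j i) = aeval f z * aeval f (R i))
    (k : ℕ) (P : MvPolynomial κ F) (hP : ¬ lineForm x ^ k ∣ aeval f P) :
    ∃ (l : ℕ) (U V : MvPolynomial κ F), lineMap (tupleEval f x) U ≠ 0 ∧
      lineMap (tupleEval f x) V ≠ 0 ∧ aeval f U * aeval f P = aeval f z ^ l * aeval f V := by
  induction k generalizing P with
  | zero => exact absurd (by simp) hP
  | succ k ih =>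
    by_cases hPw : lineMap (tupleEval f x) P = 0
    · rw [← mem_lineIdeal_iff hj] at hPw
      obtain ⟨c, rfl⟩ := Ideal.mem_span_range_iff_exists_fun.1 hPw
      have h1 : aeval f Δ * aeval f (∑ i, c i * lineGen (tupleEval f x) j i) =
          aeval f z * aeval f (∑ i, c i * R i) := by
        simp only [map_sum, map_mul, Finset.mul_sum]
        refine Finset.sum_congr rfl fun i _ => ?_
        linear_combination aeval f (c i) * hR i
      -- Dividing by z removes a factor `lineForm x` from the pullback, since this form divides the
      -- pullback of z but not that of Δ. So the process stops after at most k steps.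
      obtain ⟨l, U, V, hU, hV, h2⟩ := ih (∑ i, c i * R i) fun h3 => hP <| by
        refine (prime_lineForm hx).pow_dvd_of_dvd_mul_left (k + 1) (a := aeval f Δ) ?_ ?_
        · rw [lineForm_dvd_iff hx]
          exact lineMap_aeval_ne_zero (Nat.succ_pos e) hf hΔ
        · rw [h1, pow_succ, mul_comm]
          exact mul_dvd_mul hz h3
      refine ⟨l + 1, U * Δ, V, by rw [map_mul]; exact mul_ne_zero hU hΔ, hV, ?_⟩
      rw [map_mul, mul_assoc, h1, pow_succ]
      linear_combination aeval f z * h2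
    · exact ⟨0, 1, P, by simp, hPw, by simp⟩

/-- The fibre over a nonsingular point of the image of a birational morphism is a reduced point. -/
lemma unibranch_of_conormal [IsAlgClosed F] (hf : ∀ i, (f i).IsHomogeneous (e + 1)) (hx : x ≠ 0)
    (hfx : tupleEval f x ≠ 0) (hbir : ratioField f = ⊤)
    (hnd : ∀ y, y ≠ 0 → tupleEval f y ≠ 0) {ε : κ → F}
    (hε : ∀ φ : κ → F, ∑ i, φ i * tupleEval f x i = 0 → ∑ i, φ i * ε i = 0 →
      φ ∈ conormal f (tupleEval f x))
    {η : κ → F} (hη0 : ∑ i, η i * tupleEval f x i = 0) (hη1 : ∑ i, η i * ε i = 1) :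
    IsSoleInFibre f x ∧ IsImmersedAt f x := by
  obtain ⟨j, hj⟩ := exists_coord_ne_zero hfx
  obtain ⟨Δ, R, hΔ, hR⟩ := exists_local_parameter hj hε hη0 hη1
  set w := tupleEval f x with hw
  set z : MvPolynomial κ F := ∑ k, C (η k) * lineGen w j k with hz
  have hzhom : (aeval f z).IsHomogeneous (e + 1) := by
    have : z.IsHomogeneous 1 := IsHomogeneous.sum _ _ _ fun k _ =>
      (isHomogeneous_lineGen (w := w) (j := j) k).C_mul (η k)
    have := this.aeval f hf
    rwa [mul_one] at this
  have hzw (c : F) : eval (c • w) z = 0 := by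
    have h1 (k : κ) : eval (c • w) (lineGen w j k) = 0 := by
      rw [eval_smul_of_isHomogeneous (isHomogeneous_lineGen k), eval_lineGen hj, mul_zero]
    simp [hz, h1]
  have hzx : lineForm x ∣ aeval f z := by
    rw [lineForm_dvd_iff_of_isHomogeneous hx hzhom, eval_aeval_tuple, ← hw]
    simpa using hzw 1
  obtain ⟨t, ht⟩ : ∃ t : Fin 2 → F, eval t (lineForm x) ≠ 0 := by
    by_contra! h
    exact lineForm_ne_zero hx (MvPolynomial.funext fun t => by simpa using h t)
  have ht0 : t ≠ 0 := by
    rintro rfl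
    exact ht (by rw [eval_lineForm]; simp)
  have htx : ¬ lineForm x ∣ lineForm t := by
    rw [lineForm_dvd_iff_of_isHomogeneous hx (isHomogeneous_lineForm t)]
    intro h2
    apply ht
    rw [eval_lineForm] at h2 ⊢
    linear_combination -h2
  -- Birationality enters here: a quotient of linear forms with a simple zero at x is a ratio of
  -- forms pulled back from the image.
  obtain ⟨m, P₁, P₂, hP₁, hP₂, hP₂0, hP⟩ := exists_of_mem_ratioField hf
    (show affineMap F (lineForm x) / affineMap F (lineForm t) ∈ ratioField f by
      rw [hbir]; trivial)
  have hat : affineMap F (lineForm t) ≠ 0 := fun h =>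
    lineForm_ne_zero ht0 (affineMap_injective (isHomogeneous_lineForm t) h)
  have heq : lineForm x * aeval f P₂ = lineForm t * aeval f P₁ := by
    rw [← sub_eq_zero]
    refine affineMap_injective (((isHomogeneous_lineForm x).mul (hP₂.aeval f hf)).sub
      ((isHomogeneous_lineForm t).mul (hP₁.aeval f hf))) ?_
    rw [map_sub, map_mul, map_mul, ← hP, sub_eq_zero]
    field_simp
  have hP₁0 : aeval f P₁ ≠ 0 := by
    intro h
    rw [h, mul_zero] at heq
    exact mul_ne_zero (lineForm_ne_zero hx) hP₂0 heq
  have hfin (P : MvPolynomial κ F) (h : aeval f P ≠ 0) : ∃ k, ¬ lineForm x ^ k ∣ aeval f P := by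
    have := FiniteMultiplicity.of_prime_left (prime_lineForm hx) h
    obtain ⟨k, hk⟩ := this
    exact ⟨_, hk⟩
  obtain ⟨k₁, hk₁⟩ := hfin _ hP₁0
  obtain ⟨k₂, hk₂⟩ := hfin _ hP₂0
  obtain ⟨l₁, U₁, V₁, hU₁, hV₁, h₁⟩ := exists_eq_pow_mul hf hx hj hΔ hzx hR k₁ P₁ hk₁
  obtain ⟨l₂, U₂, V₂, hU₂, hV₂, h₂⟩ := exists_eq_pow_mul hf hx hj hΔ hzx hR k₂ P₂ hk₂
  have hunit (y : Fin 2 → F) (hy0 : y ≠ 0) (hy : tupleEval f y = w) (U V : MvPolynomial κ F)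
      (hU : lineMap w U ≠ 0) (hV : lineMap w V ≠ 0) : ¬ lineForm y ∣ aeval f U * aeval f V := by
    rw [lineForm_dvd_iff hy0, map_mul, mul_eq_zero, not_or]
    rw [← hy] at hU hV
    exact ⟨lineMap_aeval_ne_zero (Nat.succ_pos e) hf hU,
      lineMap_aeval_ne_zero (Nat.succ_pos e) hf hV⟩
  have h3 : lineForm x * (aeval f U₁ * aeval f V₂) * aeval f z ^ l₂ =
      lineForm t * (aeval f U₂ * aeval f V₁) * aeval f z ^ l₁ := by
    linear_combination aeval f U₁ * aeval f U₂ * heq + lineForm t * aeval f U₂ * h₁ -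
      lineForm x * aeval f U₁ * h₂
  have hz0 : aeval f z ^ l₂ ≠ 0 := by
    intro h
    rw [h, zero_mul] at h₂
    refine mul_ne_zero (fun h4 => ?_) hP₂0 h₂
    exact lineMap_aeval_ne_zero (x := x) (Nat.succ_pos e) hf hU₂ (by rw [h4, map_zero])
  -- Otherwise cancelling powers of z would leave `lineForm x` as a divisor of a product of forms
  -- that do not vanish at x.
  have hlt : l₂ < l₁ := by
    by_contra! hle
    have h4 : aeval f z ^ l₁ ≠ 0 := fun h => hz0 (by
      rw [← Nat.sub_add_cancel hle, pow_add, h, mul_zero])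
    rw [← Nat.sub_add_cancel hle, pow_add, ← mul_assoc] at h3
    have h5 := mul_right_cancel₀ h4 h3
    have h6 : lineForm x ∣ lineForm t * (aeval f U₂ * aeval f V₁) :=
      ⟨(aeval f U₁ * aeval f V₂) * aeval f z ^ (l₂ - l₁), by rw [← h5]; ring⟩
    exact ((prime_lineForm hx).dvd_or_dvd h6).elim htx (hunit x hx rfl _ _ hU₂ hV₁)
  obtain ⟨l, rfl⟩ := Nat.exists_eq_add_of_lt hlt
  -- Polynomials that are nonzero on the line through w pull back to functions not divisible by the
  -- linear form of any y with f(y) = w. So if z vanishes at such a y, then `lineForm x` vanishes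
  -- there too, and a double zero of z at x is impossible.
  have h7 : lineForm x * (aeval f U₁ * aeval f V₂) =
      lineForm t * (aeval f U₂ * aeval f V₁) * aeval f z ^ (l + 1) := by
    refine mul_right_cancel₀ hz0 (h3.trans ?_)
    ring
  constructor
  · rintro y hy ⟨c, hc⟩
    have hc0 : c ≠ 0 := by
      rintro rfl
      exact hnd y hy (by rw [hc, zero_smul])
    -- Rescaling y by an (e + 1)-th root makes its value equal to w, not only proportional to it.
    obtain ⟨b, hb⟩ := IsAlgClosed.exists_pow_nat_eq c⁻¹ (Nat.succ_pos e)
    have hb0 : b ≠ 0 := by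
      rintro rfl
      rw [zero_pow (Nat.succ_ne_zero e)] at hb
      exact inv_ne_zero hc0 hb.symm
    have hy' : tupleEval f (b • y) = w := by
      rw [tupleEval_smul hf, hb, hc, smul_smul, inv_mul_cancel₀ hc0, one_smul]
    have hby : b • y ≠ 0 := smul_ne_zero hb0 hy
    have h8 : lineForm (b • y) ∣ aeval f z := by
      rw [lineForm_dvd_iff_of_isHomogeneous hby hzhom, eval_aeval_tuple, hy']
      simpa using hzw 1
    have h9 : lineForm (b • y) ∣ lineForm x * (aeval f U₁ * aeval f V₂) := by
      rw [h7, pow_succ]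
      exact dvd_mul_of_dvd_right (dvd_mul_of_dvd_right h8 _) _
    have h10 := ((prime_lineForm hby).dvd_or_dvd h9).resolve_right (hunit _ hby hy' _ _ hU₁ hV₂)
    rw [lineForm_dvd_iff_of_isHomogeneous hby (isHomogeneous_lineForm x),
      eval_smul_of_isHomogeneous (isHomogeneous_lineForm x)] at h10
    exact (mul_eq_zero.1 h10).resolve_left (pow_ne_zero _ hb0)
  · by_contra hni
    have hni' (l : Fin 2) : ∃ c : F, tupleEval (fun i => pderiv l (f i)) x = c • w := by
      by_contra h
      exact hni ⟨l, h⟩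
    obtain ⟨Q, hQ, hzQ⟩ := exists_eq_lineForm_mul hx hzhom (by
      rw [eval_aeval_tuple]; simpa using hzw 1)
    obtain ⟨l', hl'⟩ := exists_pderiv_lineForm_ne_zero hx
    have hQx : eval x Q = 0 := by
      have h12 := congrArg (fun P => eval x (pderiv l' P)) hzQ
      simp only [pderiv_mul, map_add, map_mul, eval_lineForm_self, zero_mul, add_zero] at h12
      have h13 : eval x (pderiv l' (aeval f z)) = 0 := by
        obtain ⟨c, hc⟩ := hni' l'
        have hzc := hzw c
        rw [← hc] at hzc
        rw [← hzc, hz]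
        simp [algebraMap_eq, lineGen, dualCoord, tupleEval]
      rw [h13] at h12
      exact (mul_eq_zero.1 h12.symm).resolve_left (hl' x)
    have hQd : lineForm x ∣ Q := by
      rwa [lineForm_dvd_iff_of_isHomogeneous hx hQ]
    obtain ⟨Q', rfl⟩ := hQd
    rw [hzQ, pow_succ] at h7
    have h14 : aeval f U₁ * aeval f V₂ = lineForm x * (lineForm t * (aeval f U₂ * aeval f V₁) *
        (lineForm x * (lineForm x * Q')) ^ l * Q') := by
      refine mul_left_cancel₀ (lineForm_ne_zero hx) (h7.trans ?_)
      ring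
    exact hunit x hx rfl _ _ hU₁ hV₂ ⟨_, h14⟩

end Nonsingular
end RationalCurve

namespace RationalCurve

/-! ### The chain rule and orthogonality -/

section Chain

variable {F : Type*} [Field F] {κ : Type*} [Fintype κ]

lemma pderiv_aeval_eq_sum {τ : Type*} (f : κ → MvPolynomial τ F) (j : τ) (G : MvPolynomial κ F) :
    pderiv j (aeval f G) = ∑ i, aeval f (pderiv i G) * pderiv j (f i) := by
  classical
  induction G using MvPolynomial.induction_on with
  | C a => simp [algHom_C, algebraMap_eq]
  | add p q hp hq => simp only [map_add, hp, hq, add_mul, Finset.sum_add_distrib]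
  | mul_X p i hp =>
    simp only [map_mul, aeval_X, pderiv_mul, hp, map_add, add_mul, Finset.sum_add_distrib,
      Finset.sum_mul, pderiv_X]
    congr 1
    · exact Finset.sum_congr rfl fun k _ => by ring
    · rw [Finset.sum_eq_single i]
      · simp
      · intro k _ hk
        simp [Pi.single_eq_of_ne hk.symm]
      · simp

/-- A vector that is orthogonal to everything orthogonal to a subspace lies in it. -/
lemma mem_of_forall_sum_mul_eq_zero (W : Submodule F (κ → F)) {v : κ → F}
    (h : ∀ φ : κ → F, (∀ w ∈ W, ∑ i, φ i * w i = 0) → ∑ i, φ i * v i = 0) : v ∈ W := by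
  classical
  by_contra hv
  obtain ⟨g, hgv, hg⟩ := Submodule.exists_le_ker_of_notMem hv
  have hrep (u : κ → F) : g u = ∑ i, g (Pi.single i 1) * u i := by
    conv_lhs => rw [pi_eq_sum_univ u, map_sum]
    refine Finset.sum_congr rfl fun i _ => ?_
    rw [map_smul, smul_eq_mul, mul_comm]
    congr 2
    ext k
    simp [Pi.single_apply, eq_comm]
  apply hgv
  rw [hrep]
  exact h _ fun w hw => by rw [← hrep]; exact hg hw

end Chain

section Projective

variable {F : Type*} [Field F]

lemma eq_of_eval_lineForm_eq_zero {p p' : Proj F (Fin 2)}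
    (h : eval p'.rep (lineForm p.rep) = 0) : p' = p := by
  obtain ⟨c, hc⟩ := exists_smul_of_eval_lineForm p.rep_nonzero h
  rw [← p.mk_rep, ← p'.mk_rep, Projectivization.mk_eq_mk_iff']
  exact ⟨c, hc.symm⟩

lemma eval_lineForm_ne_zero {p p' : Proj F (Fin 2)} (h : p ≠ p') :
    eval p'.rep (lineForm p.rep) ≠ 0 := fun h' => h (eq_of_eval_lineForm_eq_zero h').symm

lemma exists_rep_mk {ι : Type*} {v : ι → F} (hv : v ≠ 0) :
    ∃ a : F, a ≠ 0 ∧ (Projectivization.mk F v hv).rep = a • v := by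
  obtain ⟨a, ha⟩ := Projectivization.exists_smul_eq_mk_rep F v hv
  exact ⟨a, a.ne_zero, ha.symm⟩

end Projective

/-! ### Fibres, branch tangents and Zariski tangent spaces of morphisms -/

namespace Mor

variable {F : Type*} [Field F] {n d : ℕ} (f : Mor F n d)

lemma isHomogeneous_comp (i : Fin (n + 1)) : (f.comp i).IsHomogeneous d :=
  isHomogeneous_sum_form _

lemma tupleEval_comp_ne_zero {x : Fin 2 → F} (hx : x ≠ 0) : tupleEval f.comp x ≠ 0 := by
  obtain ⟨i, hi⟩ := f.2 (Projectivization.mk F x hx)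
  obtain ⟨a, ha, hax⟩ := exists_rep_mk hx
  intro h
  apply hi
  rw [hax]
  change eval _ (f.comp i) = 0
  rw [eval_smul_of_isHomogeneous (f.isHomogeneous_comp i)]
  have := congrFun h i
  simp only [tupleEval, Pi.zero_apply] at this
  rw [this, mul_zero]

lemma toFun_mk {x : Fin 2 → F} (hx : x ≠ 0) : f.toFun (Projectivization.mk F x hx) =
    Projectivization.mk F (tupleEval f.comp x) (f.tupleEval_comp_ne_zero hx) := by
  obtain ⟨a, ha, hax⟩ := exists_rep_mk hx
  rw [toFun, Projectivization.mk_eq_mk_iff']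
  exact ⟨a ^ d, by rw [← tupleEval_smul f.isHomogeneous_comp, ← hax]; rfl⟩

lemma toFun_eq (p : Proj F (Fin 2)) : f.toFun p =
    Projectivization.mk F (tupleEval f.comp p.rep) (f.tupleEval_comp_ne_zero p.rep_nonzero) := rfl

lemma toFun_eq_mk_iff {p : Proj F (Fin 2)} {v : Fin (n + 1) → F} (hv : v ≠ 0) :
    f.toFun p = Projectivization.mk F v hv ↔ ∃ c : F, tupleEval f.comp p.rep = c • v := by
  rw [toFun_eq, Projectivization.mk_eq_mk_iff']
  exact ⟨fun ⟨a, h⟩ => ⟨a, h.symm⟩, fun ⟨a, h⟩ => ⟨a, h.symm⟩⟩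

lemma toFun_eq_toFun_iff {p p' : Proj F (Fin 2)} :
    f.toFun p' = f.toFun p ↔ ∃ c : F, tupleEval f.comp p'.rep = c • tupleEval f.comp p.rep := by
  rw [f.toFun_eq p, toFun_eq_mk_iff]

lemma isSoleInFibre_iff {p : Proj F (Fin 2)} :
    IsSoleInFibre f.comp p.rep ↔ ∀ p', f.toFun p' = f.toFun p → p' = p := by
  constructor
  · intro h p' hp'
    exact eq_of_eval_lineForm_eq_zero (h _ p'.rep_nonzero (f.toFun_eq_toFun_iff.1 hp'))
  · rintro h y hy ⟨c, hc⟩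
    have h1 := h (Projectivization.mk F y hy) (by
      rw [f.toFun_mk hy, f.toFun_eq p, Projectivization.mk_eq_mk_iff']
      exact ⟨c, hc.symm⟩)
    rw [← p.mk_rep, Projectivization.mk_eq_mk_iff'] at h1
    obtain ⟨a, ha⟩ := h1
    rw [← ha]
    exact eval_lineForm_smul _ _

lemma forall_mem_image_iff [Infinite F] {G : MvPolynomial (Fin (n + 1)) F} {k : ℕ}
    (hG : G.IsHomogeneous k) : (∀ z ∈ f.image, eval z.rep G = 0) ↔ aeval f.comp G = 0 := by
  constructor
  · intro h
    refine IsHomogeneous.eq_zero_of_forall_eval_eq_zero (hG.aeval f.comp f.isHomogeneous_comp)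
      fun x => ?_
    rw [eval_aeval_tuple]
    by_cases hx : x = 0
    · rcases Nat.eq_zero_or_pos (d * k) with h0 | h0
      · subst hx
        have h1 := h _ ⟨Projectivization.mk F ![1, 0] (fun h => one_ne_zero (congrFun h 0)), rfl⟩
        rw [f.toFun_mk] at h1
        obtain ⟨a, ha, hax⟩ := exists_rep_mk (f.tupleEval_comp_ne_zero
          (x := ![1, 0]) (fun h => one_ne_zero (congrFun h 0)))
        rw [hax, eval_smul_of_isHomogeneous hG] at h1
        have h2 := (mul_eq_zero.1 h1).resolve_left (pow_ne_zero _ ha)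
        rw [← eval_aeval_tuple] at h2 ⊢
        have h3 := eval_smul_of_isHomogeneous (hG.aeval f.comp f.isHomogeneous_comp) 0 ![(1 : F), 0]
        rw [zero_smul] at h3
        rw [h3, h2, mul_zero]
      · rw [← eval_aeval_tuple, hx]
        have h3 := eval_smul_of_isHomogeneous (hG.aeval f.comp f.isHomogeneous_comp) 0
          (0 : Fin 2 → F)
        rw [zero_smul, zero_pow h0.ne', zero_mul] at h3
        exact h3
    · have h1 := h _ ⟨Projectivization.mk F x hx, rfl⟩
      rw [f.toFun_mk] at h1
      obtain ⟨a, ha, hax⟩ := exists_rep_mk (f.tupleEval_comp_ne_zero hx)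
      rw [hax, eval_smul_of_isHomogeneous hG] at h1
      exact (mul_eq_zero.1 h1).resolve_left (pow_ne_zero _ ha)
  · rintro h _ ⟨p, rfl⟩
    rw [f.toFun_eq]
    obtain ⟨a, ha, hax⟩ := exists_rep_mk (f.tupleEval_comp_ne_zero p.rep_nonzero)
    rw [hax, eval_smul_of_isHomogeneous hG, ← eval_aeval_tuple, h, map_zero, mul_zero]

lemma mem_zariskiTangent_iff [Infinite F] (p : Proj F (Fin 2)) (v : Fin (n + 1) → F) :
    v ∈ zariskiTangent f.image (f.toFun p) ↔
      ∀ φ ∈ conormal f.comp (tupleEval f.comp p.rep), ∑ i, φ i * v i = 0 := by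
  obtain ⟨a, ha, hax⟩ := exists_rep_mk (f.tupleEval_comp_ne_zero p.rep_nonzero)
  have key (G : MvPolynomial (Fin (n + 1)) F) (k : ℕ) (hG : G.IsHomogeneous k) :
      ∑ i, eval (f.toFun p).rep (pderiv i G) * v i =
        a ^ (k - 1) * ∑ i, eval (tupleEval f.comp p.rep) (pderiv i G) * v i := by
    rw [Finset.mul_sum]
    refine Finset.sum_congr rfl fun i _ => ?_
    rw [f.toFun_eq, hax, eval_smul_of_isHomogeneous hG.pderiv, mul_assoc]
  constructor
  · intro h φ hφ
    induction hφ using Submodule.span_induction with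
    | mem φ hφ =>
      obtain ⟨G, k, hG, hG0, rfl⟩ := hφ
      have := h G k hG ((f.forall_mem_image_iff hG).2 hG0)
      rw [key G k hG] at this
      exact (mul_eq_zero.1 this).resolve_left (pow_ne_zero _ ha)
    | zero => simp
    | add φ φ' _ _ h h' => simp [add_mul, Finset.sum_add_distrib, h, h']
    | smul c φ _ h => simp [mul_assoc, ← Finset.mul_sum, h]
  · intro h G k hG hG0
    rw [key G k hG, h _ (Submodule.subset_span
      ⟨G, k, hG, (f.forall_mem_image_iff hG).1 hG0, rfl⟩), mul_zero]

lemma sum_pderiv_mul_eq_zero [Infinite F] (hd : 0 < d) {p : Proj F (Fin 2)} {v : Fin (n + 1) → F}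
    (hv : v ∈ zariskiTangent f.image (f.toFun p)) {G : MvPolynomial (Fin (n + 1)) F}
    (hG : aeval f.comp G = 0) :
    ∑ i, eval (tupleEval f.comp p.rep) (pderiv i G) * v i = 0 := by
  rw [mem_zariskiTangent_iff] at hv
  have h1 (k : ℕ) := hv _ (Submodule.subset_span ⟨homogeneousComponent k G, k,
    homogeneousComponent_isHomogeneous k G, by
      rw [← homogeneousComponent_aeval hd f.isHomogeneous_comp, hG, map_zero], rfl⟩)
  conv_lhs => rw [← sum_homogeneousComponent G]
  simp only [map_sum, Finset.sum_mul]
  rw [Finset.sum_comm]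
  exact Finset.sum_eq_zero fun k _ => h1 k

lemma tupleEval_mem_branchTangent (p : Proj F (Fin 2)) :
    tupleEval f.comp p.rep ∈ f.branchTangent p := Submodule.subset_span (Or.inl rfl)

lemma tupleEval_pderiv_mem_branchTangent (p : Proj F (Fin 2)) (j : Fin 2) :
    tupleEval (fun i => pderiv j (f.comp i)) p.rep ∈ f.branchTangent p :=
  Submodule.subset_span (Or.inr ⟨j, rfl⟩)

lemma branchTangent_le {p : Proj F (Fin 2)} {W : Submodule F (Fin (n + 1) → F)}
    (h0 : tupleEval f.comp p.rep ∈ W)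
    (h1 : ∀ j, tupleEval (fun i => pderiv j (f.comp i)) p.rep ∈ W) : f.branchTangent p ≤ W := by
  rw [branchTangent, Submodule.span_le]
  rintro v (rfl | ⟨j, rfl⟩)
  · exact h0
  · exact h1 j

/-- By Euler's relation, f(p) and one of the two partial derivatives already span the branch
tangent, so its dimension is at most 2. This holds also when the characteristic divides d. -/
lemma finrank_branchTangent_eq_two_iff (p : Proj F (Fin 2)) :
    Module.finrank F (f.branchTangent p) = 2 ↔ IsImmersedAt f.comp p.rep := by
  set w := tupleEval f.comp p.rep with hw
  have hw0 : w ≠ 0 := f.tupleEval_comp_ne_zero p.rep_nonzero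
  constructor
  · intro h
    by_contra hni
    have hle : f.branchTangent p ≤ Submodule.span F {w} := by
      refine f.branchTangent_le (Submodule.mem_span_singleton_self _) fun j => ?_
      rw [Submodule.mem_span_singleton]
      by_contra hj
      exact hni ⟨j, fun ⟨c, hc⟩ => hj ⟨c, hc.symm⟩⟩
    have := Submodule.finrank_mono hle
    rw [finrank_span_singleton hw0, h] at this
    omega
  · rintro ⟨j, hj⟩
    have hli : LinearIndependent F ![w, tupleEval (fun i => pderiv j (f.comp i)) p.rep] := by
      rw [LinearIndependent.pair_iff' hw0]
      exact fun a h => hj ⟨a, h.symm⟩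
    have heuler : p.rep 0 • tupleEval (fun i => pderiv 0 (f.comp i)) p.rep +
        p.rep 1 • tupleEval (fun i => pderiv 1 (f.comp i)) p.rep = (d : F) • w := by
      funext i
      have := congrArg (eval p.rep) (f.isHomogeneous_comp i).sum_X_mul_pderiv
      simpa [Fin.sum_univ_two, tupleEval, hw] using this
    obtain ⟨v, hv⟩ : ∃ v, f.branchTangent p ≤ Submodule.span F {w, v} := by
      obtain ⟨k, hk⟩ := exists_coord_ne_zero p.rep_nonzero
      have h1 (v) : w ∈ Submodule.span F {w, v} := Submodule.subset_span (by simp)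
      have h2 (v) : v ∈ Submodule.span F {w, v} := Submodule.subset_span (by simp)
      fin_cases k
      · simp only [Fin.zero_eta, Fin.isValue] at hk
        refine ⟨tupleEval (fun i => pderiv 1 (f.comp i)) p.rep,
          f.branchTangent_le (h1 _) fun k => ?_⟩
        fin_cases k
        · have := Submodule.sub_mem _ (Submodule.smul_mem _ (d : F) (h1 _))
            (Submodule.smul_mem _ (p.rep 1)
              (h2 (tupleEval (fun i => pderiv 1 (f.comp i)) p.rep)))
          rw [← heuler, add_sub_cancel_right] at this
          exact (Submodule.smul_mem_iff _ hk).1 this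
        · exact h2 _
      · simp only [Fin.mk_one, Fin.isValue] at hk
        refine ⟨tupleEval (fun i => pderiv 0 (f.comp i)) p.rep,
          f.branchTangent_le (h1 _) fun k => ?_⟩
        fin_cases k
        · exact h2 _
        · have := Submodule.sub_mem _ (Submodule.smul_mem _ (d : F) (h1 _))
            (Submodule.smul_mem _ (p.rep 0)
              (h2 (tupleEval (fun i => pderiv 0 (f.comp i)) p.rep)))
          rw [← heuler, add_sub_cancel_left] at this
          exact (Submodule.smul_mem_iff _ hk).1 this
    apply le_antisymm
    · classical
      refine (Submodule.finrank_mono hv).trans ?_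
      have := finrank_span_finset_le_card (R := F) ({w, v} : Finset (Fin (n + 1) → F))
      rw [Finset.coe_pair] at this
      exact this.trans Finset.card_le_two
    · have h3 := finrank_span_eq_card hli
      rw [Fintype.card_fin] at h3
      refine le_trans (le_of_eq h3.symm) (Submodule.finrank_mono ?_)
      rw [Submodule.span_le]
      rintro _ ⟨k, rfl⟩
      fin_cases k
      · exact f.tupleEval_mem_branchTangent p
      · exact f.tupleEval_pderiv_mem_branchTangent p j

/-- The differential of an equation G annihilates f(p) by Euler's relation for G, and the
derivatives of f at p by the chain rule applied to G(f) = 0. -/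
lemma branchTangent_le_zariskiTangent [Infinite F] (p : Proj F (Fin 2)) :
    f.branchTangent p ≤ zariskiTangent f.image (f.toFun p) := by
  have key (v : Fin (n + 1) → F) (h : ∀ (G : MvPolynomial (Fin (n + 1)) F) (k : ℕ),
      G.IsHomogeneous k → aeval f.comp G = 0 →
        ∑ i, eval (tupleEval f.comp p.rep) (pderiv i G) * v i = 0) :
      v ∈ zariskiTangent f.image (f.toFun p) := by
    rw [mem_zariskiTangent_iff]
    intro φ hφ
    induction hφ using Submodule.span_induction with
    | mem φ hφ =>
      obtain ⟨G, k, hG, hG0, rfl⟩ := hφ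
      exact h G k hG hG0
    | zero => simp
    | add φ φ' _ _ h h' => simp [add_mul, Finset.sum_add_distrib, h, h']
    | smul c φ _ h => simp [mul_assoc, ← Finset.mul_sum, h]
  refine f.branchTangent_le (key _ fun G k hG hG0 => ?_) fun j => key _ fun G k hG hG0 => ?_
  · have h1 := congrArg (eval (tupleEval f.comp p.rep)) hG.sum_X_mul_pderiv
    rw [map_sum, map_nsmul, ← eval_aeval_tuple _ G, hG0, map_zero, smul_zero] at h1
    rw [← h1]
    exact Finset.sum_congr rfl fun i _ => by rw [map_mul, eval_X, mul_comm]
  · have h1 := congrArg (eval p.rep) (pderiv_aeval_eq_sum f.comp j G)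
    rw [hG0, map_zero, map_zero, map_sum] at h1
    rw [h1]
    exact Finset.sum_congr rfl fun i _ => by rw [map_mul, eval_aeval_tuple]; rfl

variable [IsAlgClosed F]

/-- The image is nonsingular at a point with a single smooth branch. -/
lemma finrank_zariskiTangent_of_unibranch (hd : 1 < d) {p : Proj F (Fin 2)}
    (hsole : IsSoleInFibre f.comp p.rep) (himm : IsImmersedAt f.comp p.rep) :
    Module.finrank F (zariskiTangent f.image (f.toFun p)) = 2 := by
  have : Infinite F := IsAlgClosed.instInfinite
  rw [← (f.finrank_branchTangent_eq_two_iff p).2 himm]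
  suffices h : zariskiTangent f.image (f.toFun p) ≤ f.branchTangent p by
    rw [le_antisymm h (f.branchTangent_le_zariskiTangent p)]
  intro v hv
  obtain ⟨j, hj⟩ := exists_coord_ne_zero (f.tupleEval_comp_ne_zero p.rep_nonzero)
  obtain ⟨e, rfl⟩ : ∃ e, d = e + 1 := ⟨d - 1, by omega⟩
  refine mem_of_forall_sum_mul_eq_zero _ fun φ hφ => ?_
  exact sum_mul_eq_zero_of_unibranch (by omega) f.isHomogeneous_comp p.rep_nonzero hj hsole himm
    (fun G hG => f.sum_pderiv_mul_eq_zero (by omega) hv hG)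
    (hφ _ (f.tupleEval_mem_branchTangent p))
    fun j => hφ _ (f.tupleEval_pderiv_mem_branchTangent p j)

lemma isBirational_of_unibranch (hd : 0 < d) {p : Proj F (Fin 2)}
    (hsole : IsSoleInFibre f.comp p.rep) (himm : IsImmersedAt f.comp p.rep) : f.IsBirational := by
  obtain ⟨j, hj⟩ := exists_coord_ne_zero (f.tupleEval_comp_ne_zero p.rep_nonzero)
  obtain ⟨e, rfl⟩ : ∃ e, d = e + 1 := ⟨d - 1, by omega⟩
  exact ratioField_eq_top f.isHomogeneous_comp p.rep_nonzero hj hsole himm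

/-- Over a nonsingular point of the image there is a single smooth branch. -/
lemma unibranch_of_finrank_zariskiTangent (hd : 0 < d) (hbir : f.IsBirational)
    {p : Proj F (Fin 2)} (h : Module.finrank F (zariskiTangent f.image (f.toFun p)) = 2) :
    IsSoleInFibre f.comp p.rep ∧ IsImmersedAt f.comp p.rep := by
  have : Infinite F := IsAlgClosed.instInfinite
  obtain ⟨e, rfl⟩ : ∃ e, d = e + 1 := ⟨d - 1, by omega⟩
  set w := tupleEval f.comp p.rep with hw
  have hw0 : w ≠ 0 := f.tupleEval_comp_ne_zero p.rep_nonzero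
  set T := zariskiTangent f.image (f.toFun p) with hT
  have hwT : w ∈ T := f.branchTangent_le_zariskiTangent p (f.tupleEval_mem_branchTangent p)
  obtain ⟨ε, hεT, hε⟩ : ∃ ε ∈ T, ε ∉ Submodule.span F {w} := by
    by_contra! hcon
    have := Submodule.finrank_mono (show T ≤ Submodule.span F {w} from hcon)
    rw [finrank_span_singleton hw0, h] at this
    omega
  have hli : LinearIndependent F ![w, ε] := by
    rw [LinearIndependent.pair_iff' hw0]
    exact fun a ha => hε (Submodule.mem_span_singleton.2 ⟨a, ha⟩)
  have hspan : T = Submodule.span F (Set.range ![w, ε]) := by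
    symm
    apply Submodule.eq_of_le_of_finrank_eq
    · rw [Submodule.span_le]
      rintro _ ⟨k, rfl⟩
      fin_cases k
      · exact hwT
      · exact hεT
    · rw [finrank_span_eq_card hli, h, Fintype.card_fin]
  -- A linear form through w that is nonzero on the other tangent vector ε; it will be the local
  -- parameter.
  obtain ⟨η, hη0, hη1⟩ : ∃ η : Fin (n + 1) → F, ∑ i, η i * w i = 0 ∧ ∑ i, η i * ε i = 1 := by
    by_contra! hcon
    apply hε
    refine mem_of_forall_sum_mul_eq_zero _ fun φ hφ => ?_
    by_contra hne
    refine hcon (fun i => (∑ i, φ i * ε i)⁻¹ * φ i) ?_ ?_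
    · simp only [mul_assoc, ← Finset.mul_sum, hφ w (Submodule.mem_span_singleton_self _), mul_zero]
    · simp only [mul_assoc, ← Finset.mul_sum]
      exact inv_mul_cancel₀ hne
  refine unibranch_of_conormal f.isHomogeneous_comp p.rep_nonzero hw0 hbir
    (fun y hy => f.tupleEval_comp_ne_zero hy) (ε := ε) (fun φ hφ0 hφ1 => ?_) hη0 hη1
  -- Biduality: the vectors annihilated by the conormal space form T, which is spanned by w and ε,
  -- and φ vanishes on both.
  refine mem_of_forall_sum_mul_eq_zero _ fun v hv => ?_
  have hvT : v ∈ T := by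
    rw [hT, mem_zariskiTangent_iff]
    intro ψ hψ
    rw [← hv ψ hψ]
    exact Finset.sum_congr rfl fun i _ => mul_comm _ _
  rw [hspan] at hvT
  have hk : ∀ u ∈ Submodule.span F (Set.range ![w, ε]), ∑ i, u i * φ i = 0 := by
    intro u hu
    induction hu using Submodule.span_induction with
    | mem u hu =>
      obtain ⟨k, rfl⟩ := hu
      fin_cases k
      · simpa [mul_comm] using hφ0
      · simpa [mul_comm] using hφ1
    | zero => simp
    | add u u' _ _ h h' => simp [add_mul, Finset.sum_add_distrib, h, h']
    | smul c u _ h => simp [mul_assoc, ← Finset.mul_sum, h]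
  exact hk v hvT

end Mor
end RationalCurve

namespace RationalCurve

/-! ### The parameter space and its open subset of admissible parameters -/

section PolyForm

variable {F : Type*} [Field F] {ι κ : Type*}

/-- Families of binary forms whose coefficients are polynomials in the parameters. -/
def IsPolyForm (P : (ι → F) → MvPolynomial (Fin 2) F) : Prop :=
  ∀ δ, IsPolyFun fun v => coeff δ (P v)

namespace IsPolyForm

lemma const (Q : MvPolynomial (Fin 2) F) : IsPolyForm fun _ : ι → F => Q :=
  fun _ => IsPolyFun.const _

lemma C {φ : (ι → F) → F} (hφ : IsPolyFun φ) : IsPolyForm fun v => MvPolynomial.C (φ v) := by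
  intro δ
  simp only [coeff_C]
  split_ifs
  · exact hφ
  · exact IsPolyFun.const _

lemma add {P Q : (ι → F) → MvPolynomial (Fin 2) F} (hP : IsPolyForm P) (hQ : IsPolyForm Q) :
    IsPolyForm fun v => P v + Q v := fun δ => by
  simp only [coeff_add]
  exact (hP δ).add (hQ δ)

lemma mul {P Q : (ι → F) → MvPolynomial (Fin 2) F} (hP : IsPolyForm P) (hQ : IsPolyForm Q) :
    IsPolyForm fun v => P v * Q v := fun δ => by
  classical
  simp only [coeff_mul]
  exact IsPolyFun.sum _ fun x _ => (hP x.1).mul (hQ x.2)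

lemma sum {α : Type*} (s : Finset α) {P : α → (ι → F) → MvPolynomial (Fin 2) F}
    (hP : ∀ a ∈ s, IsPolyForm (P a)) : IsPolyForm fun v => ∑ a ∈ s, P a v := fun δ => by
  simp only [coeff_sum]
  exact IsPolyFun.sum _ fun a ha => hP a ha δ

lemma comp {P : (κ → F) → MvPolynomial (Fin 2) F} (hP : IsPolyForm P) {g : (ι → F) → κ → F}
    (hg : ∀ k, IsPolyFun fun v => g v k) : IsPolyForm fun v => P (g v) :=
  fun δ => (hP δ).comp hg

lemma eval {P : (ι → F) → MvPolynomial (Fin 2) F} (hP : IsPolyForm P) {m : ℕ}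
    (hm : ∀ v, (P v).IsHomogeneous m) {x : (ι → F) → Fin 2 → F}
    (hx : ∀ k, IsPolyFun fun v => x v k) : IsPolyFun fun v => MvPolynomial.eval (x v) (P v) := by
  simp only [fun v => eval_eq_sum_formCoeff (hm v) (x v)]
  exact IsPolyFun.sum _ fun k _ => (hP _).mul (((hx 0).pow _).mul ((hx 1).pow _))

lemma pderiv {P : (ι → F) → MvPolynomial (Fin 2) F} (hP : IsPolyForm P) {m : ℕ}
    (hm : ∀ v, (P v).IsHomogeneous m) (j : Fin 2) :
    IsPolyForm fun v => MvPolynomial.pderiv j (P v) := by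
  intro δ
  have h (v) := congrArg (fun Q => coeff δ (MvPolynomial.pderiv j Q)) (eq_sum_formCoeff (hm v))
  simp only [mul_assoc, map_sum, pderiv_C_mul, coeff_sum, coeff_C_mul] at h
  simp only [h]
  exact IsPolyFun.sum _ fun k _ => (hP _).mul (IsPolyFun.const _)

lemma binaryForm {d : ℕ} {a : (ι → F) → Fin (d + 1) → F} (ha : ∀ k, IsPolyFun fun v => a v k) :
    IsPolyForm fun v => binaryForm (a v) :=
  sum _ fun k _ => ((C (ha k)).mul (const _)).mul (const _)

end IsPolyForm

end PolyForm

/-- The coordinates on the space that parametrizes the tuples of forms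
`Aᵢ f + h (∑ⱼ Bᵢⱼ cⱼ) + h² kᵢ`. -/
inductive Param (n d r ℓ : ℕ)
  | point (i : Fin (n + 1))
  | base (k : Fin (d + 1))
  | root (k : Fin (r + 1))
  | dir (i : Fin (n + 1)) (j : Fin ℓ)
  | mult (j : Fin ℓ) (k : Fin (d - r + 1))
  | rest (i : Fin (n + 1)) (k : Fin (d + 1 - 2 * r))

section Forms

variable {F : Type*} [Field F] {n d r ℓ : ℕ} (u : Param n d r ℓ → F)

def baseForm : MvPolynomial (Fin 2) F := binaryForm fun k => u (.base k)

def rootForm : MvPolynomial (Fin 2) F := binaryForm fun k => u (.root k)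

def multForm (j : Fin ℓ) : MvPolynomial (Fin 2) F := binaryForm fun k => u (.mult j k)

/-- The monomials of degree `d - 2 r`, if `2 r ≤ d`. -/
def restMonomial (d r : ℕ) (k : Fin (d + 1 - 2 * r)) : MvPolynomial (Fin 2) F :=
  X 0 ^ (d - 2 * r - (k : ℕ)) * X 1 ^ (k : ℕ)

def restForm (i : Fin (n + 1)) : MvPolynomial (Fin 2) F :=
  ∑ k, C (u (.rest i k)) * restMonomial d r k

/-- The vector g of f = A b + h g. At a root of h only the sum ∑ B_j c_j remains, which is the
tangent direction of the branch modulo A. -/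
def slopeForm (i : Fin (n + 1)) : MvPolynomial (Fin 2) F :=
  ∑ j, C (u (.dir i j)) * multForm u j + rootForm u * restForm u i

def paramForm (i : Fin (n + 1)) : MvPolynomial (Fin 2) F :=
  C (u (.point i)) * baseForm u + rootForm u * slopeForm u i

lemma isHomogeneous_binaryForm {m : ℕ} (a : Fin (m + 1) → F) : (binaryForm a).IsHomogeneous m :=
  isHomogeneous_sum_form a

lemma isHomogeneous_rootForm_mul_restMonomial (k : Fin (d + 1 - 2 * r)) :
    (rootForm u * restMonomial d r k).IsHomogeneous (d - r) := by
  have h := (isHomogeneous_binaryForm fun k => u (.root k)).mul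
    ((isHomogeneous_X_pow (R := F) (0 : Fin 2) (d - 2 * r - (k : ℕ))).mul
      (isHomogeneous_X_pow (R := F) (1 : Fin 2) (k : ℕ)))
  have hk := k.2
  rwa [show r + (d - 2 * r - (k : ℕ) + k) = d - r by omega] at h

lemma isHomogeneous_slopeForm (i : Fin (n + 1)) : (slopeForm u i).IsHomogeneous (d - r) := by
  refine (IsHomogeneous.sum _ _ _ fun j _ => (isHomogeneous_binaryForm _).C_mul _).add ?_
  rw [restForm, Finset.mul_sum]
  refine IsHomogeneous.sum _ _ _ fun k _ => ?_
  rw [mul_left_comm]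
  exact (isHomogeneous_rootForm_mul_restMonomial u k).C_mul _

lemma isHomogeneous_paramForm (hr : r ≤ d) (i : Fin (n + 1)) :
    (paramForm u i).IsHomogeneous d := by
  refine ((isHomogeneous_binaryForm _).C_mul _).add ?_
  have h := (isHomogeneous_binaryForm fun k => u (.root k)).mul (isHomogeneous_slopeForm u i)
  rwa [Nat.add_sub_cancel' hr] at h

end Forms

section Admissible

variable {F : Type*} [Field F] {n d r ℓ : ℕ}

lemma isPolyForm_baseForm : IsPolyForm (baseForm : (Param n d r ℓ → F) → _) :=
  IsPolyForm.binaryForm fun _ => IsPolyFun.coord _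

lemma isPolyForm_rootForm : IsPolyForm (rootForm : (Param n d r ℓ → F) → _) :=
  IsPolyForm.binaryForm fun _ => IsPolyFun.coord _

lemma isPolyForm_multForm (j : Fin ℓ) :
    IsPolyForm fun u : Param n d r ℓ → F => multForm u j :=
  IsPolyForm.binaryForm fun _ => IsPolyFun.coord _

lemma isPolyForm_slopeForm (i : Fin (n + 1)) :
    IsPolyForm fun u : Param n d r ℓ → F => slopeForm u i :=
  (IsPolyForm.sum _ fun j _ => (IsPolyForm.C (IsPolyFun.coord _)).mul (isPolyForm_multForm j)).add
    (isPolyForm_rootForm.mul (IsPolyForm.sum _ fun _ _ =>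
      (IsPolyForm.C (IsPolyFun.coord _)).mul (IsPolyForm.const _)))

lemma isPolyForm_paramForm (i : Fin (n + 1)) :
    IsPolyForm fun u : Param n d r ℓ → F => paramForm u i :=
  ((IsPolyForm.C (IsPolyFun.coord _)).mul isPolyForm_baseForm).add
    (isPolyForm_rootForm.mul (isPolyForm_slopeForm i))

/-- The value at `(x, y)` of the Bezoutian of two components, or the value of a coordinate of the
trivector that is the wedge product of the point and the Bezoutian of the slopes. -/
def secantCoord (u : Param n d r ℓ → F) (x y : Fin 2 → F) :
    (Fin (n + 1) × Fin (n + 1)) ⊕ (Fin (n + 1) × Fin (n + 1) × Fin (n + 1)) → F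
  | .inl (i, j) => bez d (paramForm u i) (paramForm u j) x y
  | .inr (i, j, k) =>
      u (.point i) * bez (d - r) (slopeForm u j) (slopeForm u k) x y +
      u (.point j) * bez (d - r) (slopeForm u k) (slopeForm u i) x y +
      u (.point k) * bez (d - r) (slopeForm u i) (slopeForm u j) x y

/-- The coefficient vectors of the forms `cⱼ` and of the multiples of `h` of degree `d - r`. -/
def multCoeff (u : Param n d r ℓ → F) :
    Fin ℓ ⊕ Fin (d + 1 - 2 * r) → Fin (d - r + 1) → F
  | .inl j, k => formCoeff (d - r) k (multForm u j)
  | .inr m, k => formCoeff (d - r) k (rootForm u * restMonomial d r m)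

/-- The columns `A`, `B₁`, …, `B_ℓ`. -/
def frameVec (u : Param n d r ℓ → F) : Option (Fin ℓ) → Fin (n + 1) → F
  | none, i => u (.point i)
  | some j, i => u (.dir i j)

/-- The parameters that give a morphism in the Severi locus. -/
structure IsAdmissible (u : Param n d r ℓ → F) : Prop where
  param_ne : ∀ x : Fin 2 → F, x ≠ 0 → ∃ i, eval x (paramForm u i) ≠ 0
  slope_ne : ∀ x : Fin 2 → F, x ≠ 0 → ∃ ij : Fin (n + 1) × Fin (n + 1),
    u (.point ij.1) * eval x (slopeForm u ij.2) - u (.point ij.2) * eval x (slopeForm u ij.1) ≠ 0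
  root_ne : ∀ x : Fin 2 → F, x ≠ 0 → ∃ j : Option (Fin 2),
    j.elim (eval x (rootForm u)) (fun j => eval x (pderiv j (rootForm u))) ≠ 0
  secant_ne : ∀ x : Fin 2 → F, x ≠ 0 → ∀ y : Fin 2 → F, y ≠ 0 → ∃ a, secantCoord u x y a ≠ 0
  frame_indep : LinearIndependent F (frameVec u)
  mult_indep : LinearIndependent F (multCoeff u)

/-- The first four conditions say that functions homogeneous in one or two points of the projective
line have no common zero, so elimination applies. The last two are rank conditions. -/
theorem zOpen_isAdmissible [IsAlgClosed F] (hr : r ≤ d) :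
    ZOpen {u : Param n d r ℓ → F | IsAdmissible u} := by
  have h1 : ZOpen {u : Param n d r ℓ → F | ∀ x : Fin 2 → F, x ≠ 0 → ∃ i,
      eval x (paramForm u i) ≠ 0} :=
    ZOpen.forall_exists_ne_zero (fun _ => d) (fun i =>
      ((isPolyForm_paramForm i).comp fun _ => IsPolyFun.coord _).eval
        (fun _ => isHomogeneous_paramForm _ hr i) fun _ => IsPolyFun.coord _)
      fun i u x c => eval_smul_of_isHomogeneous (isHomogeneous_paramForm u hr i) c x
  have h2 : ZOpen {u : Param n d r ℓ → F | ∀ x : Fin 2 → F, x ≠ 0 →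
      ∃ ij : Fin (n + 1) × Fin (n + 1), u (.point ij.1) * eval x (slopeForm u ij.2) -
        u (.point ij.2) * eval x (slopeForm u ij.1) ≠ 0} := by
    refine ZOpen.forall_exists_ne_zero (fun _ => d - r) (fun ij => ?_) fun ij u x c => ?_
    · have h (i) : IsPolyFun fun w : Param n d r ℓ ⊕ Fin 2 → F =>
          eval (w ∘ Sum.inr) (slopeForm (w ∘ Sum.inl) i) :=
        ((isPolyForm_slopeForm i).comp fun _ => IsPolyFun.coord _).eval
          (fun _ => isHomogeneous_slopeForm _ i) fun _ => IsPolyFun.coord _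
      exact ((IsPolyFun.coord _).mul (h _)).sub ((IsPolyFun.coord _).mul (h _))
    · rw [eval_smul_of_isHomogeneous (isHomogeneous_slopeForm u _),
        eval_smul_of_isHomogeneous (isHomogeneous_slopeForm u _)]
      ring
  have h3 : ZOpen {u : Param n d r ℓ → F | ∀ x : Fin 2 → F, x ≠ 0 → ∃ j : Option (Fin 2),
      j.elim (eval x (rootForm u)) (fun j => eval x (pderiv j (rootForm u))) ≠ 0} := by
    refine ZOpen.forall_exists_ne_zero (fun j => j.elim r fun _ => r - 1) (fun j => ?_)
      fun j u x c => ?_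
    · rcases j with _ | j
      · exact (isPolyForm_rootForm.comp fun _ => IsPolyFun.coord _).eval
          (fun _ => isHomogeneous_binaryForm _) fun _ => IsPolyFun.coord _
      · exact ((isPolyForm_rootForm.pderiv (fun _ => isHomogeneous_binaryForm _) j).comp
          fun _ => IsPolyFun.coord _).eval
          (fun _ => (isHomogeneous_binaryForm _).pderiv) fun _ => IsPolyFun.coord _
    · rcases j with _ | j
      · exact eval_smul_of_isHomogeneous (isHomogeneous_binaryForm _) c x
      · exact eval_smul_of_isHomogeneous (isHomogeneous_binaryForm _).pderiv c x
  have h4 : ZOpen {u : Param n d r ℓ → F | ∀ x : Fin 2 → F, x ≠ 0 → ∀ y : Fin 2 → F, y ≠ 0 →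
      ∃ a, secantCoord u x y a ≠ 0} := by
    refine ZOpen.forall_forall_exists_ne_zero (φ := fun a u x y => secantCoord u x y a)
      (fun a => a.elim (fun _ => d - 1) fun _ => d - r - 1)
      (fun a => ?_) (fun a u x y c => ?_) fun a u x y c => ?_
    · rcases a with ⟨i, j⟩ | ⟨i, j, k⟩
      · exact isPolyFun_bez d
          (fun _ => ((isPolyForm_paramForm i).comp fun _ => IsPolyFun.coord _) _)
          (fun _ => ((isPolyForm_paramForm j).comp fun _ => IsPolyFun.coord _) _)
          (fun _ => IsPolyFun.coord _) fun _ => IsPolyFun.coord _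
      · have h (i j) : IsPolyFun fun w : (Param n d r ℓ ⊕ Fin 2) ⊕ Fin 2 → F =>
            bez (d - r) (slopeForm (w ∘ Sum.inl ∘ Sum.inl) i)
              (slopeForm (w ∘ Sum.inl ∘ Sum.inl) j) (w ∘ Sum.inl ∘ Sum.inr) (w ∘ Sum.inr) :=
          isPolyFun_bez (d - r)
            (fun _ => ((isPolyForm_slopeForm i).comp fun _ => IsPolyFun.coord _) _)
            (fun _ => ((isPolyForm_slopeForm j).comp fun _ => IsPolyFun.coord _) _)
            (fun _ => IsPolyFun.coord _) fun _ => IsPolyFun.coord _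
        exact (((IsPolyFun.coord _).mul (h _ _)).add ((IsPolyFun.coord _).mul (h _ _))).add
          ((IsPolyFun.coord _).mul (h _ _))
    · rcases a with ⟨i, j⟩ | ⟨i, j, k⟩
      · exact bez_smul_left _ _ _ _ _ _
      · simp only [secantCoord, bez_smul_left, Sum.elim_inr]
        ring
    · rcases a with ⟨i, j⟩ | ⟨i, j, k⟩
      · exact bez_smul_right _ _ _ _ _ _
      · simp only [secantCoord, bez_smul_right, Sum.elim_inr]
        ring
  have h5 : ZOpen {u : Param n d r ℓ → F | LinearIndependent F (frameVec u)} :=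
    ZOpen.linearIndependent fun j i => by
      rcases j with _ | j
      · exact IsPolyFun.coord _
      · exact IsPolyFun.coord _
  have h6 : ZOpen {u : Param n d r ℓ → F | LinearIndependent F (multCoeff u)} :=
    ZOpen.linearIndependent fun j i => by
      rcases j with j | m
      · exact isPolyForm_multForm j _
      · exact (isPolyForm_rootForm.mul (IsPolyForm.const _)) _
  convert ((((h1.inter h2).inter h3).inter h4).inter h5).inter h6 using 1
  ext u
  exact ⟨fun h => ⟨⟨⟨⟨⟨h.1, h.2⟩, h.3⟩, h.4⟩, h.5⟩, h.6⟩,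
    fun h => ⟨h.1.1.1.1.1, h.1.1.1.1.2, h.1.1.1.2, h.1.1.2, h.1.2, h.2⟩⟩

end Admissible
end RationalCurve

/-! ### Admissible parameters give morphisms in the Severi locus -/

namespace RationalCurve

variable {F : Type*} [Field F] {n d r ℓ : ℕ}

lemma eq_zero_of_isHomogeneous_of_lt {m : ℕ} {p : Fin r → Fin 2 → F} (hp : ∀ i, p i ≠ 0)
    (hpp : ∀ i j, i ≠ j → eval (p j) (lineForm (p i)) ≠ 0) {P : MvPolynomial (Fin 2) F}
    (hP : P.IsHomogeneous m) (hm : m < r) (h0 : ∀ i, eval (p i) P = 0) : P = 0 := by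
  induction m generalizing r P with
  | zero =>
    obtain ⟨a, rfl⟩ : ∃ a, P = C a := ⟨_, totalDegree_eq_zero_iff_eq_C.1
      (Nat.le_zero.1 hP.totalDegree_le)⟩
    have := h0 ⟨0, hm⟩
    rw [eval_C] at this
    rw [this, C_0]
  | succ m ih =>
    obtain ⟨r, rfl⟩ : ∃ s, r = s + 1 := ⟨r - 1, by omega⟩
    obtain ⟨Q, hQ, rfl⟩ := exists_eq_lineForm_mul (hp 0) hP (h0 0)
    rw [ih (p := fun i => p i.succ) (fun i => hp _)
      (fun i j hij => hpp _ _ fun h => hij (Fin.succ_injective _ h)) hQ (by omega) fun i => ?_,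
      mul_zero]
    have := h0 i.succ
    rw [map_mul] at this
    exact (mul_eq_zero.1 this).resolve_left (hpp _ _ (Fin.succ_ne_zero i).symm)

/-- If d - r < r, the form has more zeros than its degree and is zero, in agreement with the empty
sum. Otherwise the product of the linear forms divides it. -/
lemma exists_eq_sum_mul_restMonomial (hr : r ≤ d) {p : Fin r → Fin 2 → F} (hp : ∀ i, p i ≠ 0)
    (hpp : ∀ i j, i ≠ j → eval (p j) (lineForm (p i)) ≠ 0) {P : MvPolynomial (Fin 2) F}
    (hP : P.IsHomogeneous (d - r)) (h0 : ∀ i, eval (p i) P = 0) :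
    ∃ μ : Fin (d + 1 - 2 * r) → F, P =
      ∑ m, C (μ m) * ((∏ b, lineForm (p b)) * restMonomial d r m) := by
  rcases lt_or_ge (d - r) r with hlt | hge
  · refine ⟨0, ?_⟩
    rw [eq_zero_of_isHomogeneous_of_lt hp hpp hP hlt h0]
    simp
  · rw [show d - r = r + (d - 2 * r) by omega] at hP
    obtain ⟨Q, hQ, rfl⟩ := exists_eq_prod_lineForm_mul hp hpp hP h0
    refine ⟨fun m => formCoeff (d - 2 * r) m Q, ?_⟩
    have hsum : Q = ∑ m : Fin (d + 1 - 2 * r), C (formCoeff (d - 2 * r) m Q) *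
        restMonomial d r m := by
      conv_lhs => rw [eq_sum_formCoeff hQ]
      rw [show d - 2 * r + 1 = d + 1 - 2 * r by omega, ← Fin.sum_univ_eq_sum_range
        (fun k => C (formCoeff (d - 2 * r) k Q) * X 0 ^ (d - 2 * r - k) * X 1 ^ k)]
      exact Finset.sum_congr rfl fun m _ => by rw [restMonomial, mul_assoc]
    conv_lhs => rw [hsum]
    rw [Finset.mul_sum]
    exact Finset.sum_congr rfl fun m _ => mul_left_comm _ _ _

section Identities

variable (u : Param n d r ℓ → F)

lemma eval_paramForm (x : Fin 2 → F) (i : Fin (n + 1)) : eval x (paramForm u i) =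
    u (.point i) * eval x (baseForm u) + eval x (rootForm u) * eval x (slopeForm u i) := by
  simp [paramForm]

lemma eval_slopeForm {x : Fin 2 → F} (hx : eval x (rootForm u) = 0) (i : Fin (n + 1)) :
    eval x (slopeForm u i) = ∑ j, u (.dir i j) * eval x (multForm u j) := by
  simp [slopeForm, hx]

/-- Wedging with A removes the summand A b of f and leaves h(x) h(y) times the slope term; the
factor x₀ y₁ - x₁ y₀ cancels, so this is valid on the diagonal too. The second family of coordinates
is needed because two distinct roots of h have the same image, where the Bezoutians of f vanish and
the slopes must be independent modulo A instead. -/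
lemma secantCoord_inr [Infinite F] (hr : r ≤ d) {x : Fin 2 → F} (hx : x ≠ 0) (y : Fin 2 → F)
    (i j k : Fin (n + 1)) :
    u (.point i) * secantCoord u x y (.inl (j, k)) +
      u (.point j) * secantCoord u x y (.inl (k, i)) +
      u (.point k) * secantCoord u x y (.inl (i, j)) =
    eval x (rootForm u) * eval y (rootForm u) * secantCoord u x y (.inr (i, j, k)) := by
  have hD (i j) := isPolyFun_bez_right d (paramForm u i) (paramForm u j) x
  have hE (i j) := isPolyFun_bez_right (d - r) (slopeForm u i) (slopeForm u j) x
  refine congrFun (IsPolyFun.eq_of_eval_lineForm_mul_eq (hx := hx)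
    (φ := fun y => u (.point i) * secantCoord u x y (.inl (j, k)) +
      u (.point j) * secantCoord u x y (.inl (k, i)) +
      u (.point k) * secantCoord u x y (.inl (i, j)))
    (ψ := fun y => eval x (rootForm u) * eval y (rootForm u) * secantCoord u x y (.inr (i, j, k)))
    (((((IsPolyFun.const _).mul (hD _ _)).add ((IsPolyFun.const _).mul (hD _ _))).add
      ((IsPolyFun.const _).mul (hD _ _))))
    (((IsPolyFun.const _).mul (IsPolyFun.of_eval _)).mul
      ((((IsPolyFun.const _).mul (hE _ _)).add ((IsPolyFun.const _).mul (hE _ _))).add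
      ((IsPolyFun.const _).mul (hE _ _)))) fun y => ?_) y
  have hd (i j) := mul_bez (isHomogeneous_paramForm u hr i) (isHomogeneous_paramForm u hr j) x y
  have he (i j) := mul_bez (isHomogeneous_slopeForm u i) (isHomogeneous_slopeForm u j) x y
  simp only [eval_paramForm] at hd
  simp only [secantCoord]
  linear_combination u (.point i) * hd j k + u (.point j) * hd k i + u (.point k) * hd i j -
    eval x (rootForm u) * eval y (rootForm u) * (u (.point i) * he j k + u (.point j) * he k i +
      u (.point k) * he i j)

end Identities

namespace IsAdmissible

variable {u : Param n d r ℓ → F}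

lemma exists_bez_ne_zero (hu : IsAdmissible u) [Infinite F] (hr : r ≤ d)
    {x y : Fin 2 → F} (hx : x ≠ 0) (hy : y ≠ 0)
    (hx0 : eval x (rootForm u) ≠ 0) (hy0 : eval y (rootForm u) ≠ 0) :
    ∃ i j, bez d (paramForm u i) (paramForm u j) x y ≠ 0 := by
  by_contra! h
  obtain ⟨a, ha⟩ := hu.secant_ne x hx y hy
  rcases a with ⟨i, j⟩ | ⟨i, j, k⟩
  · exact ha (h i j)
  · have h1 := secantCoord_inr u hr hx y i j k
    simp only [secantCoord.eq_1, h] at h1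
    apply mul_ne_zero (mul_ne_zero hx0 hy0) ha
    rw [← h1]
    ring

lemma baseForm_ne (hu : IsAdmissible u)
    {x : Fin 2 → F} (hx : x ≠ 0) (hx0 : eval x (rootForm u) = 0) :
    eval x (baseForm u) ≠ 0 := by
  intro h
  obtain ⟨i, hi⟩ := hu.param_ne x hx
  rw [eval_paramForm, h, hx0] at hi
  simp at hi

lemma not_exists_smul_point (hu : IsAdmissible u)
    {x : Fin 2 → F} (hx : x ≠ 0) (hx0 : eval x (rootForm u) ≠ 0) :
    ¬ ∃ c : F, tupleEval (paramForm u) x = c • fun i => u (.point i) := by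
  rintro ⟨c, hc⟩
  obtain ⟨⟨i, j⟩, hij⟩ := hu.slope_ne x hx
  have h (i) := congrFun hc i
  simp only [tupleEval, eval_paramForm, Pi.smul_apply, smul_eq_mul] at h
  apply mul_ne_zero hx0 hij
  linear_combination u (.point i) * h j - u (.point j) * h i

/-- A root y of h maps to A, and `slope_ne` keeps f(x) away from A. For any other y a nonzero
Bezoutian of f separates the images unless the points coincide. -/
lemma isSoleInFibre (hu : IsAdmissible u) [Infinite F] (hr : r ≤ d) {x : Fin 2 → F} (hx : x ≠ 0)
    (hx0 : eval x (rootForm u) ≠ 0) : IsSoleInFibre (paramForm u) x := by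
  rintro y hy ⟨c, hc⟩
  have h (i) := congrFun hc i
  simp only [tupleEval, Pi.smul_apply, smul_eq_mul] at h
  by_cases hy0 : eval y (rootForm u) = 0
  · exfalso
    have hb := hu.baseForm_ne hy hy0
    have hc0 : c ≠ 0 := by
      rintro rfl
      obtain ⟨i, hi⟩ := hu.param_ne y hy
      exact hi (by rw [h, zero_mul])
    refine hu.not_exists_smul_point hx hx0 ⟨c⁻¹ * eval y (baseForm u), ?_⟩
    funext i
    have h1 := h i
    rw [eval_paramForm, hy0, zero_mul, add_zero] at h1
    simp only [tupleEval, Pi.smul_apply, smul_eq_mul]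
    field_simp
    linear_combination -h1
  · obtain ⟨i, j, hij⟩ := hu.exists_bez_ne_zero hr hx hy hx0 hy0
    have h1 := mul_bez (isHomogeneous_paramForm u hr i) (isHomogeneous_paramForm u hr j) x y
    rw [h i, h j] at h1
    rw [eval_lineForm]
    refine (mul_eq_zero.1 (h1.trans ?_)).resolve_right hij
    ring

lemma isImmersedAt (hu : IsAdmissible u) [Infinite F] (hr : r ≤ d) {x : Fin 2 → F} (hx : x ≠ 0)
    (hx0 : eval x (rootForm u) ≠ 0) : IsImmersedAt (paramForm u) x := by
  obtain ⟨i, j, hij⟩ := hu.exists_bez_ne_zero hr hx hx hx0 hx0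
  obtain ⟨k, hk⟩ := exists_pderiv_lineForm_ne_zero hx
  refine ⟨k, fun ⟨c, hc⟩ => mul_ne_zero (hk x) hij ?_⟩
  rw [bez_self (isHomogeneous_paramForm u hr i) (isHomogeneous_paramForm u hr j)]
  have h (i) := congrFun hc i
  simp only [tupleEval, Pi.smul_apply, smul_eq_mul] at h
  rw [h i, h j]
  ring

lemma exists_pderiv_rootForm_ne (hu : IsAdmissible u)
    {x : Fin 2 → F} (hx : x ≠ 0) (hx0 : eval x (rootForm u) = 0) :
    ∃ j, eval x (pderiv j (rootForm u)) ≠ 0 := by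
  obtain ⟨j, hj⟩ := hu.root_ne x hx
  rcases j with _ | j
  · exact absurd hx0 hj
  · exact ⟨j, hj⟩

/-- At two distinct roots of h the Bezoutians of f vanish, so the nonzero secant coordinate is one
of A ∧ g(x) ∧ g(y), up to a nonzero factor. -/
lemma slope_notMem_span (hu : IsAdmissible u) [Infinite F] (hr : r ≤ d)
    {x y : Fin 2 → F} (hx : x ≠ 0) (hy : y ≠ 0)
    (hx0 : eval x (rootForm u) = 0) (hy0 : eval y (rootForm u) = 0)
    (hxy : eval y (lineForm x) ≠ 0) :
    tupleEval (slopeForm u) y ∉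
      Submodule.span F {fun i => u (.point i), tupleEval (slopeForm u) x} := by
  rw [Submodule.mem_span_pair]
  rintro ⟨a, b, hab⟩
  have h (i) := congrFun hab i
  simp only [tupleEval, Pi.add_apply, Pi.smul_apply, smul_eq_mul] at h
  rw [eval_lineForm] at hxy
  obtain ⟨s, hs⟩ := hu.secant_ne x hx y hy
  apply mul_ne_zero hxy hs
  rcases s with ⟨i, j⟩ | ⟨i, j, k⟩
  · simp only [secantCoord]
    rw [mul_bez (isHomogeneous_paramForm u hr i) (isHomogeneous_paramForm u hr j)]
    simp only [eval_paramForm, hx0, hy0]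
    ring
  · have he (i j) := mul_bez (isHomogeneous_slopeForm u i) (isHomogeneous_slopeForm u j) x y
    simp only [← h] at he
    simp only [secantCoord]
    linear_combination u (.point i) * he j k + u (.point j) * he k i + u (.point k) * he i j

/-- The roots of `h` are simple. -/
lemma exists_roots (hu : IsAdmissible u) [IsAlgClosed F] :
    ∃ (c : F) (p : Fin r → Fin 2 → F), c ≠ 0 ∧ (∀ b, p b ≠ 0) ∧
    (∀ b b', b ≠ b' → eval (p b') (lineForm (p b)) ≠ 0) ∧
    rootForm u = C c * ∏ b, lineForm (p b) := by
  obtain ⟨c, p, hp, h⟩ := exists_eq_prod_lineForm (isHomogeneous_binaryForm fun k => u (.root k))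
  change rootForm u = _ at h
  refine ⟨c, p, ?_, hp, fun b b' hb h0 => ?_, h⟩
  · rintro rfl
    obtain ⟨j, hj⟩ := hu.root_ne ![1, 0] (fun h => one_ne_zero (congrFun h 0))
    rcases j with _ | j <;> simp [h] at hj
  · have hroot : eval (p b') (rootForm u) = 0 := by
      rw [h, map_mul, map_prod, Finset.prod_eq_zero (Finset.mem_univ b') (eval_lineForm_self _),
        mul_zero]
    obtain ⟨j, hj⟩ := hu.exists_pderiv_rootForm_ne (hp b') hroot
    apply hj
    rw [h, ← Finset.mul_prod_erase _ _ (Finset.mem_univ b),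
      ← Finset.mul_prod_erase _ _ (Finset.mem_erase.2 ⟨hb.symm, Finset.mem_univ b'⟩)]
    simp only [pderiv_mul, map_add, map_mul, h0, eval_lineForm_self]
    ring

/-- A linear relation between the coordinates of these vectors would give a combination of the c_j
that vanishes at all roots of h. It would be a multiple of h, against `mult_indep`. -/
lemma span_mult_eq_top (hu : IsAdmissible u) [IsAlgClosed F] (hr : r ≤ d)
    {c : F} {p : Fin r → Fin 2 → F} (hc : c ≠ 0)
    (hp : ∀ b, p b ≠ 0) (hpp : ∀ b b', b ≠ b' → eval (p b') (lineForm (p b)) ≠ 0)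
    (h : rootForm u = C c * ∏ b, lineForm (p b)) :
    Submodule.span F (Set.range fun b => tupleEval (multForm u) (p b)) = ⊤ := by
  rw [eq_top_iff]
  intro v _
  refine mem_of_forall_sum_mul_eq_zero _ fun φ hφ => ?_
  suffices h0 : ∀ j, φ j = 0 by simp [h0]
  have hhom : (∑ j, C (φ j) * multForm u j).IsHomogeneous (d - r) :=
    IsHomogeneous.sum _ _ _ fun j _ => (isHomogeneous_binaryForm _).C_mul _
  have hvan (b) : eval (p b) (∑ j, C (φ j) * multForm u j) = 0 := by
    rw [map_sum, ← hφ _ (Submodule.subset_span ⟨b, rfl⟩)]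
    simp [tupleEval]
  obtain ⟨μ, hμ⟩ := exists_eq_sum_mul_restMonomial hr hp hpp hhom hvan
  have hμ' : ∑ j, C (φ j) * multForm u j =
      ∑ m, C (c⁻¹ * μ m) * (rootForm u * restMonomial d r m) := by
    have : (C c⁻¹ : MvPolynomial (Fin 2) F) * C c = 1 := by
      rw [← C_mul, inv_mul_cancel₀ hc, C_1]
    rw [hμ]
    refine Finset.sum_congr rfl fun m _ => ?_
    rw [h, C_mul]
    linear_combination (-(C (μ m)) * (∏ b, lineForm (p b)) * restMonomial d r m) * this
  have hli := Fintype.linearIndependent_iff.1 hu.mult_indep (Sum.elim φ fun m => -(c⁻¹ * μ m)) (by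
    funext k
    have := congrArg (formCoeff (d - r) k) hμ'
    simp only [formCoeff, coeff_sum, coeff_C_mul] at this
    simp only [Fintype.sum_sum_type, Sum.elim_inl, Sum.elim_inr, Finset.sum_apply,
      Pi.smul_apply, smul_eq_mul, multCoeff, formCoeff, this, Pi.zero_apply, neg_mul,
      Finset.sum_neg_distrib, add_neg_cancel])
  exact fun j => hli (.inl j)

end IsAdmissible
end RationalCurve

namespace RationalCurve

variable {F : Type*} [Field F] {n d r ℓ : ℕ}

/-- The tangent line to a branch through the point `A` of a morphism of the form `A b + h g`. -/
lemma Mor.branchTangent_eq_span (f : Mor F n d) {A : Fin (n + 1) → F}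
    {b h : MvPolynomial (Fin 2) F} {g : Fin (n + 1) → MvPolynomial (Fin 2) F}
    (hf : ∀ i, f.comp i = C (A i) * b + h * g i) {p : Proj F (Fin 2)} (hp : eval p.rep h = 0)
    (hb : eval p.rep b ≠ 0) (hh : ∃ j, eval p.rep (pderiv j h) ≠ 0) :
    f.branchTangent p = Submodule.span F {A, tupleEval g p.rep} := by
  have h0 : tupleEval f.comp p.rep = eval p.rep b • A := by
    funext i
    simp [tupleEval, hf, hp, mul_comm]
  have h1 (j) : tupleEval (fun i => pderiv j (f.comp i)) p.rep =
      eval p.rep (pderiv j b) • A + eval p.rep (pderiv j h) • tupleEval g p.rep := by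
    funext i
    simp [tupleEval, hf, hp, mul_comm]
  have hA : A ∈ f.branchTangent p := by
    have := f.tupleEval_mem_branchTangent p
    rw [h0] at this
    exact (Submodule.smul_mem_iff _ hb).1 this
  apply le_antisymm
  · refine f.branchTangent_le ?_ fun j => ?_
    · rw [h0]
      exact Submodule.smul_mem _ _ (Submodule.subset_span (by simp))
    · rw [h1]
      exact Submodule.add_mem _ (Submodule.smul_mem _ _ (Submodule.subset_span (by simp)))
        (Submodule.smul_mem _ _ (Submodule.subset_span (by simp)))
  · rw [Submodule.span_le]
    rintro v (rfl | rfl)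
    · exact hA
    · obtain ⟨j, hj⟩ := hh
      have := f.tupleEval_pderiv_mem_branchTangent p j
      rw [h1, Submodule.add_mem_iff_right _ (Submodule.smul_mem _ _ hA)] at this
      exact (Submodule.smul_mem_iff _ hj).1 this

namespace IsAdmissible

variable {u : Param n d r ℓ → F} {f : Mor F n d} {t : F}

lemma point_ne (hu : IsAdmissible u) : (fun i => u (.point i)) ≠ 0 := hu.frame_indep.ne_zero none

lemma tupleEval_comp (hf : ∀ i, f.comp i = C t * paramForm u i) (x : Fin 2 → F) :
    tupleEval f.comp x = t • tupleEval (paramForm u) x := by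
  funext i
  simp [tupleEval, hf]

lemma isSoleInFibre_comp [Infinite F] (hu : IsAdmissible u) (hr : r ≤ d) (ht : t ≠ 0)
    (hf : ∀ i, f.comp i = C t * paramForm u i) {x : Fin 2 → F} (hx : x ≠ 0)
    (hx0 : eval x (rootForm u) ≠ 0) : IsSoleInFibre f.comp x := by
  rintro y hy ⟨c, hc⟩
  refine hu.isSoleInFibre hr hx hx0 y hy ⟨c, ?_⟩
  rw [tupleEval_comp hf, tupleEval_comp hf, smul_comm] at hc
  exact smul_right_injective _ ht hc

lemma isImmersedAt_comp [Infinite F] (hu : IsAdmissible u) (hr : r ≤ d) (ht : t ≠ 0)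
    (hf : ∀ i, f.comp i = C t * paramForm u i) {x : Fin 2 → F} (hx : x ≠ 0)
    (hx0 : eval x (rootForm u) ≠ 0) : IsImmersedAt f.comp x := by
  obtain ⟨j, hj⟩ := hu.isImmersedAt hr hx hx0
  refine ⟨j, fun ⟨c, hc⟩ => hj ⟨c, smul_right_injective _ ht ?_⟩⟩
  rw [tupleEval_comp hf, smul_comm] at hc
  refine Eq.trans ?_ hc
  funext i
  simp [tupleEval, hf]

lemma toFun_eq_point_iff (hu : IsAdmissible u) (ht : t ≠ 0)
    (hf : ∀ i, f.comp i = C t * paramForm u i) (p : Proj F (Fin 2)) :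
    f.toFun p = Projectivization.mk F _ hu.point_ne ↔ eval p.rep (rootForm u) = 0 := by
  rw [f.toFun_eq_mk_iff, tupleEval_comp hf]
  constructor
  · rintro ⟨c, hc⟩
    by_contra h
    refine hu.not_exists_smul_point p.rep_nonzero h ⟨t⁻¹ * c, ?_⟩
    rw [mul_smul, ← hc, inv_smul_smul₀ ht]
  · intro h
    refine ⟨t * eval p.rep (baseForm u), ?_⟩
    funext i
    simp [tupleEval, eval_paramForm, h]
    ring

lemma branchTangent_eq (hu : IsAdmissible u) (ht : t ≠ 0)
    (hf : ∀ i, f.comp i = C t * paramForm u i) {p : Proj F (Fin 2)}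
    (hp : eval p.rep (rootForm u) = 0) : f.branchTangent p =
      Submodule.span F {fun i => u (.point i), tupleEval (slopeForm u) p.rep} := by
  obtain ⟨j, hj⟩ := hu.exists_pderiv_rootForm_ne p.rep_nonzero hp
  refine f.branchTangent_eq_span (A := fun i => u (.point i)) (b := C t * baseForm u)
    (h := C t * rootForm u) (g := slopeForm u) (fun i => ?_) ?_ ?_ ⟨j, ?_⟩
  · rw [hf, paramForm]
    ring
  · simp [hp]
  · simpa [ht] using hu.baseForm_ne p.rep_nonzero hp
  · simpa [ht] using hj

lemma finrank_branchTangent (hu : IsAdmissible u) (ht : t ≠ 0)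
    (hf : ∀ i, f.comp i = C t * paramForm u i) {p : Proj F (Fin 2)}
    (hp : eval p.rep (rootForm u) = 0) : Module.finrank F (f.branchTangent p) = 2 := by
  have hli : LinearIndependent F ![fun i => u (.point i), tupleEval (slopeForm u) p.rep] := by
    rw [LinearIndependent.pair_iff' hu.point_ne]
    intro a ha
    obtain ⟨⟨i, j⟩, hij⟩ := hu.slope_ne p.rep p.rep_nonzero
    have h (i) := congrFun ha i
    simp only [tupleEval, Pi.smul_apply, smul_eq_mul] at h
    apply hij
    rw [← h i, ← h j]
    ring
  have := finrank_span_eq_card hli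
  rw [branchTangent_eq hu ht hf hp]
  refine Eq.trans ?_ (this.trans (Fintype.card_fin 2))
  rw [Matrix.range_cons, Matrix.range_cons, Matrix.range_empty, Set.union_empty]
  rfl

lemma exists_equiv_roots [IsAlgClosed F] (hu : IsAdmissible u) :
    ∃ (c : F) (P : Fin r → Proj F (Fin 2)), c ≠ 0 ∧ Function.Injective P ∧
      (∀ b b', b ≠ b' → eval (P b').rep (lineForm (P b).rep) ≠ 0) ∧
      rootForm u = C c * ∏ b, lineForm (P b).rep ∧
      ∀ p, eval p.rep (rootForm u) = 0 ↔ p ∈ Set.range P := by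
  obtain ⟨c, p, hc, hp, hpp, h⟩ := hu.exists_roots
  choose a ha hap using fun b => exists_rep_mk (hp b)
  set P : Fin r → Proj F (Fin 2) := fun b => Projectivization.mk F (p b) (hp b) with hP
  have hline (b) : lineForm (P b).rep = C (a b) * lineForm (p b) := by
    rw [hP, hap b]
    simp [lineForm]
    ring
  have hpp' (b b') (hb : b ≠ b') : eval (P b').rep (lineForm (P b).rep) ≠ 0 := by
    rw [hline, hap b', map_mul, eval_C, eval_smul_of_isHomogeneous (isHomogeneous_lineForm _)]
    exact mul_ne_zero (ha b) (mul_ne_zero (pow_ne_zero _ (ha b')) (hpp b b' hb))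
  have heq : rootForm u = C (c * ∏ b, (a b)⁻¹) * ∏ b, lineForm (P b).rep := by
    simp only [hline, Finset.prod_mul_distrib]
    rw [h, C_mul, map_prod]
    have : (∏ b, (C (a b)⁻¹ : MvPolynomial (Fin 2) F)) * ∏ b, C (a b) = 1 := by
      rw [← Finset.prod_mul_distrib]
      exact Finset.prod_eq_one fun b _ => by rw [← C_mul, inv_mul_cancel₀ (ha b), C_1]
    linear_combination (-(C c) * ∏ b, lineForm (p b)) * this
  have hc' : c * ∏ b, (a b)⁻¹ ≠ 0 :=
    mul_ne_zero hc (Finset.prod_ne_zero_iff.2 fun b _ => inv_ne_zero (ha b))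
  refine ⟨_, P, hc', fun b b' hb => ?_, hpp', heq, fun q => ?_⟩
  · by_contra hne
    exact hpp' b b' hne (by rw [hb]; exact eval_lineForm_self _)
  · rw [heq, map_mul, eval_C, mul_eq_zero, or_iff_right hc', map_prod, Finset.prod_eq_zero_iff]
    constructor
    · rintro ⟨b, _, hb⟩
      exact ⟨b, (eq_of_eval_lineForm_eq_zero hb).symm⟩
    · rintro ⟨b, rfl⟩
      exact ⟨b, Finset.mem_univ _, eval_lineForm_self _⟩

/-- The points over A are the roots of h. Away from them there is a single smooth branch through
each image point, so the image is nonsingular there, and one such point already gives birationality.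
-/
theorem mem_severi [IsAlgClosed F] (hu : IsAdmissible u) (hrd : r < d) (hr : 2 ≤ r) (ht : t ≠ 0)
    (hf : ∀ i, f.comp i = C t * paramForm u i) : f ∈ severi F n d r ℓ := by
  have : Infinite F := IsAlgClosed.instInfinite
  obtain ⟨c, P, hc, hPinj, hPP, hfac, hroots⟩ := hu.exists_equiv_roots
  have hfib : f.toFun ⁻¹' {Projectivization.mk F _ hu.point_ne} = Set.range P := by
    ext p
    rw [← hroots, Set.mem_preimage, Set.mem_singleton_iff, hu.toFun_eq_point_iff ht hf]
  have hP (b) : eval (P b).rep (rootForm u) = 0 := (hroots _).2 ⟨b, rfl⟩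
  have hinj : Set.InjOn f.branchTangent (Set.range P) := by
    rintro _ ⟨b, rfl⟩ _ ⟨b', rfl⟩ h
    by_contra hne
    have hbb : b ≠ b' := fun h => hne (by rw [h])
    rw [branchTangent_eq hu ht hf (hP b), branchTangent_eq hu ht hf (hP b')] at h
    refine hu.slope_notMem_span hrd.le (P b).rep_nonzero (P b').rep_nonzero (hP b) (hP b')
      (hPP b b' hbb) ?_
    rw [h]
    exact Submodule.subset_span (by simp)
  -- The values of (c_j) at the roots span F ^ ℓ, so the slopes at the roots span the same space as
  -- B_1, …, B_ℓ.
  have hspan : (⨆ p ∈ Set.range P, f.branchTangent p) =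
      Submodule.span F (Set.range (frameVec u)) := by
    have hpt : (fun i => u (.point i)) ∈ ⨆ p ∈ Set.range P, f.branchTangent p := by
      refine (le_iSup₂_of_le (f := fun p (_ : p ∈ Set.range P) => f.branchTangent p)
        (P ⟨0, by omega⟩) ⟨_, rfl⟩ le_rfl) ?_
      rw [branchTangent_eq hu ht hf (hP _)]
      exact Submodule.subset_span (by simp)
    set T : (Fin ℓ → F) →ₗ[F] (Fin (n + 1) → F) :=
      Matrix.mulVecLin (Matrix.of fun i j => u (.dir i j)) with hT
    have hslope (b) : tupleEval (slopeForm u) (P b).rep = T (tupleEval (multForm u) (P b).rep) := by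
      funext i
      simp [tupleEval, eval_slopeForm u (hP b), hT, Matrix.mulVec, dotProduct]
    have hTs (j : Fin ℓ) : T (Pi.single j 1) = frameVec u (some j) := by
      funext i
      simp [hT, frameVec]
    apply le_antisymm
    · refine iSup₂_le ?_
      rintro _ ⟨b, rfl⟩
      rw [branchTangent_eq hu ht hf (hP b), Submodule.span_le]
      rintro v (rfl | rfl)
      · exact Submodule.subset_span ⟨none, rfl⟩
      · have : tupleEval (slopeForm u) (P b).rep =
            ∑ j, eval (P b).rep (multForm u j) • frameVec u (some j) := by
          funext i
          simp [tupleEval, eval_slopeForm u (hP b), frameVec, mul_comm]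
        rw [this]
        exact Submodule.sum_mem _ fun j _ => Submodule.smul_mem _ _ (Submodule.subset_span ⟨_, rfl⟩)
    · rw [Submodule.span_le]
      rintro _ ⟨j, rfl⟩
      rcases j with _ | j
      · exact hpt
      · rw [← hTs]
        have h1 : Submodule.map T ⊤ ≤ ⨆ p ∈ Set.range P, f.branchTangent p := by
          rw [← hu.span_mult_eq_top hrd.le hc (fun b => (P b).rep_nonzero) hPP hfac,
            Submodule.map_span, Submodule.span_le]
          rintro _ ⟨_, ⟨b, rfl⟩, rfl⟩
          change T (tupleEval (multForm u) (P b).rep) ∈ _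
          rw [← hslope]
          refine (le_iSup₂_of_le (f := fun p (_ : p ∈ Set.range P) => f.branchTangent p)
            (P b) ⟨_, rfl⟩ le_rfl) ?_
          rw [branchTangent_eq hu ht hf (hP _)]
          exact Submodule.subset_span (by simp)
        exact h1 ⟨_, trivial, rfl⟩
  refine ⟨?_, Projectivization.mk F _ hu.point_ne, ?_, ?_, ?_, ?_, ?_⟩
  · have hsub : (Set.range P).Finite := Set.finite_range P
    have : Infinite (Proj F (Fin 2)) := by
      refine Infinite.of_injective (fun s : F => (Projectivization.mk F ![1, s]
        (fun h => one_ne_zero (congrFun h 0)) : Proj F (Fin 2))) fun s s' h => ?_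
      rw [Projectivization.mk_eq_mk_iff'] at h
      obtain ⟨a, ha⟩ := h
      have h0 := congrFun ha 0
      have h1 := congrFun ha 1
      simp at h0 h1
      rw [← h1, h0, one_mul]
    obtain ⟨p, hp⟩ := hsub.exists_notMem
    have hp0 : eval p.rep (rootForm u) ≠ 0 := fun h => hp ((hroots p).1 h)
    exact f.isBirational_of_unibranch (by omega)
      (hu.isSoleInFibre_comp hrd.le ht hf p.rep_nonzero hp0)
      (hu.isImmersedAt_comp hrd.le ht hf p.rep_nonzero hp0)
  · apply Set.eq_singleton_iff_unique_mem.2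
    constructor
    · have himg (b) : f.toFun (P b) = Projectivization.mk F _ hu.point_ne :=
        (hu.toFun_eq_point_iff ht hf _).2 (hP b)
      refine ⟨⟨P ⟨0, by omega⟩, himg _⟩, fun h => ?_⟩
      -- If A were nonsingular, all branch tangents would coincide with the Zariski tangent space,
      -- but there are at least two and they are distinct.
      have hb (b) : f.branchTangent (P b) =
          zariskiTangent f.image (Projectivization.mk F _ hu.point_ne) := by
        apply Submodule.eq_of_le_of_finrank_eq
        · rw [← himg b]
          exact f.branchTangent_le_zariskiTangent _
        · rw [h, finrank_branchTangent hu ht hf (hP b)]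
      have := hPinj (hinj ⟨_, rfl⟩ ⟨_, rfl⟩
        ((hb ⟨0, by omega⟩).trans (hb ⟨1, by omega⟩).symm))
      simp at this
    · rintro _ ⟨⟨p, rfl⟩, h⟩
      by_contra hne
      rw [hu.toFun_eq_point_iff ht hf] at hne
      exact h (f.finrank_zariskiTangent_of_unibranch (by omega)
        (hu.isSoleInFibre_comp hrd.le ht hf p.rep_nonzero hne)
        (hu.isImmersedAt_comp hrd.le ht hf p.rep_nonzero hne))
  · rw [hfib, ← Set.image_univ, hPinj.encard_image]
    simp
  · rw [hfib]
    rintro _ ⟨b, rfl⟩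
    exact finrank_branchTangent hu ht hf (hP b)
  · rw [hfib]
    exact hinj
  · rw [hfib, hspan, finrank_span_eq_card hu.frame_indep]
    simp

end IsAdmissible
end RationalCurve

/-! ### Morphisms in the Severi locus come from admissible parameters -/

namespace RationalCurve

variable {F : Type*} [Field F] {n d r ℓ : ℕ}

lemma exists_smul_of_forall_mul_eq {κ : Type*} {v w : κ → F} (hv : v ≠ 0)
    (h : ∀ i j, v i * w j = v j * w i) : ∃ c : F, w = c • v := by
  obtain ⟨i, hi⟩ := exists_coord_ne_zero hv
  refine ⟨(v i)⁻¹ * w i, funext fun j => ?_⟩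
  simp only [Pi.smul_apply, smul_eq_mul]
  field_simp
  linear_combination h i j

lemma exists_smul_rep {ι : Type*} {x : ι → F} (hx : x ≠ 0) :
    ∃ c : F, c ≠ 0 ∧ x = c • (Projectivization.mk F x hx).rep := by
  obtain ⟨a, ha, h⟩ := exists_rep_mk hx
  exact ⟨a⁻¹, inv_ne_zero ha, by rw [h, inv_smul_smul₀ ha]⟩

lemma binaryForm_formCoeff {m : ℕ} {P : MvPolynomial (Fin 2) F} (hP : P.IsHomogeneous m) :
    binaryForm (fun k : Fin (m + 1) => formCoeff m k P) = P := by
  conv_rhs => rw [eq_sum_formCoeff hP]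
  rw [← Fin.sum_univ_eq_sum_range (fun k => C (formCoeff m k P) * X 0 ^ (m - k) * X 1 ^ k)]
  rfl

lemma formCoeff_restMonomial (k m : Fin (d + 1 - 2 * r)) :
    formCoeff (d - 2 * r) k (restMonomial d r m : MvPolynomial (Fin 2) F) =
      if m = k then 1 else 0 := by
  rw [restMonomial, X_pow_eq_monomial, X_pow_eq_monomial, monomial_mul, mul_one, formCoeff,
    coeff_monomial]
  congr 1
  rw [eq_iff_iff]
  constructor
  · intro h
    have := DFunLike.congr_fun h 1
    simp at this
    exact Fin.ext this
  · rintro rfl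
    rfl

/-- A morphism in the Severi locus, written as `A b + h g` where `h` vanishes at the points over
the multiple point `A`. -/
structure IsSeveriForm (f : Mor F n d) (ℓ : ℕ) (A : Fin (n + 1) → F) (i₀ : Fin (n + 1))
    (P : Fin r → Proj F (Fin 2)) (g : Fin (n + 1) → MvPolynomial (Fin 2) F) : Prop where
  point_eq : A i₀ = 1
  injective : Function.Injective P
  mem_range_iff : ∀ p, p ∈ Set.range P ↔ ∃ c : F, tupleEval f.comp p.rep = c • A
  homogeneous : ∀ i, (g i).IsHomogeneous (d - r)
  comp_eq : ∀ i, f.comp i = C (A i) * f.comp i₀ + (∏ b, lineForm (P b).rep) * g i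
  slope_eq : g i₀ = 0
  finrank_tangent : ∀ b, Module.finrank F (f.branchTangent (P b)) = 2
  tangent_injective : Function.Injective fun b => f.branchTangent (P b)
  finrank_iSup : Module.finrank F (⨆ b, f.branchTangent (P b) : Submodule F (Fin (n + 1) → F)) =
    ℓ + 1
  unibranch : ∀ p ∉ Set.range P, IsSoleInFibre f.comp p.rep ∧ IsImmersedAt f.comp p.rep

/-- With A normalized at i₀, the forms f_i - A_i f_{i₀} vanish at the r points over the multiple
point, and g is their quotient by h. The case r = 0 is excluded because the singular point lies on
the image, and r = 1 because a point with one smooth branch is nonsingular. -/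
theorem exists_isSeveriForm [IsAlgClosed F] (hrd : r < d) {f : Mor F n d}
    (hf : f ∈ severi F n d r ℓ) :
    2 ≤ r ∧ ∃ A i₀, ∃ P : Fin r → Proj F (Fin 2), ∃ g, IsSeveriForm f ℓ A i₀ P g := by
  obtain ⟨hbir, q, hsing, henc, hrk, hinj, hrank⟩ := hf
  obtain ⟨P, hPinj, hP⟩ : ∃ P : Fin r → Proj F (Fin 2), Function.Injective P ∧
      Set.range P = f.toFun ⁻¹' {q} := by
    have hfin : (f.toFun ⁻¹' {q}).Finite := Set.finite_of_encard_eq_coe henc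
    have hcard : hfin.toFinset.card = r := by
      rw [hfin.encard_eq_coe_toFinset_card] at henc
      exact_mod_cast henc
    refine ⟨fun b => (hfin.toFinset.equivFinOfCardEq hcard).symm b,
      Subtype.val_injective.comp (Equiv.injective _), ?_⟩
    ext p
    constructor
    · rintro ⟨b, rfl⟩
      exact hfin.mem_toFinset.1 ((hfin.toFinset.equivFinOfCardEq hcard).symm b).2
    · intro hp
      exact ⟨hfin.toFinset.equivFinOfCardEq hcard ⟨p, hfin.mem_toFinset.2 hp⟩, by simp⟩
  have hq : q ∈ singularLocus f.image := by rw [hsing]; rfl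
  have hPq (b) : f.toFun (P b) = q := by
    have : P b ∈ f.toFun ⁻¹' {q} := hP ▸ ⟨b, rfl⟩
    exact this
  rw [← hP] at hrk hinj hrank
  have hr : 2 ≤ r := by
    obtain ⟨⟨p, hp⟩, hne⟩ := hq
    obtain ⟨b, hb⟩ : p ∈ Set.range P := by rw [hP]; exact hp
    have hr0 : 0 < r := b.pos
    by_contra hr
    obtain rfl : r = 1 := by omega
    refine hne ?_
    rw [← hp, ← hb]
    refine f.finrank_zariskiTangent_of_unibranch (by omega) (f.isSoleInFibre_iff.2 fun p' hp' => ?_)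
      ((f.finrank_branchTangent_eq_two_iff _).1 (hrk _ ⟨b, rfl⟩))
    obtain ⟨b', rfl⟩ : p' ∈ Set.range P := by rw [hP]; exact hp'.trans (hPq b)
    rw [Subsingleton.elim b' b]
  obtain ⟨i₀, hi₀⟩ := exists_coord_ne_zero q.rep_nonzero
  set A : Fin (n + 1) → F := (q.rep i₀)⁻¹ • q.rep with hA
  have hA1 : A i₀ = 1 := by simp [hA, hi₀]
  have hA0 : A ≠ 0 := fun h => by simp [h] at hA1
  have hqA : q = Projectivization.mk F A hA0 := by
    conv_lhs => rw [← q.mk_rep]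
    rw [Projectivization.mk_eq_mk_iff']
    exact ⟨q.rep i₀, by rw [hA, smul_inv_smul₀ hi₀]⟩
  have hmem (p) : p ∈ Set.range P ↔ ∃ c : F, tupleEval f.comp p.rep = c • A := by
    rw [hP, Set.mem_preimage, Set.mem_singleton_iff, hqA, f.toFun_eq_mk_iff]
  have hvan (i b) : eval (P b).rep (f.comp i - C (A i) * f.comp i₀) = 0 := by
    obtain ⟨c, hc⟩ := (hmem _).1 ⟨b, rfl⟩
    have h1 := congrFun hc i
    have h2 := congrFun hc i₀
    simp only [tupleEval, Pi.smul_apply, smul_eq_mul, hA1] at h1 h2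
    rw [map_sub, map_mul, eval_C, h1, h2]
    ring
  have hfac (i) : ∃ Q : MvPolynomial (Fin 2) F, Q.IsHomogeneous (d - r) ∧
      f.comp i - C (A i) * f.comp i₀ = (∏ b, lineForm (P b).rep) * Q := by
    refine exists_eq_prod_lineForm_mul (fun b => (P b).rep_nonzero)
      (fun b b' h => eval_lineForm_ne_zero (hPinj.ne h)) ?_ (hvan i)
    rw [Nat.add_sub_cancel' hrd.le]
    exact (f.isHomogeneous_comp i).sub ((f.isHomogeneous_comp i₀).C_mul _)
  choose g hg hg' using hfac
  refine ⟨hr, A, i₀, P, g, hA1, hPinj, hmem, hg, fun i => ?_, ?_, fun b => hrk _ ⟨b, rfl⟩,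
    fun b b' h => hPinj (hinj ⟨b, rfl⟩ ⟨b', rfl⟩ h), ?_, fun p hp => ?_⟩
  · rw [← hg' i]
    ring
  · have := hg' i₀
    rw [hA1, C_1, one_mul, sub_self] at this
    exact (mul_eq_zero.1 this.symm).resolve_left
      (Finset.prod_ne_zero_iff.2 fun b _ => lineForm_ne_zero (P b).rep_nonzero)
  · rw [← hrank, iSup_range]
  · refine f.unibranch_of_finrank_zariskiTangent (by omega) hbir ?_
    by_contra hne
    have : f.toFun p ∈ singularLocus f.image := ⟨⟨p, rfl⟩, hne⟩
    rw [hsing] at this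
    exact hp (by rw [hP]; exact this)

namespace IsSeveriForm

variable {f : Mor F n d} {A : Fin (n + 1) → F} {i₀ : Fin (n + 1)} {P : Fin r → Proj F (Fin 2)}
  {g : Fin (n + 1) → MvPolynomial (Fin 2) F}

lemma tupleEval_eq (hf : IsSeveriForm f ℓ A i₀ P g) (x : Fin 2 → F) (i : Fin (n + 1)) :
    eval x (f.comp i) = A i * eval x (f.comp i₀) +
      eval x (∏ b, lineForm (P b).rep) * eval x (g i) := by
  conv_lhs => rw [hf.comp_eq]
  simp

lemma eval_prod_eq_zero_iff (p : Proj F (Fin 2)) :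
    eval p.rep (∏ b, lineForm (P b).rep) = 0 ↔ p ∈ Set.range P := by
  rw [map_prod, Finset.prod_eq_zero_iff]
  constructor
  · rintro ⟨b, _, hb⟩
    exact ⟨b, (eq_of_eval_lineForm_eq_zero hb).symm⟩
  · rintro ⟨b, rfl⟩
    exact ⟨b, Finset.mem_univ _, eval_lineForm_self _⟩

lemma exists_pderiv_prod_ne (hP : Function.Injective P) (b : Fin r) :
    ∃ j, eval (P b).rep (pderiv j (∏ b, lineForm (P b).rep)) ≠ 0 := by
  obtain ⟨j, hj⟩ := exists_pderiv_lineForm_ne_zero (P b).rep_nonzero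
  refine ⟨j, ?_⟩
  rw [← Finset.mul_prod_erase _ _ (Finset.mem_univ b), pderiv_mul, map_add, map_mul, map_mul,
    eval_lineForm_self, zero_mul, add_zero, map_prod]
  exact mul_ne_zero (hj _) (Finset.prod_ne_zero_iff.2 fun b' hb' =>
    eval_lineForm_ne_zero (hP.ne (Finset.ne_of_mem_erase hb')))

lemma branchTangent_eq (hf : IsSeveriForm f ℓ A i₀ P g) (b : Fin r) :
    f.branchTangent (P b) = Submodule.span F {A, tupleEval g (P b).rep} := by
  have hroot := (eval_prod_eq_zero_iff (P := P) (P b)).2 ⟨b, rfl⟩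
  refine f.branchTangent_eq_span hf.comp_eq hroot (fun h => ?_)
    (exists_pderiv_prod_ne hf.injective b)
  apply f.tupleEval_comp_ne_zero (P b).rep_nonzero
  funext i
  rw [tupleEval, hf.tupleEval_eq, h, hroot]
  simp

lemma tupleEval_slope_ne (hf : IsSeveriForm f ℓ A i₀ P g) (b : Fin r) :
    tupleEval g (P b).rep ≠ 0 := by
  intro h
  have h1 := hf.finrank_tangent b
  have h2 := finrank_span_singleton (K := F) (v := A) (fun h => by simpa [h] using hf.point_eq)
  rw [hf.branchTangent_eq, h, Set.pair_comm, Submodule.span_insert_zero] at h1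
  omega

lemma tupleEval_slope_apply (hf : IsSeveriForm f ℓ A i₀ P g) (x : Fin 2 → F) :
    tupleEval g x i₀ = 0 := by
  rw [tupleEval, hf.slope_eq, map_zero]

lemma slope_notMem_span (hf : IsSeveriForm f ℓ A i₀ P g) {b b' : Fin r} (hb : b ≠ b') :
    ¬ ∃ c : F, tupleEval g (P b').rep = c • tupleEval g (P b).rep := by
  rintro ⟨c, hc⟩
  apply hb
  apply hf.tangent_injective
  symm
  apply Submodule.eq_of_le_of_finrank_eq
  · simp only [hf.branchTangent_eq]
    rw [Submodule.span_le]
    rintro v (rfl | rfl)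
    · exact Submodule.subset_span (by simp)
    · rw [hc]
      exact Submodule.smul_mem _ _ (Submodule.subset_span (by simp))
  · simp only [hf.finrank_tangent]

/-- The branch tangents together span the line of A plus the span of the slopes. This sum is direct,
since the coordinate i₀ is 1 on A and 0 on the slopes, so the line of A accounts for one dimension.
-/
lemma finrank_span_slope (hf : IsSeveriForm f ℓ A i₀ P g) (hr : 0 < r) :
    Module.finrank F (Submodule.span F (Set.range fun b => tupleEval g (P b).rep)) = ℓ := by
  set W := Submodule.span F (Set.range fun b => tupleEval g (P b).rep) with hW
  have hsup : (⨆ b, f.branchTangent (P b)) = Submodule.span F {A} ⊔ W := by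
    apply le_antisymm
    · refine iSup_le fun b => ?_
      rw [hf.branchTangent_eq, Submodule.span_insert]
      exact sup_le_sup_left (Submodule.span_mono (by rintro _ rfl; exact ⟨b, rfl⟩)) _
    · refine sup_le ?_ ?_
      · refine le_iSup_of_le ⟨0, hr⟩ ?_
        rw [hf.branchTangent_eq]
        exact Submodule.span_mono (by simp)
      · rw [hW, Submodule.span_le]
        rintro _ ⟨b, rfl⟩
        refine (le_iSup (fun b => f.branchTangent (P b)) b) ?_
        rw [hf.branchTangent_eq]
        exact Submodule.subset_span (by simp)
  have hdisj : Submodule.span F {A} ⊓ W = ⊥ := by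
    rw [← disjoint_iff, Submodule.disjoint_def]
    intro v hv hvW
    obtain ⟨a, rfl⟩ := Submodule.mem_span_singleton.1 hv
    have h0 : W ≤ LinearMap.ker (LinearMap.proj (R := F) (φ := fun _ : Fin (n + 1) => F) i₀) := by
      rw [hW, Submodule.span_le]
      rintro _ ⟨b, rfl⟩
      exact hf.tupleEval_slope_apply _
    have := h0 hvW
    simp only [LinearMap.mem_ker, LinearMap.proj_apply, Pi.smul_apply, hf.point_eq, smul_eq_mul,
      mul_one] at this
    rw [this, zero_smul]
  have h1 := Submodule.finrank_sup_add_finrank_inf_eq (Submodule.span F {A}) W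
  rw [hdisj, ← hsup, hf.finrank_iSup, finrank_bot,
    finrank_span_singleton (fun h => by simpa [h] using hf.point_eq)] at h1
  omega

end IsSeveriForm
end RationalCurve

namespace RationalCurve

variable {F : Type*} [Field F] {n d r ℓ : ℕ}

lemma exists_ne_zero_of_rep {α : Type*} {φ : α → (Fin 2 → F) → F} (m : α → ℕ)
    (hm : ∀ a x c, φ a (c • x) = c ^ m a * φ a x)
    (h : ∀ p : Proj F (Fin 2), ∃ a, φ a p.rep ≠ 0) (x : Fin 2 → F) (hx : x ≠ 0) :
    ∃ a, φ a x ≠ 0 := by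
  obtain ⟨c, hc, h'⟩ := exists_smul_rep hx
  obtain ⟨a, ha⟩ := h (Projectivization.mk F x hx)
  exact ⟨a, by rw [h', hm]; exact mul_ne_zero (pow_ne_zero _ hc) ha⟩

namespace IsSeveriForm

variable {f : Mor F n d} {A : Fin (n + 1) → F} {i₀ : Fin (n + 1)} {P : Fin r → Proj F (Fin 2)}
  {g : Fin (n + 1) → MvPolynomial (Fin 2) F}

lemma bez_ne_zero (hf : IsSeveriForm f ℓ A i₀ P g) {p p' : Proj F (Fin 2)}
    (hp : p ∉ Set.range P) (hpp : p' ≠ p) :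
    ∃ i j, bez d (f.comp i) (f.comp j) p.rep p'.rep ≠ 0 := by
  by_contra! h
  obtain ⟨c, hc⟩ := exists_smul_of_forall_mul_eq (v := tupleEval f.comp p.rep)
    (w := tupleEval f.comp p'.rep) (f.tupleEval_comp_ne_zero p.rep_nonzero) fun i j => by
      have := mul_bez (f.isHomogeneous_comp i) (f.isHomogeneous_comp j) p.rep p'.rep
      rw [h, mul_zero] at this
      simp only [tupleEval]
      linear_combination -this
  exact hpp (f.isSoleInFibre_iff.1 (hf.unibranch p hp).1 p' (f.toFun_eq_toFun_iff.2 ⟨c, hc⟩))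

lemma bez_self_ne_zero [Infinite F] {p : Proj F (Fin 2)} (hp : IsImmersedAt f.comp p.rep) :
    ∃ i j, bez d (f.comp i) (f.comp j) p.rep p.rep ≠ 0 := by
  by_contra! h
  obtain ⟨k, hk⟩ := hp
  refine hk (exists_smul_of_forall_mul_eq (f.tupleEval_comp_ne_zero p.rep_nonzero) fun i j => ?_)
  have := bez_self (f.isHomogeneous_comp i) (f.isHomogeneous_comp j) p.rep k
  rw [h, mul_zero] at this
  simp only [tupleEval]
  linear_combination -this

lemma bez_swap_ne_zero {p p' : Proj F (Fin 2)} (hpp : p' ≠ p)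
    (h : ∃ i j, bez d (f.comp i) (f.comp j) p.rep p'.rep ≠ 0) :
    ∃ i j, bez d (f.comp i) (f.comp j) p'.rep p.rep ≠ 0 := by
  obtain ⟨i, j, hij⟩ := h
  refine ⟨i, j, fun h0 => mul_ne_zero (eval_lineForm_ne_zero hpp.symm) hij ?_⟩
  rw [eval_lineForm, mul_bez (f.isHomogeneous_comp i) (f.isHomogeneous_comp j)]
  have := mul_bez (f.isHomogeneous_comp i) (f.isHomogeneous_comp j) p'.rep p.rep
  rw [h0, mul_zero] at this
  linear_combination this

/-- The secant condition holds for different reasons: immersedness on the diagonal, injectivity of f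
for two points not both over A, and distinctness of the tangents for two points over A. For the
independence of the c_j and the multiples of h, a relation is first evaluated at the roots, then h
is cancelled. -/
theorem isAdmissible [IsAlgClosed F] (hf : IsSeveriForm f ℓ A i₀ P g)
    {u : Param n d r ℓ → F} (hA : ∀ i, u (.point i) = A i)
    (hroot : rootForm u = ∏ b, lineForm (P b).rep) (hslope : ∀ i, slopeForm u i = g i)
    (hparam : ∀ i, paramForm u i = f.comp i)
    (hdir0 : ∀ j, u (.dir i₀ j) = 0)
    (hdir : LinearIndependent F fun j i => u (.dir i j))
    (hspan : Submodule.span F (Set.range fun b => tupleEval (multForm u) (P b).rep) = ⊤) :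
    IsAdmissible u := by
  have : Infinite F := IsAlgClosed.instInfinite
  have hrt (p : Proj F (Fin 2)) : eval p.rep (rootForm u) = 0 ↔ p ∈ Set.range P := by
    rw [hroot, eval_prod_eq_zero_iff]
  refine ⟨fun x hx => ?_, ?_, ?_, ?_, ?_, ?_⟩
  · simp only [hparam]
    exact exists_coord_ne_zero (f.tupleEval_comp_ne_zero hx)
  · refine exists_ne_zero_of_rep (fun _ => d - r) (fun ij x c => ?_) fun p => ?_
    · rw [eval_smul_of_isHomogeneous (isHomogeneous_slopeForm u _),
        eval_smul_of_isHomogeneous (isHomogeneous_slopeForm u _)]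
      ring
    · by_contra! h
      have h0 (j) : eval p.rep (g j) = 0 := by
        have := h (i₀, j)
        simpa [hA, hf.point_eq, hslope, hf.slope_eq] using this
      have hp : p ∈ Set.range P := (hf.mem_range_iff p).2
          ⟨eval p.rep (f.comp i₀), funext fun i => by
        rw [tupleEval, hf.tupleEval_eq, h0, mul_zero, add_zero, mul_comm]
        rfl⟩
      obtain ⟨b, rfl⟩ := hp
      exact hf.tupleEval_slope_ne b (funext h0)
  · refine exists_ne_zero_of_rep (fun j => j.elim r fun _ => r - 1) (fun j x c => ?_) fun p => ?_
    · rcases j with _ | j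
      · exact eval_smul_of_isHomogeneous (isHomogeneous_binaryForm _) c x
      · exact eval_smul_of_isHomogeneous (isHomogeneous_binaryForm _).pderiv c x
    · by_cases hp : p ∈ Set.range P
      · obtain ⟨b, rfl⟩ := hp
        obtain ⟨j, hj⟩ := exists_pderiv_prod_ne hf.injective b
        exact ⟨some j, by rw [hroot]; exact hj⟩
      · exact ⟨none, fun h => hp ((hrt p).1 h)⟩
  · intro x hx y hy
    set p := Projectivization.mk F x hx with hpx
    set p' := Projectivization.mk F y hy with hpy
    obtain ⟨c, hc, hxp⟩ := exists_smul_rep hx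
    obtain ⟨c', hc', hyp⟩ := exists_smul_rep hy
    suffices h : ∃ a, secantCoord u p.rep p'.rep a ≠ 0 by
      obtain ⟨a, ha⟩ := h
      refine ⟨a, ?_⟩
      rw [hxp, hyp]
      rcases a with ⟨i, j⟩ | ⟨i, j, k⟩
      · simp only [secantCoord, bez_smul_left, bez_smul_right]
        exact mul_ne_zero (pow_ne_zero _ hc') (mul_ne_zero (pow_ne_zero _ hc) ha)
      · have := mul_ne_zero (pow_ne_zero (d - r - 1) hc)
          (mul_ne_zero (pow_ne_zero (d - r - 1) hc') ha)
        simp only [secantCoord, bez_smul_left, bez_smul_right] at this ⊢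
        convert this using 1
        ring
    have hin (h : ∃ i j, bez d (f.comp i) (f.comp j) p.rep p'.rep ≠ 0) :
        ∃ a, secantCoord u p.rep p'.rep a ≠ 0 := by
      obtain ⟨i, j, hij⟩ := h
      exact ⟨.inl (i, j), by simpa [secantCoord, hparam] using hij⟩
    by_cases hpp : p' = p
    · rw [hpp] at hin ⊢
      refine hin (bez_self_ne_zero ?_)
      by_cases hp : p ∈ Set.range P
      · obtain ⟨b, hb⟩ := hp
        rw [← hb, ← f.finrank_branchTangent_eq_two_iff]
        exact hf.finrank_tangent b
      · exact (hf.unibranch p hp).2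
    · by_cases hp : p ∈ Set.range P
      · by_cases hp' : p' ∈ Set.range P
        · obtain ⟨b, hb⟩ := hp
          obtain ⟨b', hb'⟩ := hp'
          rw [← hb, ← hb'] at hpp ⊢
          by_contra! h
          refine hf.slope_notMem_span (b := b) (b' := b') (fun h => hpp (by rw [h]))
            (exists_smul_of_forall_mul_eq (hf.tupleEval_slope_ne b) fun j k => ?_)
          have h0 := h (.inr (i₀, j, k))
          have hm (i j) := mul_bez (hf.homogeneous i) (hf.homogeneous j) (P b).rep (P b').rep
          have h1 := hm k i₀
          have h2 := hm i₀ j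
          simp only [hf.slope_eq, map_zero, mul_zero, zero_mul, sub_zero] at h1 h2
          simp only [secantCoord, hA, hf.point_eq, hslope, hf.slope_eq] at h0
          simp only [tupleEval]
          linear_combination ((P b).rep 0 * (P b').rep 1 - (P b).rep 1 * (P b').rep 0) * h0 -
            A j * h1 - A k * h2 - hm j k
        · exact hin (bez_swap_ne_zero (Ne.symm hpp) (hf.bez_ne_zero hp' (Ne.symm hpp)))
      · exact hin (hf.bez_ne_zero hp hpp)
  · rw [linearIndependent_option]
    refine ⟨hdir, fun hmem => ?_⟩
    have h0 : Submodule.span F (Set.range (frameVec u ∘ some)) ≤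
        LinearMap.ker (LinearMap.proj (R := F) (φ := fun _ : Fin (n + 1) => F) i₀) := by
      rw [Submodule.span_le]
      rintro _ ⟨j, rfl⟩
      exact hdir0 j
    have := h0 hmem
    simp [frameVec, hA, hf.point_eq] at this
  · rw [Fintype.linearIndependent_iff]
    intro c hc
    rw [Fintype.sum_sum_type] at hc
    have hhom : (∑ j, C (c (.inl j)) * multForm u j +
        rootForm u * ∑ m, C (c (.inr m)) * restMonomial d r m).IsHomogeneous (d - r) := by
      refine (IsHomogeneous.sum _ _ _ fun j _ => (isHomogeneous_binaryForm _).C_mul _).add ?_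
      rw [Finset.mul_sum]
      refine IsHomogeneous.sum _ _ _ fun m _ => ?_
      rw [mul_left_comm]
      exact (isHomogeneous_rootForm_mul_restMonomial u m).C_mul _
    have hz : ∑ j, C (c (.inl j)) * multForm u j +
        rootForm u * ∑ m, C (c (.inr m)) * restMonomial d r m = 0 := by
      rw [eq_sum_formCoeff hhom]
      refine Finset.sum_eq_zero fun k hk => ?_
      have := congrFun hc ⟨k, Finset.mem_range.1 hk⟩
      simp only [Pi.add_apply, Finset.sum_apply, Pi.smul_apply, smul_eq_mul, multCoeff,
        formCoeff, Pi.zero_apply] at this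
      simp only [formCoeff, coeff_add, Finset.mul_sum, coeff_sum, mul_left_comm (rootForm u),
        coeff_C_mul, this, C_0, zero_mul]
    have hl (j) : c (.inl j) = 0 := by
      have h0 : Submodule.span F (Set.range fun b => tupleEval (multForm u) (P b).rep) ≤
          LinearMap.ker (Fintype.linearCombination F fun j => c (.inl j)) := by
        rw [Submodule.span_le]
        rintro _ ⟨b, rfl⟩
        have := congrArg (eval (P b).rep) hz
        rw [map_add, map_mul, (hrt (P b)).2 ⟨b, rfl⟩, zero_mul, add_zero, map_sum, map_zero] at this
        simp only [map_mul, eval_C] at this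
        simpa [Fintype.linearCombination_apply, tupleEval, mul_comm] using this
      have h1 := h0 (hspan ▸ Submodule.mem_top (x := Pi.single j (1 : F)))
      simpa using h1
    have hr0 : rootForm u ≠ 0 := by
      rw [hroot]
      exact Finset.prod_ne_zero_iff.2 fun b _ => lineForm_ne_zero (P b).rep_nonzero
    simp only [hl, C_0, zero_mul, Finset.sum_const_zero, zero_add, mul_eq_zero, hr0,
      false_or] at hz
    rintro (j | m)
    · exact hl j
    · have := congrArg (formCoeff (d - 2 * r) m) hz
      rw [formCoeff, formCoeff, coeff_sum, coeff_zero] at this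
      simp only [coeff_C_mul] at this
      simp only [← formCoeff.eq_1 (d - 2 * r), formCoeff_restMonomial] at this
      simpa using this

/-- B is a basis e of the span W of the slopes, and c is g in the coordinates given by a linear left
inverse β of B. The difference g - ∑ B_j c_j vanishes at the roots of h, so it is a multiple h k.
All vectors of W and g itself vanish at i₀, which gives the normalization there. -/
theorem exists_param [IsAlgClosed F] (hrd : r < d) (hr : 0 < r)
    (hf : IsSeveriForm f ℓ A i₀ P g) :
    ∃ u : Param n d r ℓ → F, IsAdmissible u ∧ (∀ i, paramForm u i = f.comp i) ∧
      u (.point i₀) = 1 ∧ (∀ j, u (.dir i₀ j) = 0) ∧ ∀ m, u (.rest i₀ m) = 0 := by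
  set W := Submodule.span F (Set.range fun b => tupleEval g (P b).rep) with hW
  set e := Module.finBasisOfFinrankEq F W (hf.finrank_span_slope hr) with he
  have hWi (v) (hv : v ∈ W) : v i₀ = 0 := by
    have h0 : W ≤ LinearMap.ker (LinearMap.proj (R := F) (φ := fun _ : Fin (n + 1) => F) i₀) := by
      rw [hW, Submodule.span_le]
      rintro _ ⟨b, rfl⟩
      exact hf.tupleEval_slope_apply _
    exact h0 hv
  set T : (Fin ℓ → F) →ₗ[F] (Fin (n + 1) → F) := W.subtype ∘ₗ e.equivFun.symm.toLinearMap with hT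
  have hTs (j) : T (Pi.single j 1) = e j := by simp [hT]
  have hTinj : LinearMap.ker T = ⊥ := by
    rw [LinearMap.ker_eq_bot]
    exact W.injective_subtype.comp e.equivFun.symm.injective
  obtain ⟨β, hβ⟩ := LinearMap.exists_leftInverse_of_injective T hTinj
  have hTrange (v) (hv : v ∈ W) : T (β v) = v := by
    obtain ⟨a, rfl⟩ : ∃ a, T a = v := ⟨e.equivFun ⟨v, hv⟩, by simp [hT]⟩
    rw [← LinearMap.comp_apply β T, hβ, LinearMap.id_apply]
  have hTapp (a i) : T a i = ∑ j, (e j : Fin (n + 1) → F) i * a j := by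
    conv_lhs => rw [pi_eq_sum_univ' a, map_sum, Finset.sum_apply]
    simp only [map_smul, hTs, Pi.smul_apply, smul_eq_mul, mul_comm]
  have hβapp (v j) : β v j = ∑ i, β (Pi.single i 1) j * v i := by
    conv_lhs => rw [pi_eq_sum_univ' v, map_sum, Finset.sum_apply]
    simp only [map_smul, Pi.smul_apply, smul_eq_mul, mul_comm]
  set c : Fin ℓ → MvPolynomial (Fin 2) F := fun j => ∑ i, C (β (Pi.single i 1) j) * g i with hc
  have hchom (j) : (c j).IsHomogeneous (d - r) :=
    IsHomogeneous.sum _ _ _ fun i _ => (hf.homogeneous i).C_mul _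
  have hceval (x : Fin 2 → F) : tupleEval c x = β (tupleEval g x) := by
    funext j
    rw [hβapp]
    simp [tupleEval, hc]
  have hrem (i) : ∃ μ : Fin (d + 1 - 2 * r) → F,
      g i - ∑ j, C ((e j : Fin (n + 1) → F) i) * c j =
        ∑ m, C (μ m) * ((∏ b, lineForm (P b).rep) * restMonomial d r m) := by
    refine exists_eq_sum_mul_restMonomial hrd.le (fun b => (P b).rep_nonzero)
      (fun b b' h => eval_lineForm_ne_zero (hf.injective.ne h)) ((hf.homogeneous i).sub
      (IsHomogeneous.sum _ _ _ fun j _ => (hchom j).C_mul _)) fun b => ?_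
    have h1 := congrFun (hTrange (tupleEval g (P b).rep) (Submodule.subset_span ⟨b, rfl⟩)) i
    rw [hTapp, ← hceval] at h1
    simp only [tupleEval] at h1
    simp [← h1]
  choose μ hμ using hrem
  have hei (j) : (e j : Fin (n + 1) → F) i₀ = 0 := hWi _ (e j).2
  set u : Param n d r ℓ → F := fun
    | .point i => A i
    | .base k => formCoeff d k (f.comp i₀)
    | .root k => formCoeff r k (∏ b, lineForm (P b).rep)
    | .dir i j => (e j : Fin (n + 1) → F) i
    | .mult j k => formCoeff (d - r) k (c j)
    | .rest i m => if i = i₀ then 0 else μ i m with hu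
  have hbase : baseForm u = f.comp i₀ := binaryForm_formCoeff (f.isHomogeneous_comp i₀)
  have hroot : rootForm u = ∏ b, lineForm (P b).rep := by
    refine binaryForm_formCoeff ?_
    have := IsHomogeneous.prod Finset.univ (fun b : Fin r => lineForm (P b).rep) (fun _ => 1)
      fun b _ => isHomogeneous_lineForm _
    simpa using this
  have hmult (j) : multForm u j = c j := binaryForm_formCoeff (hchom j)
  have hslope (i) : slopeForm u i = g i := by
    rw [slopeForm]
    simp only [hmult]
    by_cases hi : i = i₀
    · subst hi
      simp [hu, hei, hf.slope_eq, restForm]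
    · rw [hroot, restForm, Finset.mul_sum]
      simp only [hu, if_neg hi, mul_left_comm (∏ b, lineForm (P b).rep)]
      rw [← hμ]
      ring
  have hparam (i) : paramForm u i = f.comp i := by
    rw [paramForm, hbase, hroot, hslope]
    exact (hf.comp_eq i).symm
  refine ⟨u, hf.isAdmissible (fun i => rfl) hroot hslope hparam hei ?_ ?_, hparam, hf.point_eq,
    hei, fun m => by simp [hu]⟩
  · exact e.linearIndependent.map' W.subtype (Submodule.ker_subtype W)
  · rw [eq_top_iff, ← LinearMap.range_id, ← hβ, LinearMap.range_comp]
    have h1 : LinearMap.range T ≤ W := by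
      rintro _ ⟨a, rfl⟩
      exact (e.equivFun.symm a).2
    refine (Submodule.map_mono h1).trans ?_
    rw [hW, Submodule.map_span, Submodule.span_le]
    rintro _ ⟨_, ⟨b, rfl⟩, rfl⟩
    rw [SetLike.mem_coe, ← hceval, show c = multForm u from funext fun j => (hmult j).symm]
    exact Submodule.subset_span ⟨b, rfl⟩

end IsSeveriForm
end RationalCurve

namespace RationalCurve

/-! ### Heights of primes whose zero sets contain many curves -/

section Height

variable {F : Type*} [Field F]

attribute [local instance] algebraMvPolynomial in
/-- A prime that meets the ring of coefficients trivially has height at most the number of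
variables. -/
lemma height_le_card_of_disjoint {S A : Type*} [Fintype S] [CommRing A] [IsDomain A]
    (Q : Ideal (MvPolynomial S A)) [Q.IsPrime] (hQ : ∀ a : A, C a ∈ Q → a = 0) :
    Q.height ≤ Fintype.card S := by
  set K := FractionRing A
  set M := (nonZeroDivisors A).map (C (σ := S)) with hM
  have hdisj : Disjoint (M : Set (MvPolynomial S A)) Q := by
    rw [Set.disjoint_left]
    rintro _ ⟨a, ha, rfl⟩ h
    exact nonZeroDivisors.ne_zero ha (hQ a h)
  have hloc : IsLocalization M (MvPolynomial S K) :=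
    MvPolynomial.isLocalization (nonZeroDivisors A) K
  rw [← IsLocalization.height_map_of_disjoint (S := MvPolynomial S K) M Q hdisj]
  have hprime := IsLocalization.isPrime_of_isPrime_disjoint M (MvPolynomial S K) Q ‹_› hdisj
  have h := Ideal.height_le_ringKrullDim_of_ne_top hprime.ne_top
  rw [MvPolynomial.ringKrullDim_of_isNoetherianRing, ringKrullDim_eq_zero_of_field, zero_add,
    Nat.card_eq_fintype_card] at h
  exact_mod_cast h

/-- The ring is viewed as a polynomial ring over F[κ] in the remaining variables, where Q meets the
coefficients trivially. -/
lemma height_add_card_le {ι κ : Type*} [Fintype ι] [Fintype κ] (a : κ → ι)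
    (ha : Function.Injective a) (Q : Ideal (MvPolynomial ι F)) [Q.IsPrime]
    (hQ : ∀ P : MvPolynomial κ F, rename a P ∈ Q → P = 0) :
    Q.height + Fintype.card κ ≤ Fintype.card ι := by
  classical
  set S := {i // i ∉ Set.range a}
  let e : ι ≃ S ⊕ κ := ((Equiv.sumComm S κ).trans ((Equiv.sumCongr (Equiv.ofInjective a ha)
    (Equiv.refl _)).trans (Equiv.Set.sumCompl (Set.range a)))).symm
  have he (k) : e (a k) = Sum.inr k := by
    rw [Equiv.symm_apply_eq]
    rfl
  let φ : MvPolynomial ι F ≃ₐ[F] MvPolynomial S (MvPolynomial κ F) :=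
    (renameEquiv F e).trans (sumAlgEquiv F S κ)
  have hφ (P : MvPolynomial κ F) : φ (rename a P) = C P := by
    have h : (φ : MvPolynomial ι F →ₐ[F] _).comp (rename a) =
        IsScalarTower.toAlgHom F (MvPolynomial κ F) (MvPolynomial S (MvPolynomial κ F)) := by
      ext k : 1
      simp [φ, he, MvPolynomial.algebraMap_eq]
    exact AlgHom.congr_fun h P
  set Q' := Q.comap φ.symm.toRingEquiv with hQ'
  have h1 : Q'.height = Q.height := φ.symm.toRingEquiv.height_comap Q
  have h2 := height_le_card_of_disjoint Q' fun P hP => hQ P (by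
    rw [hQ', Ideal.mem_comap] at hP
    have : φ.symm (C P) = rename a P := by rw [← hφ, AlgEquiv.symm_apply_apply]
    rw [← this]
    exact hP)
  have h3 : Fintype.card ι = Fintype.card S + Fintype.card κ := by
    rw [Fintype.card_congr e, Fintype.card_sum]
  rw [h3, ← h1]
  push_cast
  exact add_le_add_left h2 _

lemma exists_lowest_component {κ : Type*} {N : MvPolynomial κ F} (hN : N ≠ 0) :
    ∃ m, homogeneousComponent m N ≠ 0 ∧ ∀ i < m, homogeneousComponent i N = 0 := by
  classical
  have h : ∃ m, homogeneousComponent m N ≠ 0 := by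
    by_contra! h
    apply hN
    rw [← sum_homogeneousComponent N]
    exact Finset.sum_eq_zero fun i _ => h i
  exact ⟨Nat.find h, Nat.find_spec h, fun i hi => not_not.1 (Nat.find_min h hi)⟩

lemma aeval_X_mul_of_isHomogeneous {κ : Type*} {P : MvPolynomial κ F} {m : ℕ}
    (hP : P.IsHomogeneous m) (q : κ → Polynomial F) :
    aeval (fun k => Polynomial.X * q k) P = Polynomial.X ^ m * aeval q P := by
  rw [aeval_def, aeval_def, eval₂_eq, eval₂_eq, Finset.mul_sum]
  refine Finset.sum_congr rfl fun δ hδ => ?_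
  have hdeg : δ.degree = m := by
    by_contra h
    exact mem_support_iff.1 hδ (hP.coeff_eq_zero h)
  simp only [mul_pow, Finset.prod_mul_distrib, Finset.prod_pow_eq_pow_sum]
  rw [← Finsupp.degree_apply, hdeg]
  ring

/-- A polynomial that vanishes along curves through a point with arbitrary tangent direction is
zero. -/
lemma eq_zero_of_forall_curve [Infinite F] {κ : Type*} {P : MvPolynomial κ F} (a : κ → F)
    (h : ∀ z : κ → F, ∃ R : κ → Polynomial F, ∀ ε : F,
      eval (fun k => a k + ε * z k + ε ^ 2 * (R k).eval ε) P = 0) : P = 0 := by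
  set N : MvPolynomial κ F := aeval (fun k => X k + C (a k)) P with hN
  have hback : aeval (fun k => X k - C (a k)) N = P := by
    rw [hN, ← AlgHom.comp_apply]
    have : (aeval fun k => X k - C (a k)).comp (aeval fun k => X k + C (a k)) =
        AlgHom.id F (MvPolynomial κ F) := by
      ext k : 1
      simp [MvPolynomial.algHom_C, MvPolynomial.algebraMap_eq]
    rw [this, AlgHom.id_apply]
  by_contra hP
  have hN0 : N ≠ 0 := by
    intro h0
    rw [h0, map_zero] at hback
    exact hP hback.symm
  obtain ⟨m, hm, hlow⟩ := exists_lowest_component hN0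
  apply hm
  refine MvPolynomial.funext fun z => ?_
  rw [map_zero]
  obtain ⟨R, hR⟩ := h z
  set q : κ → Polynomial F := fun k => Polynomial.C (z k) + Polynomial.X * R k with hq
  have hz : aeval (fun k => Polynomial.X * q k) N = 0 := by
    refine Polynomial.funext fun ε => ?_
    rw [Polynomial.eval_zero, ← hR ε, hN, ← AlgHom.comp_apply]
    have : (Polynomial.evalRingHom ε).comp ((aeval fun k => Polynomial.X * q k).comp
        (aeval fun k => X k + C (a k))).toRingHom =
        eval fun k => a k + ε * z k + ε ^ 2 * (R k).eval ε := by
      ext k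
      · simp [MvPolynomial.algebraMap_eq]
      · simp [hq, MvPolynomial.algHom_C]
        ring
    exact RingHom.congr_fun this P
  -- Along the curve the lowest power of ε is ε ^ m, and its coefficient is the value at z of the
  -- lowest homogeneous component of N.
  have hcoeff := congrArg (fun p : Polynomial F => p.coeff m) hz
  beta_reduce at hcoeff
  rw [← sum_homogeneousComponent N, map_sum, Polynomial.finsetSum_coeff,
    Finset.sum_eq_single m, aeval_X_mul_of_isHomogeneous (homogeneousComponent_isHomogeneous m N),
    Polynomial.coeff_X_pow_mul', if_pos le_rfl, Nat.sub_self, Polynomial.coeff_zero,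
    Polynomial.coeff_zero_eq_eval_zero] at hcoeff
  · have : (Polynomial.evalRingHom 0).comp (aeval q).toRingHom = eval z := by
      ext k
      · simp
      · simp [hq]
    rw [← this]
    exact hcoeff
  · intro i _ hi
    rcases lt_or_gt_of_ne hi with hlt | hgt
    · rw [hlow i hlt, map_zero, Polynomial.coeff_zero]
    · rw [aeval_X_mul_of_isHomogeneous (homogeneousComponent_isHomogeneous i N),
        Polynomial.coeff_X_pow_mul', if_neg (by omega)]
  · intro hmem
    rw [homogeneousComponent_eq_zero _ _ (by simpa using hmem), map_zero, Polynomial.coeff_zero]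

/-- The height of a prime whose zero set contains, through some point, curves with tangent
directions filling the image of an injective linear map. -/
theorem height_add_card_le_of_curves [Infinite F] {ι τ : Type*} [Fintype ι] [Fintype τ]
    (Q : Ideal (MvPolynomial ι F)) [Q.IsPrime] (a : ι → F) (L : (τ → F) →ₗ[F] (ι → F))
    (hL : LinearMap.ker L = ⊥)
    (h : ∀ w, ∃ R : ι → Polynomial F, ∀ P ∈ Q, ∀ ε : F,
      eval (fun i => a i + ε * L w i + ε ^ 2 * (R i).eval ε) P = 0) :
    Q.height + Fintype.card τ ≤ Fintype.card ι := by
  classical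
  set v : ι → τ → F := fun i t => L (Pi.single t 1) i with hv
  have hLv (w i) : L w i = ∑ t, v i t * w t := by
    conv_lhs => rw [pi_eq_sum_univ' w, map_sum, Finset.sum_apply]
    simp only [map_smul, Pi.smul_apply, smul_eq_mul, mul_comm, hv]
  have hker {w : τ → F} (hw : ∀ u ∈ Submodule.span F (Set.range v), ∑ t, w t * u t = 0) :
      w = 0 := by
    refine LinearMap.ker_eq_bot'.1 hL w (funext fun i => ?_)
    rw [hLv, Pi.zero_apply, ← hw (v i) (Submodule.subset_span ⟨i, rfl⟩)]
    exact Finset.sum_congr rfl fun t _ => mul_comm _ _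
  have htop : Submodule.span F (Set.range v) = ⊤ := by
    rw [eq_top_iff]
    intro u _
    refine mem_of_forall_sum_mul_eq_zero _ fun φ hφ => ?_
    rw [hker hφ]
    simp
  -- The coordinates of L span the dual space, so a basis can be selected among them. In these
  -- coordinates L is bijective and the curves have every tangent direction; hence Q contains no
  -- nonzero polynomial in them. No separability is needed.
  obtain ⟨κ, b, hb, hspan, hli⟩ := exists_linearIndependent' F v
  rw [htop] at hspan
  have : Fintype κ := Fintype.ofInjective b hb
  have hcard : Fintype.card κ = Fintype.card τ := by
    have := finrank_span_eq_card hli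
    rw [hspan, finrank_top, Module.finrank_fintype_fun_eq_card] at this
    exact this.symm
  set L' : (τ → F) →ₗ[F] (κ → F) := (LinearMap.funLeft F F b).comp L with hL'
  have hsurj : Function.Surjective L' := by
    rw [← LinearMap.injective_iff_surjective_of_finrank_eq_finrank (by simp [hcard]),
      ← LinearMap.ker_eq_bot, LinearMap.ker_eq_bot']
    intro w hw
    refine hker fun u hu => ?_
    rw [htop, ← hspan] at hu
    induction hu using Submodule.span_induction with
    | mem u hu =>
      obtain ⟨k, rfl⟩ := hu
      have := congrFun hw k
      rw [hL', LinearMap.comp_apply, LinearMap.funLeft_apply, hLv] at this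
      rw [← Pi.zero_apply (M := fun _ => F) k, ← this]
      exact Finset.sum_congr rfl fun t _ => mul_comm _ _
    | zero => simp
    | add u u' _ _ h h' => simp [mul_add, Finset.sum_add_distrib, h, h']
    | smul c u _ h => simp [mul_left_comm _ c, ← Finset.mul_sum, h]
  rw [← hcard]
  refine height_add_card_le b hb Q fun P hP => ?_
  refine eq_zero_of_forall_curve (fun k => a (b k)) fun z => ?_
  obtain ⟨w, rfl⟩ := hsurj z
  obtain ⟨R, hR⟩ := h w
  refine ⟨fun k => R (b k), fun ε => ?_⟩
  have := hR _ hP ε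
  rw [eval_rename] at this
  exact this

end Height
end RationalCurve

namespace RationalCurve

/-! ### The Zariski topology, cone ideals and codimension -/

section Zariski

variable {F : Type*} [Field F] {n d : ℕ}

lemma Mor.exists_eval_ne_zero_of_isOpen {U : Set (Mor F n d)} (hU : IsOpen U) {f : Mor F n d}
    (hf : f ∈ U) : ∃ (G : MvPolynomial (Fin (n + 1) × Fin (d + 1)) F) (k : ℕ), G.IsHomogeneous k ∧
      eval f.1.rep G ≠ 0 ∧ ∀ f' : Mor F n d, eval f'.1.rep G ≠ 0 → f' ∈ U := by
  obtain ⟨V, hV, rfl⟩ := hU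
  suffices h : ∀ x ∈ V, ∃ (G : MvPolynomial (Fin (n + 1) × Fin (d + 1)) F) (k : ℕ),
      G.IsHomogeneous k ∧ eval x.rep G ≠ 0 ∧
        ∀ y : Proj F (Fin (n + 1) × Fin (d + 1)), eval y.rep G ≠ 0 → y ∈ V by
    obtain ⟨G, k, hG, h1, h2⟩ := h f.1 hf
    exact ⟨G, k, hG, h1, fun f' hf' => h2 _ hf'⟩
  clear hf f
  induction hV with
  | basic V hV =>
    obtain ⟨G, k, hG, rfl⟩ := hV
    exact fun x hx => ⟨G, k, hG, hx, fun y hy => hy⟩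
  | univ => exact fun x _ => ⟨1, 0, isHomogeneous_one _ _, by simp, fun _ _ => trivial⟩
  | inter V W _ _ h h' =>
    rintro x ⟨hx, hx'⟩
    obtain ⟨G, k, hG, h1, h2⟩ := h x hx
    obtain ⟨G', k', hG', h1', h2'⟩ := h' x hx'
    refine ⟨G * G', k + k', hG.mul hG', ?_, fun y hy => ?_⟩
    · rw [map_mul]
      exact mul_ne_zero h1 h1'
    · rw [map_mul] at hy
      exact ⟨h2 y (left_ne_zero_of_mul hy), h2' y (right_ne_zero_of_mul hy)⟩
  | sUnion S _ h =>
    rintro x ⟨V, hV, hx⟩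
    obtain ⟨G, k, hG, h1, h2⟩ := h V hV x hx
    exact ⟨G, k, hG, h1, fun y hy => ⟨V, hV, h2 y hy⟩⟩

lemma Mor.isOpen_eval_ne_zero {G : MvPolynomial (Fin (n + 1) × Fin (d + 1)) F} {k : ℕ}
    (hG : G.IsHomogeneous k) : IsOpen {f : Mor F n d | eval f.1.rep G ≠ 0} :=
  ⟨_, TopologicalSpace.GenerateOpen.basic _ ⟨G, k, hG, rfl⟩, rfl⟩

lemma lineMap_eq_sum {κ : Type*} (w : κ → F) (P : MvPolynomial κ F) :
    lineMap w P = ∑ k ∈ Finset.range (P.totalDegree + 1),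
      Polynomial.C (eval w (homogeneousComponent k P)) * Polynomial.X ^ k := by
  conv_lhs => rw [← sum_homogeneousComponent P, map_sum]
  exact Finset.sum_congr rfl fun k _ =>
    lineMap_of_isHomogeneous w (homogeneousComponent_isHomogeneous k P)

lemma lineMap_ne_zero_iff {κ : Type*} (w : κ → F) (P : MvPolynomial κ F) :
    lineMap w P ≠ 0 ↔ ∃ k, eval w (homogeneousComponent k P) ≠ 0 := by
  constructor
  · contrapose!
    intro h
    rw [lineMap_eq_sum]
    exact Finset.sum_eq_zero fun k _ => by rw [h, Polynomial.C_0, zero_mul]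
  · rintro ⟨k, hk⟩ h
    have hle : k ≤ P.totalDegree := by
      by_contra hlt
      rw [homogeneousComponent_eq_zero _ _ (by omega), map_zero] at hk
      exact hk rfl
    have := congrArg (fun p : Polynomial F => p.coeff k) (lineMap_eq_sum w P)
    simp only [h, Polynomial.coeff_zero, Polynomial.finsetSum_coeff, Polynomial.coeff_C_mul,
      Polynomial.coeff_X_pow, mul_ite, mul_one, mul_zero] at this
    rw [Finset.sum_ite_eq, if_pos (Finset.mem_range.2 (by omega))] at this
    exact hk this.symm

lemma Mor.isOpen_lineMap_ne_zero (P : MvPolynomial (Fin (n + 1) × Fin (d + 1)) F) :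
    IsOpen {f : Mor F n d | lineMap f.1.rep P ≠ 0} := by
  have : {f : Mor F n d | lineMap f.1.rep P ≠ 0} =
      ⋃ k, {f : Mor F n d | eval f.1.rep (homogeneousComponent k P) ≠ 0} := by
    ext f
    simp [lineMap_ne_zero_iff]
  rw [this]
  exact isOpen_iUnion fun k => isOpen_eval_ne_zero (homogeneousComponent_isHomogeneous k P)

/-- The ideal of the cone over a set of morphisms. -/
def coneIdeal (Y : Set (Mor F n d)) : Ideal (MvPolynomial (Fin (n + 1) × Fin (d + 1)) F) :=
  ⨅ f ∈ Y, RingHom.ker (lineMap f.1.rep)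

lemma mem_coneIdeal {Y : Set (Mor F n d)} {P : MvPolynomial (Fin (n + 1) × Fin (d + 1)) F} :
    P ∈ coneIdeal Y ↔ ∀ f ∈ Y, lineMap f.1.rep P = 0 := by
  simp [coneIdeal, Submodule.mem_iInf]

lemma isPrime_coneIdeal {Y : Set (Mor F n d)} (hY : IsIrreducible Y) : (coneIdeal Y).IsPrime := by
  constructor
  · intro h
    obtain ⟨f, hf⟩ := hY.nonempty
    have := mem_coneIdeal.1 ((Ideal.eq_top_iff_one _).1 h) f hf
    simp at this
  · intro P Q hPQ
    by_contra! h
    simp only [mem_coneIdeal, not_forall] at h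
    obtain ⟨⟨f, hf, hfP⟩, ⟨f', hf', hfQ⟩⟩ := h
    obtain ⟨f₁, hf₁, h1, h2⟩ := hY.isPreirreducible _ _ (Mor.isOpen_lineMap_ne_zero P)
      (Mor.isOpen_lineMap_ne_zero Q) ⟨f, hf, hfP⟩ ⟨f', hf', hfQ⟩
    have := mem_coneIdeal.1 hPQ f₁ hf₁
    rw [map_mul] at this
    exact mul_ne_zero h1 h2 this

lemma coneIdeal_lt {Y Y' : Set (Mor F n d)} (hY : IsClosed Y) (h : Y ⊂ Y') :
    coneIdeal Y' < coneIdeal Y := by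
  refine lt_of_le_of_ne (fun P hP => mem_coneIdeal.2 fun f hf => mem_coneIdeal.1 hP f (h.1 hf))
    fun heq => ?_
  obtain ⟨f, hf, hf'⟩ := Set.exists_of_ssubset h
  obtain ⟨G, k, hG, h1, h2⟩ := Mor.exists_eval_ne_zero_of_isOpen hY.isOpen_compl hf'
  have hmem : G ∈ coneIdeal Y := by
    refine mem_coneIdeal.2 fun f' hf'' => ?_
    rw [lineMap_of_isHomogeneous _ hG]
    have : eval f'.1.rep G = 0 := by
      by_contra h0
      exact h2 f' h0 hf''
    rw [this, Polynomial.C_0, zero_mul]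
  rw [← heq] at hmem
  have := mem_coneIdeal.1 hmem f hf
  rw [lineMap_of_isHomogeneous _ hG] at this
  simp [h1] at this

/-- Taking cone ideals turns chains of irreducible closed sets above Z into chains of primes below
the ideal of Z. They stay strict because closed sets are separated from points by homogeneous
polynomials. -/
theorem codim_le_height_coneIdeal (Z : TopologicalSpace.IrreducibleCloseds (Mor F n d)) :
    codim Z ≤ (coneIdeal (Z : Set (Mor F n d))).height := by
  let φ : TopologicalSpace.IrreducibleCloseds (Mor F n d) →
      (PrimeSpectrum (MvPolynomial (Fin (n + 1) × Fin (d + 1)) F))ᵒᵈ :=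
    fun Y => OrderDual.toDual ⟨coneIdeal (Y : Set (Mor F n d)), isPrime_coneIdeal Y.isIrreducible⟩
  have hφ : StrictMono φ := fun Y Y' h => coneIdeal_lt Y.isClosed h
  exact (Order.coheight_le_coheight_apply_of_strictMono φ hφ Z).trans
    (le_of_eq (PrimeSpectrum.height_eq_orderHeight _).symm)

end Zariski

/-! ### Irreducibility of the Severi locus -/

section Component

variable {F : Type*} [Field F] {n d r ℓ : ℕ}

lemma ZOpen.inter_nonempty [Infinite F] {ι : Type*} {S T : Set (ι → F)} (hS : ZOpen S)
    (hT : ZOpen T) (hS' : S.Nonempty) (hT' : T.Nonempty) : (S ∩ T).Nonempty := by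
  obtain ⟨u, hu⟩ := hS'
  obtain ⟨v, hv⟩ := hT'
  obtain ⟨P, hP, hPS⟩ := hS u hu
  obtain ⟨Q, hQ, hQT⟩ := hT v hv
  have hne : P * Q ≠ 0 := by
    refine mul_ne_zero ?_ ?_
    · rintro rfl
      simp at hP
    · rintro rfl
      simp at hQ
  obtain ⟨w, hw⟩ : ∃ w, eval w (P * Q) ≠ 0 := by
    by_contra! h
    exact hne (MvPolynomial.funext fun w => by rw [h, map_zero])
  rw [map_mul] at hw
  exact ⟨w, hPS w (left_ne_zero_of_mul hw), hQT w (right_ne_zero_of_mul hw)⟩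

/-- The coefficients of the forms with given parameters. -/
def paramCoeff (u : Param n d r ℓ → F) (ik : Fin (n + 1) × Fin (d + 1)) : F :=
  formCoeff d ik.2 (paramForm u ik.1)

lemma isPolyFun_paramCoeff (ik : Fin (n + 1) × Fin (d + 1)) :
    IsPolyFun fun u : Param n d r ℓ → F => paramCoeff u ik :=
  isPolyForm_paramForm ik.1 _

lemma binaryForm_paramCoeff (hr : r ≤ d) (u : Param n d r ℓ → F) (i : Fin (n + 1)) :
    binaryForm (fun k => paramCoeff u (i, k)) = paramForm u i := by
  simp only [paramCoeff]
  exact binaryForm_formCoeff (isHomogeneous_paramForm u hr i)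

lemma binaryForm_smul (t : F) (a : Fin (d + 1) → F) :
    binaryForm (fun k => t * a k) = C t * binaryForm a := by
  simp [binaryForm, Finset.mul_sum, mul_assoc]

lemma IsAdmissible.exists_mor {u : Param n d r ℓ → F} (hu : IsAdmissible u) (hr : r ≤ d) :
    ∃ (f : Mor F n d) (t : F), t ≠ 0 ∧ f.1.rep = t • paramCoeff u ∧
      ∀ i, f.comp i = C t * paramForm u i := by
  have h0 : paramCoeff u ≠ 0 := by
    intro h
    obtain ⟨i, hi⟩ := hu.param_ne ![1, 0] (fun h => one_ne_zero (congrFun h 0))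
    rw [← binaryForm_paramCoeff hr, h] at hi
    simp [binaryForm] at hi
  obtain ⟨t, ht, hrep⟩ := exists_rep_mk h0
  have hform (i) : binaryForm (fun k => (Projectivization.mk F _ h0).rep (i, k)) =
      C t * paramForm u i := by
    rw [hrep, ← binaryForm_paramCoeff hr, ← binaryForm_smul]
    rfl
  refine ⟨⟨Projectivization.mk F _ h0, fun p => ?_⟩, t, ht, hrep, hform⟩
  obtain ⟨i, hi⟩ := hu.param_ne p.rep p.rep_nonzero
  exact ⟨i, by rw [hform, map_mul, eval_C]; exact mul_ne_zero ht hi⟩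

lemma rep_eq_paramCoeff {u : Param n d r ℓ → F} {f : Mor F n d}
    (h : ∀ i, paramForm u i = f.comp i) : f.1.rep = paramCoeff u := by
  funext ⟨i, k⟩
  rw [paramCoeff, h, Mor.comp]
  have := formCoeff_sum (m := d) (fun l => if hl : l < d + 1 then f.1.rep (i, ⟨l, hl⟩) else 0)
    (Nat.le_of_lt_succ k.2)
  rw [← Fin.sum_univ_eq_sum_range
    (fun l => (C (if hl : l < d + 1 then f.1.rep (i, ⟨l, hl⟩) else 0) *
    X 0 ^ (d - l) * X 1 ^ l : MvPolynomial (Fin 2) F))] at this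
  simp only [Fin.is_lt, dif_pos, Fin.eta] at this
  exact this.symm

lemma IsComponent.severi_nonempty {Z : TopologicalSpace.IrreducibleCloseds (Mor F n d)}
    (hZ : IsComponent (severi F n d r ℓ) Z) : (severi F n d r ℓ).Nonempty := by
  obtain ⟨f, hf⟩ := Z.isIrreducible.nonempty
  exact closure_nonempty_iff.1 ⟨f, hZ.prop hf⟩

variable [IsAlgClosed F]

lemma exists_isAdmissible_of_mem_severi (hrd : r < d) {f : Mor F n d}
    (hf : f ∈ severi F n d r ℓ) : 2 ≤ r ∧ ∃ i₀, ∃ u : Param n d r ℓ → F, IsAdmissible u ∧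
      (∀ i, paramForm u i = f.comp i) ∧ u (.point i₀) = 1 ∧ (∀ j, u (.dir i₀ j) = 0) ∧
      ∀ m, u (.rest i₀ m) = 0 := by
  obtain ⟨hr, A, i₀, P, g, h⟩ := exists_isSeveriForm hrd hf
  exact ⟨hr, i₀, h.exists_param hrd (by omega)⟩

/-- Open sets that meet the locus pull back to nonempty open sets of parameters. In affine space
over an infinite field these meet each other and the admissible set. -/
lemma isPreirreducible_severi (hrd : r < d) : IsPreirreducible (severi F n d r ℓ) := by
  have : Infinite F := IsAlgClosed.instInfinite
  rintro U V hU hV ⟨f, hf, hfU⟩ ⟨f', hf', hfV⟩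
  obtain ⟨hr, _, u, hu, huf, -⟩ := exists_isAdmissible_of_mem_severi hrd hf
  obtain ⟨-, _, u', hu', huf', -⟩ := exists_isAdmissible_of_mem_severi hrd hf'
  obtain ⟨G, k, hG, hGf, hGU⟩ := Mor.exists_eval_ne_zero_of_isOpen hU hfU
  obtain ⟨G', k', hG', hGf', hGV⟩ := Mor.exists_eval_ne_zero_of_isOpen hV hfV
  rw [rep_eq_paramCoeff huf] at hGf
  rw [rep_eq_paramCoeff huf'] at hGf'
  have hzo (G : MvPolynomial (Fin (n + 1) × Fin (d + 1)) F) :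
      ZOpen {u : Param n d r ℓ → F | eval (paramCoeff u) G ≠ 0} :=
    ZOpen.ne_zero ((IsPolyFun.of_eval G).comp isPolyFun_paramCoeff)
  obtain ⟨w, ⟨hw, hwG⟩, hwG'⟩ :=
    ((zOpen_isAdmissible hrd.le).inter (hzo G)).inter_nonempty (hzo G')
      ((zOpen_isAdmissible hrd.le).inter_nonempty (hzo G) ⟨u, hu⟩ ⟨u, hGf⟩) ⟨u', hGf'⟩
  obtain ⟨f₁, t, ht, hrep, hcomp⟩ := IsAdmissible.exists_mor hw hrd.le
  refine ⟨f₁, IsAdmissible.mem_severi hw hrd hr ht hcomp, hGU _ ?_, hGV _ ?_⟩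
  · rw [hrep, eval_smul_of_isHomogeneous hG]
    exact mul_ne_zero (pow_ne_zero _ ht) hwG
  · rw [hrep, eval_smul_of_isHomogeneous hG']
    exact mul_ne_zero (pow_ne_zero _ ht) hwG'

/-- A component of the closure of the Severi locus contains the Severi locus. -/
lemma IsComponent.severi_subset (hrd : r < d)
    {Z : TopologicalSpace.IrreducibleCloseds (Mor F n d)}
    (hZ : IsComponent (severi F n d r ℓ) Z) : severi F n d r ℓ ⊆ Z := by
  have hirr : IsIrreducible (closure (severi F n d r ℓ)) :=
    ⟨hZ.severi_nonempty.closure, (isPreirreducible_severi hrd).closure⟩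
  exact subset_closure.trans (hZ.le_of_ge
    (y := ⟨closure (severi F n d r ℓ), hirr, isClosed_closure⟩) le_rfl hZ.prop)

/-- The polynomial vanishes at all admissible parameters, and these are dense in the parameter
space. -/
theorem eval_paramCoeff_eq_zero (hrd : r < d)
    {Z : TopologicalSpace.IrreducibleCloseds (Mor F n d)}
    (hZ : IsComponent (severi F n d r ℓ) Z) {P : MvPolynomial (Fin (n + 1) × Fin (d + 1)) F}
    (hP : P ∈ coneIdeal (Z : Set (Mor F n d))) (u : Param n d r ℓ → F) :
    eval (paramCoeff u) P = 0 := by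
  have : Infinite F := IsAlgClosed.instInfinite
  obtain ⟨f₀, hf₀⟩ := hZ.severi_nonempty
  obtain ⟨hr, _, u₀, hu₀, -⟩ := exists_isAdmissible_of_mem_severi hrd hf₀
  by_contra hne
  obtain ⟨w, hw, hwP⟩ := (zOpen_isAdmissible hrd.le).inter_nonempty
    (ZOpen.ne_zero ((IsPolyFun.of_eval P).comp isPolyFun_paramCoeff)) ⟨u₀, hu₀⟩ ⟨u, hne⟩
  obtain ⟨f, t, ht, hrep, hcomp⟩ := IsAdmissible.exists_mor hw hrd.le
  have h := mem_coneIdeal.1 hP f (hZ.severi_subset hrd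
    (IsAdmissible.mem_severi hw hrd hr ht hcomp))
  apply hwP
  have h1 := eval_lineMap f.1.rep P t⁻¹
  rw [h, Polynomial.eval_zero, hrep, inv_smul_smul₀ ht] at h1
  exact h1.symm

end Component
end RationalCurve

namespace RationalCurve

/-! ### The differential of the parametrization -/

section Derivative

variable {F : Type*} [Field F] {n d r ℓ : ℕ}

lemma binaryForm_add_mul (a b : Fin (d + 1) → F) (t : F) :
    binaryForm (fun k => a k + t * b k) = binaryForm a + C t * binaryForm b := by
  rw [← binaryForm_smul]
  simp [binaryForm, add_mul, Finset.sum_add_distrib]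

variable (u w : Param n d r ℓ → F)

/-- The derivative of `slopeForm` at `u` in the direction `w`. -/
def slopeDeriv (i : Fin (n + 1)) : MvPolynomial (Fin 2) F :=
  ∑ j, (C (w (.dir i j)) * multForm u j + C (u (.dir i j)) * multForm w j) +
    rootForm w * restForm u i + rootForm u * restForm w i

/-- The derivative of `paramForm` at `u` in the direction `w`. -/
def paramDeriv (i : Fin (n + 1)) : MvPolynomial (Fin 2) F :=
  C (w (.point i)) * baseForm u + C (u (.point i)) * baseForm w + rootForm w * slopeForm u i +
    rootForm u * slopeDeriv u w i

lemma restForm_add_mul (t : F) (i : Fin (n + 1)) :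
    restForm (fun s => u s + t * w s) i = restForm u i + C t * restForm w i := by
  simp only [restForm, C_add, C_mul, add_mul, Finset.sum_add_distrib, Finset.mul_sum, mul_assoc]

lemma slopeForm_add_mul (t : F) (i : Fin (n + 1)) :
    slopeForm (fun s => u s + t * w s) i =
      slopeForm u i + C t * slopeDeriv u w i + C t ^ 2 * slopeForm w i := by
  have hm (j) : multForm (fun s => u s + t * w s) j = multForm u j + C t * multForm w j :=
    binaryForm_add_mul _ _ _
  have hr : rootForm (fun s => u s + t * w s) = rootForm u + C t * rootForm w :=
    binaryForm_add_mul _ _ _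
  have hs : ∑ j, C (u (.dir i j) + t * w (.dir i j)) * (multForm u j + C t * multForm w j) =
      ∑ j, C (u (.dir i j)) * multForm u j +
      C t * ∑ j, (C (w (.dir i j)) * multForm u j + C (u (.dir i j)) * multForm w j) +
      C t ^ 2 * ∑ j, C (w (.dir i j)) * multForm w j := by
    rw [Finset.mul_sum, Finset.mul_sum, ← Finset.sum_add_distrib, ← Finset.sum_add_distrib]
    refine Finset.sum_congr rfl fun j _ => ?_
    rw [C_add, C_mul]
    ring
  simp only [slopeForm, slopeDeriv, restForm_add_mul, hm, hr, hs]
  ring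

lemma paramForm_add_mul (t : F) (i : Fin (n + 1)) :
    paramForm (fun s => u s + t * w s) i = paramForm u i + C t * paramDeriv u w i +
      C t ^ 2 * (C (w (.point i)) * baseForm w + rootForm w * slopeDeriv u w i +
        rootForm u * slopeForm w i + C t * (rootForm w * slopeForm w i)) := by
  have hb : baseForm (fun s => u s + t * w s) = baseForm u + C t * baseForm w :=
    binaryForm_add_mul _ _ _
  have hr : rootForm (fun s => u s + t * w s) = rootForm u + C t * rootForm w :=
    binaryForm_add_mul _ _ _
  simp only [paramForm, slopeForm_add_mul, hb, hr, paramDeriv, C_add, C_mul]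
  ring

lemma slopeDeriv_add_mul (v : Param n d r ℓ → F) (t : F) (i : Fin (n + 1)) :
    slopeDeriv u (fun s => v s + t * w s) i = slopeDeriv u v i + C t * slopeDeriv u w i := by
  have hm (j) : multForm (fun s => v s + t * w s) j = multForm v j + C t * multForm w j :=
    binaryForm_add_mul _ _ _
  have hr : rootForm (fun s => v s + t * w s) = rootForm v + C t * rootForm w :=
    binaryForm_add_mul _ _ _
  have hs : ∑ j, (C (v (.dir i j) + t * w (.dir i j)) * multForm u j +
        C (u (.dir i j)) * (multForm v j + C t * multForm w j)) =
      ∑ j, (C (v (.dir i j)) * multForm u j + C (u (.dir i j)) * multForm v j) +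
      C t * ∑ j, (C (w (.dir i j)) * multForm u j + C (u (.dir i j)) * multForm w j) := by
    rw [Finset.mul_sum, ← Finset.sum_add_distrib]
    refine Finset.sum_congr rfl fun j _ => ?_
    rw [C_add, C_mul]
    ring
  simp only [slopeDeriv, restForm_add_mul, hm, hr, hs]
  ring

lemma paramDeriv_add_mul (v : Param n d r ℓ → F) (t : F) (i : Fin (n + 1)) :
    paramDeriv u (fun s => v s + t * w s) i = paramDeriv u v i + C t * paramDeriv u w i := by
  have hb : baseForm (fun s => v s + t * w s) = baseForm v + C t * baseForm w :=
    binaryForm_add_mul _ _ _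
  have hr : rootForm (fun s => v s + t * w s) = rootForm v + C t * rootForm w :=
    binaryForm_add_mul _ _ _
  simp only [paramDeriv, slopeDeriv_add_mul, hb, hr, C_add, C_mul]
  ring

lemma isHomogeneous_rootForm_mul_restForm (i : Fin (n + 1)) :
    (rootForm u * restForm w i).IsHomogeneous (d - r) := by
  rw [restForm, Finset.mul_sum]
  refine IsHomogeneous.sum _ _ _ fun k _ => ?_
  rw [mul_left_comm]
  exact (isHomogeneous_rootForm_mul_restMonomial u k).C_mul _

lemma isHomogeneous_paramDeriv (hr : r ≤ d) (i : Fin (n + 1)) :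
    (paramDeriv u w i).IsHomogeneous d := by
  have hs : (slopeDeriv u w i).IsHomogeneous (d - r) :=
    ((IsHomogeneous.sum _ _ _ fun j _ => ((isHomogeneous_binaryForm _).C_mul _).add
      ((isHomogeneous_binaryForm _).C_mul _)).add (isHomogeneous_rootForm_mul_restForm w u i)).add
      (isHomogeneous_rootForm_mul_restForm u w i)
  have h1 := (isHomogeneous_binaryForm fun k => w (.root k)).mul (isHomogeneous_slopeForm u i)
  have h2 := (isHomogeneous_binaryForm fun k => u (.root k)).mul hs
  rw [Nat.add_sub_cancel' hr] at h1 h2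
  exact ((((isHomogeneous_binaryForm _).C_mul _).add ((isHomogeneous_binaryForm _).C_mul _)).add
    h1).add h2

/-- The derivative of `paramCoeff` at `u`. -/
def paramCoeffDeriv : (Param n d r ℓ → F) →ₗ[F] (Fin (n + 1) × Fin (d + 1) → F) where
  toFun w ik := formCoeff d ik.2 (paramDeriv u w ik.1)
  map_add' v w := by
    funext ik
    have := paramDeriv_add_mul u w v 1 ik.1
    simp only [one_mul, C_1] at this
    change formCoeff d ik.2 (paramDeriv u (fun s => v s + w s) ik.1) = _
    rw [this]
    simp [formCoeff]
  map_smul' t w := by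
    funext ik
    have h0 := paramDeriv_add_mul u 0 (0 : Param n d r ℓ → F) (-1) ik.1
    have h1 := paramDeriv_add_mul u w 0 t ik.1
    simp only [Pi.zero_apply, mul_zero, add_zero, zero_add, C_neg, C_1, neg_mul, one_mul,
      add_neg_cancel] at h0 h1
    change formCoeff d ik.2 (paramDeriv u (fun s => t * w s) ik.1) = _
    rw [h1, show paramDeriv u (0 : Param n d r ℓ → F) ik.1 = 0 from h0, zero_add]
    simp [formCoeff]

/-- The forms are of degree at most three in the parameters, so on a line the expansion ends with a
quadratic and a cubic term. Lines of parameters thus give the curves used in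
`height_add_card_le_of_curves`. -/
lemma exists_paramCoeff_add_mul : ∃ R : Fin (n + 1) × Fin (d + 1) → Polynomial F, ∀ t ik,
    paramCoeff (fun s => u s + t * w s) ik =
      paramCoeff u ik + t * paramCoeffDeriv u w ik + t ^ 2 * (R ik).eval t := by
  refine ⟨fun ik => Polynomial.C (formCoeff d ik.2 (C (w (.point ik.1)) * baseForm w +
    rootForm w * slopeDeriv u w ik.1 + rootForm u * slopeForm w ik.1)) +
    Polynomial.C (formCoeff d ik.2 (rootForm w * slopeForm w ik.1)) * Polynomial.X,
    fun t ik => ?_⟩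
  rw [paramCoeff, paramForm_add_mul, ← C_pow]
  simp only [formCoeff, coeff_add, coeff_C_mul, Polynomial.eval_add, Polynomial.eval_C,
    Polynomial.eval_mul, Polynomial.eval_X, paramCoeff, paramCoeffDeriv, LinearMap.coe_mk,
    AddHom.coe_mk]
  ring

end Derivative

/-! ### Injectivity of the differential on a slice -/

section Injective

variable {F : Type*} [Field F] {n d r ℓ : ℕ} {u w : Param n d r ℓ → F}

lemma binaryForm_eq_zero {a : Fin (d + 1) → F} (h : binaryForm a = 0) (k : Fin (d + 1)) :
    a k = 0 := by
  have h1 := formCoeff_sum (m := d) (fun l => if hl : l < d + 1 then a ⟨l, hl⟩ else 0)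
    (Nat.le_of_lt_succ k.2)
  rw [← Fin.sum_univ_eq_sum_range (fun l => (C (if hl : l < d + 1 then a ⟨l, hl⟩ else 0) *
    X 0 ^ (d - l) * X 1 ^ l : MvPolynomial (Fin 2) F))] at h1
  simp only [Fin.is_lt, dif_pos, Fin.eta] at h1
  rw [← h1]
  change formCoeff d k (binaryForm a) = 0
  rw [h, formCoeff, coeff_zero]

lemma IsAdmissible.eq_zero_of_sum_eq_zero (hu : IsAdmissible u) {a : Fin ℓ → F}
    {b : Fin (d + 1 - 2 * r) → F} (h : ∑ j, C (a j) * multForm u j +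
      rootForm u * ∑ m, C (b m) * restMonomial d r m = 0) : (∀ j, a j = 0) ∧ ∀ m, b m = 0 := by
  have hli := Fintype.linearIndependent_iff.1 hu.mult_indep (Sum.elim a b) (by
    funext k
    have := congrArg (formCoeff (d - r) k) h
    simp only [formCoeff, coeff_add, Finset.mul_sum, coeff_sum, mul_left_comm (rootForm u),
      coeff_C_mul, coeff_zero] at this
    simp only [Fintype.sum_sum_type, Sum.elim_inl, Sum.elim_inr, Finset.sum_apply,
      Pi.smul_apply, smul_eq_mul, multCoeff, formCoeff, this, Pi.zero_apply])
  exact ⟨fun j => hli (.inl j), fun m => hli (.inr m)⟩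

/-- The derivative of `paramForm` is injective on a slice of the space of parameters. -/
theorem IsAdmissible.eq_zero_of_paramDeriv [IsAlgClosed F] (hu : IsAdmissible u) (hrd : r ≤ d)
    (hr : 2 ≤ r) {i₀ : Fin (n + 1)} {k₀ : Fin (r + 1)} {I : Set (Fin (n + 1))}
    (hpt : u (.point i₀) = 1) (hdir : ∀ j, u (.dir i₀ j) = 0) (hrest : ∀ m, u (.rest i₀ m) = 0)
    (hk₀ : u (.root k₀) ≠ 0)
    (hI : ∀ v : Fin ℓ → F, (∀ i ∈ I, ∑ j, u (.dir i j) * v j = 0) → v = 0)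
    (hw0 : w (.point i₀) = 0) (hwk : w (.root k₀) = 0)
    (hwdir : ∀ i, i = i₀ ∨ i ∈ I → ∀ j, w (.dir i j) = 0)
    (hwrest : ∀ i, i = i₀ ∨ i ∈ I → ∀ m, w (.rest i m) = 0)
    (h : ∀ i, paramDeriv u w i = 0) : w = 0 := by
  have : Infinite F := IsAlgClosed.instInfinite
  -- By the normalization the component i₀ of f is b alone, and that of the derivative is the
  -- variation of b.
  have hbase : baseForm w = 0 := by
    have := h i₀
    simpa [paramDeriv, slopeDeriv, slopeForm, restForm, hw0, hpt, hdir, hrest,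
      hwdir i₀ (Or.inl rfl), hwrest i₀ (Or.inl rfl)] using this
  obtain ⟨c, p, hc, hp, hpp, hfac⟩ := hu.exists_roots
  have hroot (b) : eval (p b) (rootForm u) = 0 := by
    rw [hfac, map_mul, map_prod, Finset.prod_eq_zero (Finset.mem_univ b) (eval_lineForm_self _),
      mul_zero]
  have hev (b) (i) : w (.point i) * eval (p b) (baseForm u) +
      eval (p b) (rootForm w) * eval (p b) (slopeForm u i) = 0 := by
    have := congrArg (eval (p b)) (h i)
    simpa [paramDeriv, hbase, hroot] using this
  have hslope (b) (hne : ∀ i, eval (p b) (slopeForm u i) = 0) (b') (hb : b' ≠ b) : False := by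
    refine hu.slope_notMem_span hrd (hp b') (hp b) (hroot b') (hroot b) (hpp b' b hb) ?_
    rw [show tupleEval (slopeForm u) (p b) = 0 from funext hne]
    exact Submodule.zero_mem _
  have hother (b : Fin r) : ∃ b', b' ≠ b := by
    have : Nontrivial (Fin r) := Fin.nontrivial_iff_two_le.2 hr
    exact exists_ne b
  -- By `hev`, if the variation of h were nonzero at one root, the slope there would be a multiple
  -- of the slope at another root, but the tangents are distinct. This uses r ≥ 2.
  have hrootw (b) : eval (p b) (rootForm w) = 0 := by
    by_contra hne
    obtain ⟨b', hb⟩ := hother b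
    have hbase' := hu.baseForm_ne (hp b') (hroot b')
    refine hu.slope_notMem_span hrd (hp b') (hp b) (hroot b') (hroot b) (hpp b' b hb) ?_
    rw [Submodule.mem_span_pair]
    refine ⟨0, (eval (p b) (rootForm w))⁻¹ * eval (p b) (baseForm u) *
      (eval (p b') (baseForm u))⁻¹ * eval (p b') (rootForm w), ?_⟩
    funext i
    have h1 := hev b i
    have h2 := hev b' i
    simp only [zero_smul, zero_add, Pi.smul_apply, smul_eq_mul, tupleEval]
    field_simp
    linear_combination eval (p b) (baseForm u) * h2 - eval (p b') (baseForm u) * h1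
  have hpoint (i) : w (.point i) = 0 := by
    have h1 := hev ⟨0, by omega⟩ i
    rw [hrootw, zero_mul, add_zero] at h1
    exact (mul_eq_zero.1 h1).resolve_right (hu.baseForm_ne (hp _) (hroot _))
  -- A form of degree r with the same r roots is a scalar multiple of h, and the fixed coefficient
  -- k₀ forces the scalar to be 0.
  have hrootw' : rootForm w = 0 := by
    obtain ⟨Q, hQ, hQ'⟩ := exists_eq_prod_lineForm_mul (m := 0) hp hpp
      (isHomogeneous_binaryForm fun k => w (.root k)) hrootw
    obtain ⟨s, rfl⟩ : ∃ s, Q = C s := ⟨_, totalDegree_eq_zero_iff_eq_C.1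
      (Nat.le_zero.1 hQ.totalDegree_le)⟩
    have h1 : binaryForm (fun k => w (.root k) + -(s * c⁻¹) * u (.root k)) = 0 := by
      have hcc : (C c⁻¹ : MvPolynomial (Fin 2) F) * C c = 1 := by
        rw [← C_mul, inv_mul_cancel₀ hc, C_1]
      rw [binaryForm_add_mul, hQ', show binaryForm (fun k => u (.root k)) = _ from hfac, C_neg,
        C_mul]
      linear_combination (-(C s) * ∏ b, lineForm (p b)) * hcc
    have h2 := binaryForm_eq_zero h1 k₀
    rw [hwk, zero_add, mul_eq_zero, or_iff_left hk₀, neg_eq_zero, mul_eq_zero,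
      or_iff_left (inv_ne_zero hc)] at h2
    rw [rootForm, hQ', h2, C_0, mul_zero]
  have hr0 : rootForm u ≠ 0 := by
    rw [hfac]
    refine mul_ne_zero (fun h => hc (C_eq_zero.1 h)) ?_
    exact Finset.prod_ne_zero_iff.2 fun b _ => lineForm_ne_zero (hp b)
  have hs (i) : ∑ j, (C (w (.dir i j)) * multForm u j + C (u (.dir i j)) * multForm w j) +
      rootForm u * restForm w i = 0 := by
    have := h i
    simpa [paramDeriv, slopeDeriv, hbase, hpoint, hrootw', hr0] using this
  -- In the rows of I the matrix B has trivial kernel and neither B nor k varies, so the variation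
  -- of c vanishes. Then `mult_indep` takes care of the variations of B and k in the other rows.
  have hmult (j k) : w (.mult j k) = 0 := by
    refine congrFun (hI (fun j => w (.mult j k)) fun i hi => ?_) j
    have h1 := hs i
    simp only [hwdir i (Or.inr hi), C_0, zero_mul, zero_add, restForm, hwrest i (Or.inr hi),
      Finset.sum_const_zero, mul_zero, add_zero] at h1
    have h2 : binaryForm (fun k => ∑ j, u (.dir i j) * w (.mult j k)) = 0 := by
      rw [← h1]
      simp only [binaryForm, multForm, map_sum, C_mul, Finset.sum_mul, Finset.mul_sum]
      rw [Finset.sum_comm]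
      simp only [mul_assoc]
    exact binaryForm_eq_zero h2 k
  have hmult' (j) : multForm w j = 0 := by
    simp [multForm, binaryForm, hmult]
  have hfin (i) : (∀ j, w (.dir i j) = 0) ∧ ∀ m, w (.rest i m) = 0 := by
    apply hu.eq_zero_of_sum_eq_zero
    have := hs i
    simpa only [hmult', mul_zero, add_zero, restForm] using this
  funext s
  rcases s with i | k | k | ⟨i, j⟩ | ⟨j, k⟩ | ⟨i, m⟩
  · exact hpoint i
  · exact binaryForm_eq_zero hbase k
  · exact binaryForm_eq_zero hrootw' k
  · exact (hfin i).1 j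
  · exact hmult j k
  · exact (hfin i).2 m

end Injective
end RationalCurve

/-! ### Choice of the slice and the count of its dimension -/

namespace RationalCurve

variable {F : Type*} [Field F] {n d r ℓ : ℕ}

/-- The indices of a coordinate slice of the space of parameters. -/
abbrev SliceIndex (d r ℓ n : ℕ) (T : Finset (Fin (n + 1))) : Type :=
  Fin n ⊕ Fin (d + 1) ⊕ Fin r ⊕ ({i // i ∉ T} × Fin ℓ) ⊕ (Fin ℓ × Fin (d - r + 1)) ⊕
    ({i // i ∉ T} × Fin (d + 1 - 2 * r))

def sliceParam (i₀ : Fin (n + 1)) (k₀ : Fin (r + 1)) (T : Finset (Fin (n + 1))) :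
    SliceIndex d r ℓ n T → Param n d r ℓ
  | .inl i => .point (i₀.succAbove i)
  | .inr (.inl k) => .base k
  | .inr (.inr (.inl k)) => .root (k₀.succAbove k)
  | .inr (.inr (.inr (.inl (i, j)))) => .dir i j
  | .inr (.inr (.inr (.inr (.inl (j, k))))) => .mult j k
  | .inr (.inr (.inr (.inr (.inr (i, m))))) => .rest i m

lemma sliceParam_injective (i₀ : Fin (n + 1)) (k₀ : Fin (r + 1)) (T : Finset (Fin (n + 1))) :
    Function.Injective (sliceParam i₀ k₀ T : SliceIndex d r ℓ n T → Param n d r ℓ) := by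
  intro a b h
  rcases a with i | k | k | ⟨i, j⟩ | ⟨j, k⟩ | ⟨i, m⟩ <;>
    rcases b with i' | k' | k' | ⟨i', j'⟩ | ⟨j', k'⟩ | ⟨i', m'⟩ <;>
    simp only [sliceParam, reduceCtorEq, Param.point.injEq, Param.base.injEq, Param.root.injEq,
      Param.dir.injEq, Param.mult.injEq, Param.rest.injEq] at h
  · rw [Fin.succAbove_right_injective h]
  · rw [h]
  · rw [Fin.succAbove_right_injective h]
  · rw [Subtype.ext h.1, h.2]
  · rw [h.1, h.2]
  · rw [Subtype.ext h.1, h.2]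

/-- Rows of a matrix with independent columns that form an invertible submatrix. -/
lemma exists_rows {κ : Type*} [Fintype κ] {v : Fin ℓ → κ → F} (hv : LinearIndependent F v) :
    ∃ b : Fin ℓ → κ, Function.Injective b ∧ (∀ k, ∃ j, v j (b k) ≠ 0) ∧
      ∀ x : Fin ℓ → F, (∀ k, ∑ j, v j (b k) * x j = 0) → x = 0 := by
  have hker {x : Fin ℓ → F}
      (hx : ∀ y ∈ Submodule.span F (Set.range fun i j => v j i), ∑ j, x j * y j = 0) : x = 0 := by
    funext j
    refine Fintype.linearIndependent_iff.1 hv x (funext fun i => ?_) j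
    simpa using hx _ (Submodule.subset_span ⟨i, rfl⟩)
  have htop : Submodule.span F (Set.range fun i j => v j i) = ⊤ := by
    rw [eq_top_iff]
    intro y _
    refine mem_of_forall_sum_mul_eq_zero _ fun φ hφ => ?_
    rw [hker hφ]
    simp
  obtain ⟨κ', b, hb, hspan, hli⟩ := exists_linearIndependent' F fun i j => v j i
  rw [htop] at hspan
  have : Fintype κ' := Fintype.ofInjective b hb
  have hcard : Fintype.card κ' = ℓ := by
    have := finrank_span_eq_card hli
    rw [hspan, finrank_top, Module.finrank_fintype_fun_eq_card, Fintype.card_fin] at this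
    exact this.symm
  let e := Fintype.equivFinOfCardEq hcard
  refine ⟨fun k => b (e.symm k), hb.comp e.symm.injective, fun k => ?_, fun x hx => ?_⟩
  · exact exists_coord_ne_zero (hli.ne_zero (e.symm k))
  · refine hker fun y hy => ?_
    rw [htop, ← hspan] at hy
    induction hy using Submodule.span_induction with
    | mem y hy =>
      obtain ⟨k, rfl⟩ := hy
      have := hx (e k)
      beta_reduce at this
      rw [Equiv.symm_apply_apply] at this
      rw [← this]
      exact Finset.sum_congr rfl fun j _ => mul_comm _ _
    | zero => simp
    | add y y' _ _ h h' => simp [mul_add, Finset.sum_add_distrib, h, h']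
    | smul c y _ h => simp [mul_left_comm _ c, ← Finset.mul_sum, h]

/-- The slice fixes A at i₀, one coefficient of h, and the rows T of B and k, where T consists of i₀
and of ℓ rows in which B is invertible. The row i₀ is not among these ℓ rows because B vanishes
there. -/
theorem exists_card_slice_le [IsAlgClosed F] (hrd : r < d)
    {Z : TopologicalSpace.IrreducibleCloseds (Mor F n d)}
    (hZ : IsComponent (severi F n d r ℓ) Z) : ∃ T : Finset (Fin (n + 1)), T.card = ℓ + 1 ∧
      codim Z + Fintype.card (SliceIndex d r ℓ n T) ≤ (n + 1) * (d + 1) := by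
  classical
  have : Infinite F := IsAlgClosed.instInfinite
  obtain ⟨f, hf⟩ := hZ.severi_nonempty
  obtain ⟨hr, i₀, u, hu, -, hpt, hdir, hrest⟩ := exists_isAdmissible_of_mem_severi hrd hf
  obtain ⟨k₀, hk₀⟩ : ∃ k₀, u (.root k₀) ≠ 0 := by
    by_contra! h
    obtain ⟨j, hj⟩ := hu.root_ne ![1, 0] (fun h => one_ne_zero (congrFun h 0))
    have h0 : rootForm u = 0 := by simp [rootForm, binaryForm, h]
    rcases j with _ | j <;> simp [h0] at hj
  obtain ⟨b, hb, hb0, hbx⟩ := exists_rows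
    (hu.frame_indep.comp some (Option.some_injective _) : LinearIndependent F (frameVec u ∘ some))
  have hi₀ : i₀ ∉ Finset.univ.image b := by
    intro h
    obtain ⟨k, -, hk⟩ := Finset.mem_image.1 h
    obtain ⟨j, hj⟩ := hb0 k
    rw [hk] at hj
    exact hj (hdir j)
  set T : Finset (Fin (n + 1)) := insert i₀ (Finset.univ.image b) with hT
  refine ⟨T, by rw [hT, Finset.card_insert_of_notMem hi₀, Finset.card_image_of_injective _ hb,
    Finset.card_univ, Fintype.card_fin], ?_⟩
  set s : SliceIndex d r ℓ n T → Param n d r ℓ := sliceParam i₀ k₀ T with hs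
  set E := Function.ExtendByZero.linearMap F s with hE
  have hprime := isPrime_coneIdeal Z.isIrreducible
  have hmain := height_add_card_le_of_curves (coneIdeal (Z : Set (Mor F n d))) (paramCoeff u)
    ((paramCoeffDeriv u).comp E) ?_ ?_
  · refine (add_le_add_left (codim_le_height_coneIdeal Z) _).trans (hmain.trans (le_of_eq ?_))
    simp
  · rw [LinearMap.ker_eq_bot']
    intro w hw
    have hoff (a : Param n d r ℓ) (ha : ∀ t, s t ≠ a) : E w a = 0 :=
      Function.extend_apply' _ _ _ fun ⟨t, ht⟩ => ha t ht
    have hzero : E w = 0 := by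
      refine hu.eq_zero_of_paramDeriv hrd.le hr (I := Set.range b) hpt hdir hrest hk₀
        (fun v hv => hbx v fun k => hv _ ⟨k, rfl⟩) (hoff _ ?_) (hoff _ ?_)
        (fun i hi j => hoff _ ?_) (fun i hi m => hoff _ ?_) fun i => ?_
      · rintro (i | k | k | ⟨i, j⟩ | ⟨j, k⟩ | ⟨i, m⟩) <;> simp [hs, sliceParam, Fin.succAbove_ne]
      · rintro (i | k | k | ⟨i, j⟩ | ⟨j, k⟩ | ⟨i, m⟩) <;> simp [hs, sliceParam, Fin.succAbove_ne]
      · have hi' : i ∈ T := by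
          rw [hT]
          rcases hi with rfl | ⟨k, rfl⟩ <;> simp
        rintro (i | k | k | ⟨i, j⟩ | ⟨j, k⟩ | ⟨i, m⟩) <;> simp [hs, sliceParam]
        rintro rfl
        exact absurd hi' i.2
      · have hi' : i ∈ T := by
          rw [hT]
          rcases hi with rfl | ⟨k, rfl⟩ <;> simp
        rintro (i | k | k | ⟨i, j⟩ | ⟨j, k⟩ | ⟨i, m⟩) <;> simp [hs, sliceParam]
        rintro rfl
        exact absurd hi' i.2
      · rw [eq_sum_formCoeff (isHomogeneous_paramDeriv u (E w) hrd.le i)]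
        refine Finset.sum_eq_zero fun k hk => ?_
        have := congrFun hw (i, ⟨k, Finset.mem_range.1 hk⟩)
        rw [show formCoeff d k (paramDeriv u (E w) i) = 0 from this, C_0, zero_mul, zero_mul]
    funext t
    have := congrFun hzero (s t)
    rwa [hE, Function.ExtendByZero.linearMap_apply,
      (sliceParam_injective i₀ k₀ T).extend_apply] at this
  · intro w
    obtain ⟨R, hR⟩ := exists_paramCoeff_add_mul u (E w)
    refine ⟨R, fun P hP ε => ?_⟩
    rw [← eval_paramCoeff_eq_zero hrd hZ hP fun s => u s + ε * E w s]
    congr 2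
    funext ik
    exact (hR ε ik).symm

lemma card_sliceIndex (T : Finset (Fin (n + 1))) (hT : T.card = ℓ + 1) :
    ℓ ≤ n ∧ Fintype.card (SliceIndex d r ℓ n T) = n + (d + 1) + r + (n - ℓ) * ℓ +
      ℓ * (d - r + 1) + (n - ℓ) * (d + 1 - 2 * r) := by
  have h1 : T.card ≤ n + 1 := by simpa using T.card_le_univ
  have h2 : Fintype.card {i // i ∉ T} = n - ℓ := by
    rw [Fintype.card_subtype_compl, Fintype.card_coe, hT, Fintype.card_fin]
    omega
  refine ⟨by omega, ?_⟩
  simp only [Fintype.card_sum, Fintype.card_prod, Fintype.card_fin, h2]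
  ring

end RationalCurve

end

theorem lemma4p6 {F : Type*} [Field F] [IsAlgClosed F] (n d r ℓ : ℕ) (hd : r < d)
    (Z : TopologicalSpace.IrreducibleCloseds (RationalCurve.Mor F n d))
    (hZ : RationalCurve.IsComponent (RationalCurve.severi F n d r ℓ) Z) :
    ∃ c : ℕ, RationalCurve.codim Z = c ∧
      (c : ℤ) ≤ ((n : ℤ) - ℓ) * ((r : ℤ) - ℓ) + ((r : ℤ) - 1) * n - r := by
  obtain ⟨T, hT, hle⟩ := RationalCurve.exists_card_slice_le hd hZ
  obtain ⟨hℓ, hcard⟩ := RationalCurve.card_sliceIndex (d := d) (r := r) T hT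
  have hne : RationalCurve.codim Z ≠ ⊤ := by
    intro h
    rw [h, top_add] at hle
    exact absurd hle (by exact_mod_cast ENat.natCast_lt_top _ |>.not_ge)
  obtain ⟨c, hc⟩ := ENat.ne_top_iff_exists.1 hne
  refine ⟨c, hc.symm, ?_⟩
  rw [← hc, hcard] at hle
  have hle' : c + (n + (d + 1) + r + (n - ℓ) * ℓ + ℓ * (d - r + 1) +
      (n - ℓ) * (d + 1 - 2 * r)) ≤ (n + 1) * (d + 1) := by exact_mod_cast hle
  obtain ⟨s, rfl⟩ := Nat.exists_eq_add_of_le hℓ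
  obtain ⟨e, rfl⟩ := Nat.exists_eq_add_of_le hd.le
  -- For 2r > d the truncated number of coefficients of k is 0, which is at least the integer d + 1
  -- - 2r, so the bound holds without a case distinction.
  have h1 : r + e + 1 ≤ 2 * r + (r + e + 1 - 2 * r) := by omega
  have h2 := Nat.mul_le_mul_left s h1
  rw [Nat.add_sub_cancel_left, Nat.add_sub_cancel_left] at hle'
  clear hle hcard
  generalize r + e + 1 - 2 * r = m at *
  zify at hle' h2
  push_cast
  linarith
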